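/- All graphs are finite multigraphs (loops allowed), and a loop counts twice towards the valence of its vertex. A \emph{leaf} is a vertex of valence $1$, a \emph{trinode} is a vertex of valence $3$; a \emph{trivalent tree} is a finite tree with at least one edge all of whose vertices are leaves or trinodes. A graph $\Gamma$ is \emph{tree-like} if it is obtained from a trivalent tree by adding one loop at each vertex of some (possibly empty) set of leaves of the tree. Let the leaves of $\Gamma$ be labelled $1,\dots,n$ and let $\vec r=(r_1,\dots,r_n)$ be a vector of non-negative integers. We call $\vec r$ \emph{compatible} with $\Gamma$ if for every $i$ with $r_i$ odd there is $j\neq i$ with $r_j$ odd such that the leaf-edges at the leaves $i$ and $j$ share a vertex. For an integer $\ell\ge 0$ let $P_\Gamma(\vec r,\ell)\subset\mathbb R^{\mathrm{Edge}(\Gamma)}$ be the set of non-negative real edge weightings such that the edge at the $i$-th leaf has weight $r_i$ and, for every trinode with incident edge weights $w_1,w_2,w_3$ (a loop is listed twice), $|w_1-w_2|\le w_3\le w_1+w_2$ and $w_1+w_2+w_3\le 2\ell$. Lattice points are taken with respect to the lattice of integer edge weightings for which $w_1+w_2+w_3$ is even at every trinode. For $P=P_\Gamma(\vec r,\ell)$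 let $\mathbb C[P]$ be the graded semigroup algebra whose component of degree $m$ has as basis the lattice points of the $m$-fold Minkowski sum $mP$ (with $0P=\{0\}$), with multiplication given by addition of lattice points. Let $\mathbb C[X_P]$ be the polynomial ring with one variable for each lattice point of $P$, and let the toric ideal $I_P$ be the kernel of the natural map $\mathbb C[X_P]\to\mathbb C[P]$. \textbf{Theorem.} Let $\Gamma$ be tree-like, let $L>1$ be an integer, let $\vec r$ be compatible with $\Gamma$, and assume that $r_1+\dots+r_n$ is even. Then $\mathbb C[P_\Gamma(\vec r,2L)]$ is generated in degree $1$ (that is, the polytope is normal), and the ideal $I_{P_\Gamma(\vec r,2L)}$ is generated by polynomials of degree at most $3$. -/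

import Mathlib

open scoped Graph

namespace Graph

variable {α β : Type*}

/-- The half-edges of a multigraph at the vertex `v`: every edge incident to `v` contributes one,
and a loop at `v` contributes a second one. -/
abbrev HalfEdgeAt (Γ : Graph α β) (v : α) : Type _ :=
  {e : E(Γ) // Γ.Inc e v} ⊕ {e : E(Γ) // Γ.IsLoopAt e v}

/-- The edge to which a half-edge belongs. -/
def HalfEdgeAt.edge {Γ : Graph α β} {v : α} (h : Γ.HalfEdgeAt v) : E(Γ) :=
  Sum.elim Subtype.val Subtype.val h

/-- The valence of a vertex; a loop counts twice. -/
noncomputable def valence (Γ : Graph α β) (v : α) : ℕ := Nat.card (Γ.HalfEdgeAt v)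

/-- The leaves of a graph: its univalent vertices. -/
abbrev Leaf (Γ : Graph α β) : Type _ := {v : α // Γ.valence v = 1}

/-- A trivalent tree: a finite tree in which every vertex that is not a leaf has three neighbours.
-/
def _root_.SimpleGraph.IsTrivalentTree {V : Type*} (T : SimpleGraph V) : Prop :=
  Finite V ∧ T.IsTree ∧ ∀ v, (T.neighborSet v).ncard = 1 ∨ (T.neighborSet v).ncard = 3

/-- `Γ` is tree-like: it is obtained from a trivalent tree `T` by adding a loop at each vertex
of a set `S` of leaves of `T`. -/
def IsTreeLike (Γ : Graph α β) : Prop :=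
  ∃ (T : SimpleGraph V(Γ)) (S : Set V(Γ)),
    T.IsTrivalentTree ∧ (∀ v ∈ S, (T.neighborSet v).ncard = 1) ∧
    ∃ φ : T.edgeSet ⊕ S ≃ E(Γ),
      (∀ (e : T.edgeSet) (x y : V(Γ)),
        Γ.IsLink (φ (Sum.inl e)) x y ↔ (e : Sym2 V(Γ)) = s(x, y)) ∧
      (∀ (s : S) (x y : V(Γ)),
        Γ.IsLink (φ (Sum.inr s)) x y ↔ x = (s : V(Γ)) ∧ y = (s : V(Γ)))

/-- `r` (a weight for every labelled leaf) is compatible with `Γ`: the leaf-edge of a leaf with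
odd weight shares a vertex with the leaf-edge of another leaf with odd weight. -/
def IsCompatible (Γ : Graph α β) {n : ℕ} (leaf : Fin n ≃ Γ.Leaf) (r : Fin n → ℕ) : Prop :=
  ∀ i, Odd (r i) → ∃ j, j ≠ i ∧ Odd (r j) ∧
    ∃ (e f : β) (v : α), Γ.Inc e (leaf i) ∧ Γ.Inc f (leaf j) ∧ Γ.Inc e v ∧ Γ.Inc f v

/-- The polytope `P_Γ(r, ℓ)` of level `ℓ`, in the space of real edge weightings of `Γ`.
A bijection of `Fin 3` with the half-edges at `v` exists exactly when `v` is a trinode, and then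
lists the three edges at `v` (with a loop listed twice). -/
def weightPolytope (Γ : Graph α β) {n : ℕ} (leaf : Fin n ≃ Γ.Leaf) (r : Fin n → ℕ) (ℓ : ℕ) :
    Set (E(Γ) → ℝ) :=
  {w | (∀ e, 0 ≤ w e) ∧
    (∀ (v : α) (h : Fin 3 ≃ Γ.HalfEdgeAt v),
      |w (h 0).edge - w (h 1).edge| ≤ w (h 2).edge ∧
      w (h 2).edge ≤ w (h 0).edge + w (h 1).edge ∧
      w (h 0).edge + w (h 1).edge + w (h 2).edge ≤ 2 * ℓ) ∧
    ∀ (i : Fin n) (e : E(Γ)), Γ.Inc e (leaf i) → w e = r i}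

/-- The lattice of integer edge weightings with even sum at every trinode. -/
def weightLattice (Γ : Graph α β) : AddSubgroup (E(Γ) → ℤ) where
  carrier := {w | ∀ (v : α) (h : Fin 3 ≃ Γ.HalfEdgeAt v),
    Even (w (h 0).edge + w (h 1).edge + w (h 2).edge)}
  zero_mem' := by
    intro v h
    simp
  add_mem' := by
    intro a b ha hb v h
    obtain ⟨k, hk⟩ := ha v h
    obtain ⟨l, hl⟩ := hb v h
    refine ⟨k + l, ?_⟩
    simp only [Pi.add_apply]
    linarith
  neg_mem' := by
    intro a ha v h
    obtain ⟨k, hk⟩ := ha v h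
    refine ⟨-k, ?_⟩
    simp only [Pi.neg_apply]
    linarith

end Graph

namespace LatticePolytope

variable {ι : Type*}

/-- The `m`-fold Minkowski sum `P + ⋯ + P`, which is `{0}` for `m = 0`. -/
def minkowskiMultiple (P : Set (ι → ℝ)) (m : ℕ) : Set (ι → ℝ) :=
  {x | ∃ p : Fin m → ι → ℝ, (∀ k, p k ∈ P) ∧ ∑ k, p k = x}

/-- The graded semigroup of a polytope `P` with respect to a lattice `Λ`: the pairs `(m, w)` with
`w` a point of `Λ` in the `m`-fold Minkowski sum of `P`. -/
def semigroup (P : Set (ι → ℝ)) (Λ : AddSubgroup (ι → ℤ)) : AddSubmonoid (ℕ × (ι → ℤ)) where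
  carrier := {x | x.2 ∈ Λ ∧ (fun i => (x.2 i : ℝ)) ∈ minkowskiMultiple P x.1}
  zero_mem' := by
    refine ⟨Λ.zero_mem, Fin.elim0, fun k => k.elim0, ?_⟩
    ext i
    simp
  add_mem' := by
    rintro ⟨m, a⟩ ⟨n, b⟩ ⟨ha, p, hp, hpa⟩ ⟨hb, q, hq, hqb⟩
    refine ⟨Λ.add_mem ha hb, (Fin.append p q : Fin (m + n) → ι → ℝ), ?_, ?_⟩
    · intro k
      refine Fin.addCases (fun i => ?_) (fun i => ?_) k
      · simpa using hp i
      · simpa using hq i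
    · have h : ∑ k, (Fin.append p q : Fin (m + n) → ι → ℝ) k = ∑ k, p k + ∑ k, q k := by
        rw [Fin.sum_univ_add]
        simp
      refine h.trans ?_
      rw [hpa, hqb]
      ext i
      simp

/-- The semigroup algebra `ℂ[P]`. -/
abbrev SemigroupAlgebra (P : Set (ι → ℝ)) (Λ : AddSubgroup (ι → ℤ)) : Type _ :=
  AddMonoidAlgebra ℂ (semigroup P Λ)

/-- The homogeneous component of degree `m` of `ℂ[P]`, spanned by the lattice points of the
`m`-fold Minkowski sum. -/
noncomputable def component (P : Set (ι → ℝ)) (Λ : AddSubgroup (ι → ℤ)) (m : ℕ) :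
    Submodule ℂ (SemigroupAlgebra P Λ) :=
  AddMonoidAlgebra.gradeBy ℂ (fun x : semigroup P Λ => (x : ℕ × (ι → ℤ)).1) m

/-- `P` is normal: `ℂ[P]` is generated by its component of degree one. -/
def IsNormal (P : Set (ι → ℝ)) (Λ : AddSubgroup (ι → ℤ)) : Prop :=
  Algebra.adjoin ℂ (component P Λ 1 : Set (SemigroupAlgebra P Λ)) = ⊤

/-- The set `X_P` of lattice points of `P`. -/
abbrev LatticePoint (P : Set (ι → ℝ)) (Λ : AddSubgroup (ι → ℤ)) : Type _ :=
  {w : ι → ℤ // w ∈ Λ ∧ (fun i => (w i : ℝ)) ∈ P}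

/-- A lattice point of `P`, as an element of degree one of the semigroup. -/
def LatticePoint.toSemigroup {P : Set (ι → ℝ)} {Λ : AddSubgroup (ι → ℤ)}
    (x : LatticePoint P Λ) : semigroup P Λ :=
  ⟨(1, x.1), x.2.1, fun _ => fun i => (x.1 i : ℝ), fun _ => x.2.2, by simp⟩

/-- The toric ideal `I_P`: the kernel of the map `ℂ[X_P] → ℂ[P]` from the polynomial ring with one
variable for every lattice point of `P`. -/
noncomputable def toricIdeal (P : Set (ι → ℝ)) (Λ : AddSubgroup (ι → ℤ)) :
    Ideal (MvPolynomial (LatticePoint P Λ) ℂ) :=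
  RingHom.ker (MvPolynomial.aeval (R := ℂ)
    (fun x : LatticePoint P Λ => (AddMonoidAlgebra.single x.toSemigroup 1 : SemigroupAlgebra P Λ)))

end LatticePolytope

/-- An ideal of a polynomial ring is generated by polynomials of degree at most `d`. -/
def MvPolynomial.IsGeneratedInDegreeLE {σ : Type*} (I : Ideal (MvPolynomial σ ℂ)) (d : ℕ) :
    Prop :=
  ∃ G : Set (MvPolynomial σ ℂ), (∀ f ∈ G, f.totalDegree ≤ d) ∧ Ideal.span G = I

/-!
Write a lattice point `x` of the `m`-fold multiple of the polytope as a sum of `m` lattice points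
of the polytope, an `m`-*tuple* with sum `x`. Normality says that tuples exist. The toric ideal is
generated in degrees at most three if any two tuples with the same sum are connected by *moves*,
each changing at most three entries (`LatticePolytope.isNormal_and_isGeneratedInDegreeLE`): a move
is a binomial of degree at most three in the ideal, times a monomial.

*Parity.* By the lattice condition the tree edges of odd weight, apart from leaf-edges of odd
weight, form a subforest without vertices of degree one, hence do not exist
(`Graph.TreeModel.even_weight`); compatibility and the parity of the sum ensure that leaf-edges of
odd weight meet a trinode in pairs (`Graph.TreeModel.trinode_cases`). So the weights of a fixed
tree edge at the points of the polytope lie in one class modulo `d = 2`; for loops, `d = 1`.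

*Balancing.* Two entries of a tuple may be replaced by a splitting of their sum which is as equal as
possible. This decreases the sum of squares unless all entries have, on each edge, one of two
consecutive values `a` and `a + d`, which are then determined by `x`
(`TupleMoves.eq_base_of_pairwise`). It remains to treat tuples of this kind
(`TupleMoves.BalancedSystem.conn`), a question about `0/1` vectors.

*Gluing.* The vertices of the tree impose conditions on the edges around them, and two vertices
share at most one edge. As that edge takes only two values, the sum determines how often each of
them occurs in a tuple, so two tuples for neighbouring vertices can be matched by permuting one of
them, and moves lift (`TupleMoves.Good.glue`, `TupleMoves.Good.forest`). Hence it is enough to study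
one vertex.

*One vertex.* At a trinode, the triangle inequalities and the level bound cut corners off the cube
`{0,1}³`. If exactly the four of odd coordinate sum were cut, a tetrahedron of volume `1/3` would
remain, which is not normal; the bound `L > 1` excludes this (`TupleMoves.TriData.good`). Otherwise,
up to reflections, either a subset of the standard simplex is left, where tuples are unique
(`TupleMoves.good_of_simplex`), or `(1,1,1)` and the vertices of even coordinate sum are present, as
far as they are relevant for `x` (`TupleMoves.good_of_core`). In the latter case all relations are
generated by quadratic ones and the cubic relation
`(0,1,1) + (1,0,1) + (1,1,0) = 2 (1,1,1) + (0,0,0)`.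
-/

/-! ### Tuples of weightings with prescribed sums -/

namespace TupleMoves

variable {E : Type*} {m : ℕ}

/-- An `m`-tuple of elements of `C` whose sum is `x` on the coordinates in `F`. -/
def IsTuple (x : E → ℤ) (F : Set E) (C : Set (E → ℤ)) (f : Fin m → E → ℤ) : Prop :=
  (∀ j, f j ∈ C) ∧ ∀ e ∈ F, ∑ j, f j e = x e

/-- A move from the tuple `f` to the tuple `g`: at most three entries change (as far as the
coordinates in `F` can tell), and `g` is again a tuple in `C` with sum `x`. -/
def Move (x : E → ℤ) (F : Set E) (C : Set (E → ℤ)) (f g : Fin m → E → ℤ) : Prop :=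
  IsTuple x F C g ∧ ∃ J : Finset (Fin m), J.card ≤ 3 ∧ ∀ j ∉ J, ∀ e ∈ F, f j e = g j e

/-- Two tuples are connected if a chain of moves leads from the first to the second. -/
def Conn (x : E → ℤ) (F : Set E) (C : Set (E → ℤ)) :
    (Fin m → E → ℤ) → (Fin m → E → ℤ) → Prop :=
  Relation.ReflTransGen (Move x F C)

/-- There is an `m`-tuple in `C` with sum `x`, and any two such tuples are connected by moves. -/
def Good (m : ℕ) (x : E → ℤ) (F : Set E) (C : Set (E → ℤ)) : Prop :=
  (∃ f : Fin m → E → ℤ, IsTuple x F C f) ∧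
    ∀ f g : Fin m → E → ℤ, IsTuple x F C f → IsTuple x F C g → Conn x F C f g

variable {x : E → ℤ} {F : Set E} {C : Set (E → ℤ)} {f g h : Fin m → E → ℤ}

lemma Conn.isTuple (hfg : Conn x F C f g) (hf : IsTuple x F C f) : IsTuple x F C g := by
  induction hfg with
  | refl => exact hf
  | tail _ h _ => exact h.1

lemma Conn.of_eqOn (hg : IsTuple x F C g) (hfg : ∀ j, ∀ e ∈ F, f j e = g j e) :
    Conn x F C f g :=
  .single ⟨hg, ∅, by simp, fun j _ => hfg j⟩

lemma Conn.symm (hf : IsTuple x F C f) (hfg : Conn x F C f g) : Conn x F C g f := by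
  induction hfg with
  | refl => exact .refl
  | tail h1 h ih =>
    obtain ⟨_, J, hJ, hJ'⟩ := h
    exact .head ⟨Conn.isTuple h1 hf, J, hJ, fun j hj e he => (hJ' j hj e he).symm⟩ ih

/-- Two families of integers taking values in `{p, q}` that agree outside `J` and have the same
sum differ by a permutation supported in `J`. -/
lemma exists_perm_of_sum_eq {p q : ℤ} {u v : Fin m → ℤ} (hu : ∀ j, u j = p ∨ u j = q)
    (hv : ∀ j, v j = p ∨ v j = q) (J : Finset (Fin m)) (hJ : ∀ j ∉ J, u j = v j)
    (hs : ∑ j, u j = ∑ j, v j) :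
    ∃ ρ : Equiv.Perm (Fin m), (∀ j ∉ J, ρ j = j) ∧ ∀ j, v j = u (ρ j) := by
  classical
  -- Induction on the number of positions at which the families differ.
  induction' hn : (Finset.univ.filter fun j => u j ≠ v j).card using Nat.strong_induction_on
    with n ih generalizing u
  by_cases huv : ∀ j, u j = v j
  · exact ⟨1, fun _ _ => rfl, fun j => (huv j).symm⟩
  push Not at huv
  obtain ⟨i, hi⟩ := huv
  -- Some other misplaced position carries the value required at `i`; exchange the two.
  have hex : ∃ k, u k ≠ v k ∧ u k = v i ∧ v k ≠ v i := by
    by_contra hcon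
    push Not at hcon
    rcases lt_or_gt_of_ne hi with hlt | hlt
    · refine absurd hs (ne_of_lt (Finset.sum_lt_sum (fun k _ => ?_) ⟨i, Finset.mem_univ _, hlt⟩))
      have := hcon k
      rcases hu k with h1 | h1 <;> rcases hv k with h2 | h2 <;> rcases hu i with h3 | h3 <;>
        rcases hv i with h4 | h4 <;> grind
    · refine absurd hs.symm (ne_of_lt (Finset.sum_lt_sum (fun k _ => ?_)
        ⟨i, Finset.mem_univ _, hlt⟩))
      have := hcon k
      rcases hu k with h1 | h1 <;> rcases hv k with h2 | h2 <;> rcases hu i with h3 | h3 <;>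
        rcases hv i with h4 | h4 <;> grind
  obtain ⟨k, hk1, hk2, hk3⟩ := hex
  have hiJ : i ∈ J := by by_contra h; exact hi (hJ i h)
  have hkJ : k ∈ J := by by_contra h; exact hk1 (hJ k h)
  have hvk : v k = u i := by
    rcases hu k with h1 | h1 <;> rcases hv k with h2 | h2 <;> rcases hu i with h3 | h3 <;>
        rcases hv i with h4 | h4 <;> grind
  obtain ⟨ρ, hρ, hρ'⟩ := ih _ (by
      rw [← hn]
      refine Finset.card_lt_card ⟨?_, ?_⟩
      · intro j hj
        simp only [Finset.mem_filter, Finset.mem_univ, true_and] at hj ⊢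
        intro hj'
        apply hj
        have h1 : j ≠ i := by rintro rfl; exact hi hj'
        have h2 : j ≠ k := by rintro rfl; exact hk1 hj'
        rw [Equiv.swap_apply_of_ne_of_ne h1 h2, hj']
      · intro hsub
        have := @hsub i (by simpa using hi)
        simp only [Finset.mem_filter, Finset.mem_univ, true_and] at this
        exact this (by simpa using hk2))
    (u := fun j => u (Equiv.swap i k j)) (fun j => hu _)
    (fun j hj => by
      have h1 : j ≠ i := by rintro rfl; exact hj hiJ
      have h2 : j ≠ k := by rintro rfl; exact hj hkJ
      rw [Equiv.swap_apply_of_ne_of_ne h1 h2, hJ j hj])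
    (by rw [← hs]; exact Equiv.sum_comp (Equiv.swap i k) u) rfl
  refine ⟨Equiv.swap i k * ρ, fun j hj => ?_, fun j => ?_⟩
  · have h1 : j ≠ i := by rintro rfl; exact hj hiJ
    have h2 : j ≠ k := by rintro rfl; exact hj hkJ
    rw [Equiv.Perm.mul_apply, hρ j hj, Equiv.swap_apply_of_ne_of_ne h1 h2]
  · rw [hρ' j]; rfl

/-! ### Gluing along one coordinate -/

section Glue

variable {F₁ F₂ : Set E} {C₁ C₂ : Set (E → ℤ)}

/-- `C` depends only on the coordinates in `F`. -/
def DependsOn (F : Set E) (C : Set (E → ℤ)) : Prop :=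
  ∀ y z : E → ℤ, (∀ e ∈ F, y e = z e) → y ∈ C → z ∈ C

open Classical in
/-- The tuple that follows `f` on the coordinates in `F₁` and `g` on all others. -/
noncomputable def splice (F₁ : Set E) (f g : Fin m → E → ℤ) : Fin m → E → ℤ :=
  fun j e => if e ∈ F₁ then f j e else g j e

lemma splice_left {e : E} (he : e ∈ F₁) (j : Fin m) : splice F₁ f g j e = f j e := if_pos he

lemma splice_right (hfg : ∀ e ∈ F₁ ∩ F₂, ∀ j, f j e = g j e) {e : E} (he : e ∈ F₂) (j : Fin m) :
    splice F₁ f g j e = g j e := by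
  unfold splice
  split_ifs with h
  · exact hfg e ⟨h, he⟩ j
  · rfl

lemma isTuple_splice (hC₁ : DependsOn F₁ C₁) (hC₂ : DependsOn F₂ C₂)
    (hf : IsTuple x F₁ C₁ f) (hg : IsTuple x F₂ C₂ g)
    (hfg : ∀ e ∈ F₁ ∩ F₂, ∀ j, f j e = g j e) :
    IsTuple x (F₁ ∪ F₂) (C₁ ∩ C₂) (splice F₁ f g) := by
  refine ⟨fun j => ⟨hC₁ _ _ (fun e he => (splice_left he j).symm) (hf.1 j),
    hC₂ _ _ (fun e he => (splice_right hfg he j).symm) (hg.1 j)⟩, ?_⟩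
  rintro e (he | he)
  · rw [← hf.2 e he]; exact Finset.sum_congr rfl fun j _ => splice_left he j
  · rw [← hg.2 e he]; exact Finset.sum_congr rfl fun j _ => splice_right hfg he j

lemma IsTuple.inter_left (hf : IsTuple x (F₁ ∪ F₂) (C₁ ∩ C₂) f) : IsTuple x F₁ C₁ f :=
  ⟨fun j => (hf.1 j).1, fun e he => hf.2 e (.inl he)⟩

lemma IsTuple.inter_right (hf : IsTuple x (F₁ ∪ F₂) (C₁ ∩ C₂) f) : IsTuple x F₂ C₂ f :=
  ⟨fun j => (hf.1 j).2, fun e he => hf.2 e (.inr he)⟩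

lemma IsTuple.comp_perm (hf : IsTuple x F C f) (ρ : Equiv.Perm (Fin m)) :
    IsTuple x F C (fun j => f (ρ j)) :=
  ⟨fun _ => hf.1 _, fun e he => (Equiv.sum_comp ρ fun j => f j e).trans (hf.2 e he)⟩

/-- Two tuples that agree outside `J` can be matched on the (at most one) common coordinate by
permuting the first one inside `J`: that coordinate takes two values, so its sum tells how often
each occurs. -/
lemma exists_perm_match (hsub : (F₁ ∩ F₂).Subsingleton) {p q : E → ℤ}
    (hpq : ∀ y ∈ C₁, ∀ e ∈ F₁ ∩ F₂, y e = p e ∨ y e = q e)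
    (hpq' : ∀ y ∈ C₂, ∀ e ∈ F₁ ∩ F₂, y e = p e ∨ y e = q e)
    (hf : IsTuple x F₂ C₂ f) (hh : IsTuple x F₁ C₁ h)
    (J : Finset (Fin m)) (hJ : ∀ j ∉ J, ∀ e ∈ F₁, f j e = h j e) :
    ∃ ρ : Equiv.Perm (Fin m), (∀ j ∉ J, ρ j = j) ∧
      ∀ e ∈ F₁ ∩ F₂, ∀ j, h j e = f (ρ j) e := by
  rcases (F₁ ∩ F₂).eq_empty_or_nonempty with h0 | ⟨e, he⟩
  · exact ⟨1, fun _ _ => rfl, by simp [h0]⟩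
  · obtain ⟨ρ, h1, h2⟩ := exists_perm_of_sum_eq (p := p e) (q := q e) (u := fun j => f j e)
      (v := fun j => h j e) (fun j => hpq' _ (hf.1 j) e he) (fun j => hpq _ (hh.1 j) e he) J
      (fun j hj => hJ j hj e he.1) (by rw [hf.2 e he.2, hh.2 e he.1])
    refine ⟨ρ, h1, fun e' he' j => ?_⟩
    rw [hsub he' he]
    exact h2 j

/-- A chain of moves in the first factor lifts to the glued system; on the second factor the
entries of the tuple are merely permuted. -/
lemma lift_conn (hC₁ : DependsOn F₁ C₁) (hC₂ : DependsOn F₂ C₂)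
    (hsub : (F₁ ∩ F₂).Subsingleton) {p q : E → ℤ}
    (hpq : ∀ y ∈ C₁, ∀ e ∈ F₁ ∩ F₂, y e = p e ∨ y e = q e)
    (hpq' : ∀ y ∈ C₂, ∀ e ∈ F₁ ∩ F₂, y e = p e ∨ y e = q e)
    (hf : IsTuple x (F₁ ∪ F₂) (C₁ ∩ C₂) f) (hfh : Conn x F₁ C₁ f h) :
    ∃ f', Conn x (F₁ ∪ F₂) (C₁ ∩ C₂) f f' ∧ (∀ j, ∀ e ∈ F₁, f' j e = h j e) ∧
      ∃ ρ : Equiv.Perm (Fin m), ∀ j, ∀ e ∈ F₂, f' j e = f (ρ j) e := by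
  induction hfh with
  | refl => exact ⟨f, .refl, fun _ _ _ => rfl, 1, fun _ _ _ => rfl⟩
  | @tail h h' _ hmove ih =>
    obtain ⟨f', hconn, hF₁, ρ, hρ⟩ := ih
    obtain ⟨hh', J, hJ, hJ'⟩ := hmove
    have hf' := hconn.isTuple hf
    have hJ'' : ∀ j ∉ J, ∀ e ∈ F₁, f' j e = h' j e := fun j hj e he =>
      (hF₁ j e he).trans (hJ' j hj e he)
    obtain ⟨τ, hτ, hτ'⟩ := exists_perm_match hsub hpq hpq' hf'.inter_right hh' J hJ''
    refine ⟨splice F₁ h' (fun j => f' (τ j)), hconn.tail ⟨isTuple_splice hC₁ hC₂ hh'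
      (hf'.inter_right.comp_perm τ) hτ', J, hJ, ?_⟩, fun j e he => splice_left he j,
      τ.trans ρ, fun j e he => ?_⟩
    · rintro j hj e (he | he)
      · rw [splice_left he, hJ'' j hj e he]
      · rw [splice_right hτ' he, hτ j hj]
    · rw [splice_right hτ' he, hρ _ e he]; rfl

/-- Permuting the entries on one factor, by a permutation that preserves the common coordinate,
is a composition of moves that exchange two entries. -/
lemma conn_splice_perm (hC₁ : DependsOn F₁ C₁) (hC₂ : DependsOn F₂ C₂)
    (hg : IsTuple x (F₁ ∪ F₂) (C₁ ∩ C₂) g) (ρ : Equiv.Perm (Fin m))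
    (hρ : ∀ e ∈ F₁ ∩ F₂, ∀ j, g (ρ j) e = g j e) :
    Conn x (F₁ ∪ F₂) (C₁ ∩ C₂) (splice F₁ (fun j => g (ρ j)) g) g := by
  induction' hn : ρ.support.card using Nat.strong_induction_on with n ih generalizing ρ
  by_cases h1 : ρ = 1
  · subst h1
    exact Conn.of_eqOn hg fun j e _ => by simp [splice]
  · obtain ⟨i, hi⟩ : ∃ i, ρ i ≠ i := by
      by_contra hcon
      push Not at hcon
      exact h1 (Equiv.ext hcon)
    -- Composing with the transposition of `i` and `ρ i` makes `i` a fixed point.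
    set τ := Equiv.swap i (ρ i) * ρ with hτ
    have hτ' : ∀ e ∈ F₁ ∩ F₂, ∀ j, g (τ j) e = g j e := by
      intro e he j
      rw [← hρ e he j, hτ, Equiv.Perm.mul_apply, Equiv.swap_apply_def]
      split_ifs with h2 h3
      · rw [h2]; exact hρ e he i
      · rw [h3]; exact (hρ e he i).symm
      · rfl
    refine .head ⟨isTuple_splice hC₁ hC₂ (hg.inter_left.comp_perm τ) hg.inter_right hτ',
      {i, ρ.symm i}, Finset.card_le_two.trans (by norm_num), ?_⟩
      (ih _ (by rw [← hn]; exact Equiv.Perm.card_support_swap_mul hi) τ hτ' rfl)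
    rintro j hj e -
    have hj1 : j ≠ i := fun h => hj (by simp [h])
    have hj2 : ρ j ≠ i := fun h => hj (by simp [← h])
    have : τ j = ρ j := by
      rw [hτ, Equiv.Perm.mul_apply]
      exact Equiv.swap_apply_of_ne_of_ne hj2 (fun h => hj1 (ρ.injective h))
    simp only [splice, this]

/-- Goodness is inherited by the fibre product of two systems along one two-valued coordinate. -/
theorem Good.glue (hC₁ : DependsOn F₁ C₁) (hC₂ : DependsOn F₂ C₂)
    (hsub : (F₁ ∩ F₂).Subsingleton) {p q : E → ℤ}
    (hpq : ∀ y ∈ C₁, ∀ e ∈ F₁ ∩ F₂, y e = p e ∨ y e = q e)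
    (hpq' : ∀ y ∈ C₂, ∀ e ∈ F₁ ∩ F₂, y e = p e ∨ y e = q e)
    (h₁ : Good m x F₁ C₁) (h₂ : Good m x F₂ C₂) : Good m x (F₁ ∪ F₂) (C₁ ∩ C₂) := by
  constructor
  · obtain ⟨f, hf⟩ := h₁.1
    obtain ⟨g, hg⟩ := h₂.1
    obtain ⟨ρ, -, hρ⟩ := exists_perm_match hsub hpq hpq' hg hf Finset.univ (by simp)
    exact ⟨_, isTuple_splice hC₁ hC₂ hf (hg.comp_perm ρ) hρ⟩
  · intro f g hf hg
    obtain ⟨f₁, hff₁, hf₁, -⟩ := lift_conn hC₁ hC₂ hsub hpq hpq' hf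
      (h₁.2 f g hf.inter_left hg.inter_left)
    have hf₁t := hff₁.isTuple hf
    have hsub' : (F₂ ∩ F₁).Subsingleton := by rwa [Set.inter_comm]
    obtain ⟨f₂, hff₂, hf₂, ρ, hρ⟩ := lift_conn (F₁ := F₂) (F₂ := F₁) (C₁ := C₂) (C₂ := C₁)
      hC₂ hC₁ hsub'
      (fun y hy e he => hpq' y hy e he.symm) (fun y hy e he => hpq y hy e he.symm)
      (by rwa [Set.union_comm, Set.inter_comm]) (h₂.2 f₁ g hf₁t.inter_right hg.inter_right)
    rw [Set.union_comm, Set.inter_comm] at hff₂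
    have hρg : ∀ j, ∀ e ∈ F₁, f₂ j e = g (ρ j) e := fun j e he => by
      rw [hρ j e he, hf₁ _ e he]
    have hρ' : ∀ e ∈ F₁ ∩ F₂, ∀ j, g (ρ j) e = g j e := fun e he j => by
      rw [← hρg j e he.1, hf₂ j e he.2]
    have key := conn_splice_perm hC₁ hC₂ hg ρ hρ'
    refine (hff₁.trans hff₂).trans (.trans (Conn.of_eqOn (isTuple_splice hC₁ hC₂
      (hg.inter_left.comp_perm ρ) hg.inter_right hρ') ?_) key)
    rintro j e (he | he)
    · rw [splice_left he, hρg j e he]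
    · rw [splice_right hρ' he, hf₂ j e he]

end Glue

end TupleMoves

/-! ### Gluing over a forest -/

/-- In a forest, every nonempty finite set of vertices contains one with at most one neighbour in
the set, namely the end of a longest path inside the set. -/
lemma SimpleGraph.IsAcyclic.exists_subsingleton_neighbors {V : Type*} {T : SimpleGraph V}
    (hT : T.IsAcyclic) (S : Finset V) (hS : S.Nonempty) :
    ∃ v ∈ S, {u | u ∈ S ∧ T.Adj v u}.Subsingleton := by
  classical
  let H := T.induce (S : Set V)
  have hH : H.IsAcyclic := hT.induce _
  have : Nonempty (S : Set V) := hS.to_subtype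
  obtain ⟨a, b, w, hw, hmax⟩ := SimpleGraph.Walk.exists_isPath_forall_isPath_length_le_length H
  refine ⟨b, b.2, ?_⟩
  have key : ∀ u (hu : u ∈ S), T.Adj b u → (⟨u, hu⟩ : (S : Set V)) = w.penultimate := by
    intro u hu hadj
    have hadj' : H.Adj b ⟨u, hu⟩ := hadj
    refine hH.eq_penultimate_of_adj_end hw hadj' ?_
    by_contra hmem
    have := hmax _ _ _ (hw.concat hmem hadj')
    rw [w.length_concat] at this
    omega
  rintro u ⟨hu, hu'⟩ u' ⟨hv, hv'⟩
  exact congrArg Subtype.val ((key u hu hu').trans (key u' hv hv').symm)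

namespace TupleMoves

lemma DependsOn.biInter {V E : Type*} {F : V → Set E} {C : V → Set (E → ℤ)}
    (hC : ∀ v, DependsOn (F v) (C v)) (S : Finset V) :
    DependsOn (⋃ v ∈ S, F v) (⋂ v ∈ S, C v) := by
  intro y z hyz hy
  simp only [Set.mem_iInter] at hy ⊢
  exact fun v hv => hC v y z (fun e he => hyz e (Set.mem_biUnion hv he)) (hy v hv)

/-- A system of local conditions indexed by the vertices of a forest, in which two vertices share
a coordinate only if they are adjacent, and then just one, is good if it is good locally. -/
theorem Good.forest {V E : Type*} {T : SimpleGraph V} (hT : T.IsAcyclic) {m : ℕ}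
    {x : E → ℤ} {F : V → Set E} {C : V → Set (E → ℤ)}
    (hadj : ∀ u v, u ≠ v → (F u ∩ F v).Nonempty → T.Adj u v)
    (hsub : ∀ u v, u ≠ v → (F u ∩ F v).Subsingleton)
    (hC : ∀ v, DependsOn (F v) (C v))
    {p q : E → ℤ} (hpq : ∀ v, ∀ y ∈ C v, ∀ e ∈ F v, y e = p e ∨ y e = q e)
    (hgood : ∀ v, Good m x (F v) (C v)) (S : Finset V) :
    Good m x (⋃ v ∈ S, F v) (⋂ v ∈ S, C v) := by
  classical
  induction' hn : S.card with n ih generalizing S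
  · obtain rfl := Finset.card_eq_zero.mp hn
    refine ⟨⟨0, by simp, by simp⟩, fun f g hf hg => Conn.of_eqOn hg (by simp)⟩
  · obtain ⟨v, hv, hv'⟩ := hT.exists_subsingleton_neighbors S (Finset.card_pos.mp (by omega))
    have ih' := ih (S.erase v) (by rw [Finset.card_erase_of_mem hv, hn]; rfl)
    rw [← Finset.insert_erase hv]
    simp only [Finset.set_biUnion_insert, Finset.set_biInter_insert]
    refine (hgood v).glue (p := p) (q := q) (hC v) (DependsOn.biInter hC _) ?_
      (fun y hy e he => hpq v y hy e he.1) (fun y hy e he => ?_) ih'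
    · rintro e ⟨he, he'⟩ e₂ ⟨he₂, he₂'⟩
      simp only [Set.mem_iUnion, Finset.mem_erase, exists_prop] at he' he₂'
      obtain ⟨u, ⟨huv, hu⟩, heu⟩ := he'
      obtain ⟨u₂, ⟨huv₂, hu₂⟩, heu₂⟩ := he₂'
      have h1 := hadj v u huv.symm ⟨e, he, heu⟩
      have h2 := hadj v u₂ huv₂.symm ⟨e₂, he₂, heu₂⟩
      obtain rfl := hv' ⟨hu, h1⟩ ⟨hu₂, h2⟩
      exact hsub v u huv.symm ⟨he, heu⟩ ⟨he₂, heu₂⟩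
    · obtain ⟨-, he'⟩ := he
      simp only [Set.mem_iUnion, exists_prop] at he'
      obtain ⟨u, hu, heu⟩ := he'
      simp only [Set.mem_iInter] at hy
      exact hpq u y (hy u hu) e heu

end TupleMoves

/-! ### Subsets of the cube `{0,1}³` -/

namespace TupleMoves

variable {m : ℕ}

/-- The vertices of the unit cube. -/
def cube : Finset (Fin 3 → ℤ) :=
  {![0, 0, 0], ![0, 1, 1], ![1, 0, 1], ![1, 1, 0], ![1, 1, 1], ![1, 0, 0], ![0, 1, 0], ![0, 0, 1]}

/-- The vertices of the unit cube with even coordinate sum, and `(1,1,1)`. -/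
def core : Finset (Fin 3 → ℤ) :=
  {![0, 0, 0], ![0, 1, 1], ![1, 0, 1], ![1, 1, 0], ![1, 1, 1]}

lemma core_subset_cube : core ⊆ cube := by decide

lemma cube_nonneg {y : Fin 3 → ℤ} (hy : y ∈ cube) (i : Fin 3) : 0 ≤ y i := by
  revert i; revert y; decide

lemma mem_cube_of_bits {a b c : ℤ} (ha : a = 0 ∨ a = 1) (hb : b = 0 ∨ b = 1)
    (hc : c = 0 ∨ c = 1) : ![a, b, c] ∈ cube := by
  rcases ha with rfl | rfl <;> rcases hb with rfl | rfl <;> rcases hc with rfl | rfl <;> decide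

lemma dependsOn_univ {E : Type*} (C : Set (E → ℤ)) : DependsOn Set.univ C := by
  intro y z hyz hy
  rwa [← funext fun e => hyz e trivial]

/-- Reordering a tuple is a chain of moves. -/
lemma conn_of_perm {E : Type*} {x : E → ℤ} {F : Set E} {C : Set (E → ℤ)} (hC : DependsOn F C)
    {f g : Fin m → E → ℤ} (hg : IsTuple x F C g) (ρ : Equiv.Perm (Fin m))
    (hfg : ∀ j, f j = g (ρ j)) (hf : IsTuple x F C f) : Conn x F C f g := by
  have key := conn_splice_perm (F₁ := F) (F₂ := ∅) (C₁ := C) (C₂ := Set.univ) (x := x) hC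
    (fun _ _ _ _ => trivial) (g := g) (by simpa using hg) ρ (by simp)
  simp only [Set.union_empty, Set.inter_univ] at key
  refine .head ⟨?_, ∅, by simp, fun j _ e he => ?_⟩ key
  · refine ⟨fun j => hC _ _ (fun e he => ?_) (hf.1 j), fun e he => ?_⟩
    · rw [splice_left he, hfg]
    · rw [← hf.2 e he]
      exact Finset.sum_congr rfl fun j _ => by rw [splice_left he, hfg]
  · rw [splice_left he, hfg]

/-- The number of entries of the tuple `f` that are equal to `u`. -/
def count (f : Fin m → Fin 3 → ℤ) (u : Fin 3 → ℤ) : ℕ :=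
  (Finset.univ.filter fun j => f j = u).card

lemma count_ne_zero {f : Fin m → Fin 3 → ℤ} {u : Fin 3 → ℤ} (h : count f u ≠ 0) :
    ∃ j, f j = u := by
  obtain ⟨j, hj⟩ := Finset.card_pos.mp (Nat.pos_of_ne_zero h)
  exact ⟨j, by simpa using hj⟩

lemma sum_eq_count {f : Fin m → Fin 3 → ℤ} (hf : ∀ j, f j ∈ cube) (h : (Fin 3 → ℤ) → ℤ) :
    ∑ j, h (f j) = count f ![0, 0, 0] * h ![0, 0, 0] + count f ![0, 1, 1] * h ![0, 1, 1] +
      count f ![1, 0, 1] * h ![1, 0, 1] + count f ![1, 1, 0] * h ![1, 1, 0] +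
      count f ![1, 1, 1] * h ![1, 1, 1] + count f ![1, 0, 0] * h ![1, 0, 0] +
      count f ![0, 1, 0] * h ![0, 1, 0] + count f ![0, 0, 1] * h ![0, 0, 1] := by
  rw [← Finset.sum_fiberwise_of_maps_to (t := cube) (g := f) (fun j _ => hf j)]
  have : ∀ u ∈ cube, ∑ j with f j = u, h (f j) = count f u * h u := by
    intro u _
    rw [Finset.sum_congr rfl (g := fun _ => h u)
      (fun j hj => by rw [(Finset.mem_filter.mp hj).2])]
    simp [count]
  rw [Finset.sum_congr rfl this]
  unfold cube
  iterate 7 rw [Finset.sum_insert (by decide)]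
  rw [Finset.sum_singleton]
  ring

lemma exists_perm_of_count_eq {f g : Fin m → Fin 3 → ℤ} (h : ∀ u, count f u = count g u) :
    ∃ ρ : Equiv.Perm (Fin m), ∀ j, f j = g (ρ j) := by
  have e : ∀ u, Nonempty ({j // f j = u} ≃ {j // g j = u}) := fun u =>
    ⟨Fintype.equivOfCardEq (by simpa [Fintype.card_subtype, count] using h u)⟩
  exact ⟨Equiv.ofFiberEquiv fun u => (e u).some, fun j => (Equiv.ofFiberEquiv_map _ j).symm⟩

lemma conn_of_count_eq {s : Fin 3 → ℤ} {A : Set (Fin 3 → ℤ)} (hA : A ⊆ cube)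
    {f g : Fin m → Fin 3 → ℤ} (hf : IsTuple s Set.univ A f) (hg : IsTuple s Set.univ A g)
    (h : ∀ u ∈ cube, count f u = count g u) : Conn s Set.univ A f g := by
  obtain ⟨ρ, hρ⟩ := exists_perm_of_count_eq (f := f) (g := g) fun u => by
    by_cases hu : u ∈ cube
    · exact h u hu
    · have h1 : count f u = 0 := by
        by_contra h0
        obtain ⟨j, rfl⟩ := count_ne_zero h0
        exact hu (hA (hf.1 j))
      have h2 : count g u = 0 := by
        by_contra h0
        obtain ⟨j, rfl⟩ := count_ne_zero h0
        exact hu (hA (hg.1 j))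
      rw [h1, h2]
  exact conn_of_perm (dependsOn_univ A) hg ρ hρ hf

/-- The linear equations relating the multiplicities of the eight vertices in a tuple to its
length and its sum. -/
lemma count_eqs {s : Fin 3 → ℤ} {f : Fin m → Fin 3 → ℤ} (hf : ∀ j, f j ∈ cube)
    (hs : ∀ i, ∑ j, f j i = s i) :
    (m : ℤ) = count f ![0, 0, 0] + count f ![0, 1, 1] + count f ![1, 0, 1] + count f ![1, 1, 0] +
      count f ![1, 1, 1] + count f ![1, 0, 0] + count f ![0, 1, 0] + count f ![0, 0, 1] ∧
    s 0 = count f ![1, 0, 1] + count f ![1, 1, 0] + count f ![1, 1, 1] + count f ![1, 0, 0] ∧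
    s 1 = count f ![0, 1, 1] + count f ![1, 1, 0] + count f ![1, 1, 1] + count f ![0, 1, 0] ∧
    s 2 = count f ![0, 1, 1] + count f ![1, 0, 1] + count f ![1, 1, 1] + count f ![0, 0, 1] := by
  refine ⟨?_, ?_, ?_, ?_⟩
  · simpa using sum_eq_count hf fun _ => 1
  · rw [← hs 0]; simpa using sum_eq_count hf fun y => y 0
  · rw [← hs 1]; simpa using sum_eq_count hf fun y => y 1
  · rw [← hs 2]; simpa using sum_eq_count hf fun y => y 2

lemma sum_update {β : Type*} (h : β → ℤ) (f : Fin m → β) (k : Fin m) (z : β) :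
    ∑ j, h (Function.update f k z j) = ∑ j, h (f j) - h (f k) + h z := by
  rw [← Finset.add_sum_erase _ _ (Finset.mem_univ k),
    ← Finset.add_sum_erase _ (fun j => h (f j)) (Finset.mem_univ k), Function.update_self,
    Finset.sum_congr rfl (g := fun j => h (f j)) fun j hj => by
      rw [Function.update_of_ne (Finset.ne_of_mem_erase hj)]]
  ring

/-- Membership in `A` of the entries lying in the core only has to be known for those vertices
whose support is contained in the support of the sum. -/
lemma isTuple_of_mem_core {s : Fin 3 → ℤ} {A : Set (Fin 3 → ℤ)} (hA : A ⊆ cube)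
    (hcore : ∀ y ∈ core, (∀ i, y i = 1 → 0 < s i) → y ∈ A) {f : Fin m → Fin 3 → ℤ}
    (hf : ∀ j, f j ∈ A ∨ f j ∈ core) (hs : ∀ i, ∑ j, f j i = s i) :
    IsTuple s Set.univ A f := by
  refine ⟨fun j => ?_, fun i _ => hs i⟩
  rcases hf j with h | h
  · exact h
  · refine hcore _ h fun i hi => ?_
    have := Finset.single_le_sum (f := fun k => f k i) (s := Finset.univ)
      (fun k _ => cube_nonneg (by
        rcases hf k with h | h
        exacts [hA h, core_subset_cube h]) i) (Finset.mem_univ j)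
    simp only [hi, hs i] at this
    omega

/-- A potential on the vertices of the cube: `3` on those with one nonzero coordinate, `1` on those
with two, and `0` on `(0,0,0)` and `(1,1,1)`. -/
def potential (y : Fin 3 → ℤ) : ℤ :=
  if y 0 + y 1 + y 2 = 1 then 3 else if y 0 + y 1 + y 2 = 2 then 1 else 0

lemma potential_nonneg (y : Fin 3 → ℤ) : 0 ≤ potential y := by
  unfold potential; split_ifs <;> norm_num

/-- No move decreases the total potential of `f`. -/
def Irred (s : Fin 3 → ℤ) (A : Set (Fin 3 → ℤ)) (f : Fin m → Fin 3 → ℤ) : Prop :=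
  ∀ g, Move s Set.univ A f g → ∑ j, potential (f j) ≤ ∑ j, potential (g j)

lemma exists_irred {s : Fin 3 → ℤ} {A : Set (Fin 3 → ℤ)} (f : Fin m → Fin 3 → ℤ)
    (hf : IsTuple s Set.univ A f) :
    ∃ g, IsTuple s Set.univ A g ∧ Conn s Set.univ A f g ∧ Irred s A g := by
  induction' hn : (∑ j, potential (f j)).toNat using Nat.strong_induction_on with n ih
    generalizing f
  by_cases hirr : Irred s A f
  · exact ⟨f, hf, .refl, hirr⟩
  · simp only [Irred, not_forall, not_le] at hirr
    obtain ⟨g, hg, hlt⟩ := hirr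
    have h0 : 0 ≤ ∑ j, potential (g j) := Finset.sum_nonneg fun j _ => potential_nonneg _
    obtain ⟨g', h1, h2, h3⟩ := ih _ (by omega) g hg.1 rfl
    exact ⟨g', h1, .head hg h2, h3⟩

section

variable {s : Fin 3 → ℤ} {A : Set (Fin 3 → ℤ)} {f : Fin m → Fin 3 → ℤ}

/-- In an irreducible tuple, `u` and `w` do not both occur if they can be replaced by two vertices
of the core with the same sum and smaller potential. -/
lemma Irred.pair (hirr : Irred s A f) (hf : IsTuple s Set.univ A f) (hA : A ⊆ cube)
    (hcore : ∀ y ∈ core, (∀ i, y i = 1 → 0 < s i) → y ∈ A) {u w : Fin 3 → ℤ}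
    (u' w' : Fin 3 → ℤ) (huw : u ≠ w) (hu' : u' ∈ core) (hw' : w' ∈ core)
    (hsum : ∀ i, u i + w i = u' i + w' i)
    (hpot : potential u' + potential w' < potential u + potential w) :
    count f u = 0 ∨ count f w = 0 := by
  by_contra! hcon
  obtain ⟨j, rfl⟩ := count_ne_zero hcon.1
  obtain ⟨k, rfl⟩ := count_ne_zero hcon.2
  have hjk : k ≠ j := by rintro rfl; exact huw rfl
  have hsums : ∀ h : (Fin 3 → ℤ) → ℤ,
      ∑ l, h (Function.update (Function.update f j u') k w' l) =
        ∑ l, h (f l) - h (f j) + h u' - h (f k) + h w' := by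
    intro h
    rw [sum_update, sum_update, Function.update_of_ne hjk]
  have hle := hirr (Function.update (Function.update f j u') k w') ⟨?_, {j, k}, ?_, ?_⟩
  · rw [hsums] at hle; linarith
  · refine isTuple_of_mem_core hA hcore (fun l => ?_) fun i => ?_
    · by_cases h1 : l = k
      · subst h1; simp [hw']
      · by_cases h2 : l = j
        · subst h2; simp [h1, hu']
        · simp [h1, h2, hf.1 l]
    · rw [hsums fun y => y i, hf.2 i trivial]; linarith [hsum i]
  · exact Finset.card_le_two.trans (by norm_num)
  · intro l hl e _
    simp only [Finset.mem_insert, Finset.mem_singleton, not_or] at hl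
    simp [hl]

/-- In an irreducible tuple the three vertices with two nonzero coordinates do not all occur,
because of the relation `(0,1,1) + (1,0,1) + (1,1,0) = 2 (1,1,1) + (0,0,0)`. -/
lemma Irred.triple (hirr : Irred s A f) (hf : IsTuple s Set.univ A f) (hA : A ⊆ cube)
    (hcore : ∀ y ∈ core, (∀ i, y i = 1 → 0 < s i) → y ∈ A) :
    count f ![0, 1, 1] = 0 ∨ count f ![1, 0, 1] = 0 ∨ count f ![1, 1, 0] = 0 := by
  by_contra! hcon
  obtain ⟨j, hj⟩ := count_ne_zero hcon.1
  obtain ⟨k, hk⟩ := count_ne_zero hcon.2.1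
  obtain ⟨n, hn⟩ := count_ne_zero hcon.2.2
  have hjk : k ≠ j := by rintro rfl; exact absurd (hj.symm.trans hk) (by decide)
  have hjn : n ≠ j := by rintro rfl; exact absurd (hj.symm.trans hn) (by decide)
  have hkn : n ≠ k := by rintro rfl; exact absurd (hk.symm.trans hn) (by decide)
  set g := Function.update (Function.update (Function.update f j ![1, 1, 1]) k ![1, 1, 1]) n
    ![0, 0, 0] with hg
  have hsums : ∀ h : (Fin 3 → ℤ) → ℤ, ∑ l, h (g l) =
        ∑ l, h (f l) - h ![0, 1, 1] + h ![1, 1, 1] - h ![1, 0, 1] + h ![1, 1, 1]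
          - h ![1, 1, 0] + h ![0, 0, 0] := by
    intro h
    rw [hg, sum_update, sum_update, sum_update, Function.update_of_ne hjk,
      Function.update_of_ne hkn, Function.update_of_ne hjn, hj, hk, hn]
  have hle := hirr g ⟨?_, {j, k, n}, Finset.card_le_three, ?_⟩
  · rw [hsums, show potential ![0, 1, 1] = 1 by decide, show potential ![1, 0, 1] = 1 by decide,
      show potential ![1, 1, 0] = 1 by decide, show potential ![1, 1, 1] = 0 by decide,
      show potential ![0, 0, 0] = 0 by decide] at hle
    linarith
  · refine isTuple_of_mem_core hA hcore (fun l => ?_) fun i => ?_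
    · by_cases h1 : l = n
      · subst h1; right; simp [hg, core]
      · by_cases h2 : l = k
        · subst h2; right; simp [hg, h1, core]
        · by_cases h3 : l = j
          · subst h3; right; simp [hg, h1, h2, core]
          · left; simp [hg, h1, h2, h3, hf.1 l]
    · rw [hsums fun y => y i, hf.2 i trivial]
      fin_cases i <;> simp
  · intro l hl e _
    simp only [Finset.mem_insert, Finset.mem_singleton, not_or] at hl
    simp [hg, hl]

end

/-- A `0/1` sequence with the first `a` entries equal to one. -/
lemma sum_initial (a : ℤ) (h0 : 0 ≤ a) (hm : a ≤ m) :
    ∑ j : Fin m, (if (j : ℤ) < a then (1 : ℤ) else 0) = a := by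
  lift a to ℕ using h0
  have hm' : a ≤ m := by exact_mod_cast hm
  simp only [Nat.cast_lt]
  rw [Fin.sum_univ_eq_sum_range (fun j => if j < a then (1 : ℤ) else 0), Finset.sum_ite]
  have : Finset.filter (fun j => j < a) (Finset.range m) = Finset.range a := by
    ext j; simp; omega
  simp [this]

/-- Three intervals, the first and the second an initial and a final part of the third. -/
lemma exists_intervals {a b c : ℤ} (ha : 0 ≤ a) (hb : 0 ≤ b) (hac : a ≤ c) (hbc : b ≤ c)
    (hc : c ≤ m) :
    ∃ p q r : Fin m → ℤ, ∑ j, p j = a ∧ ∑ j, q j = b ∧ ∑ j, r j = c ∧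
      ∀ j, (p j = 0 ∧ q j = 0 ∧ r j = 0) ∨ (p j = 1 ∧ q j = 0 ∧ r j = 1) ∨
        (p j = 1 ∧ q j = 1 ∧ r j = 1) ∨ (p j = 0 ∧ q j = 1 ∧ r j = 1) ∨
        (p j = 0 ∧ q j = 0 ∧ r j = 1 ∧ a + b < c) := by
  refine ⟨fun j => if (j : ℤ) < a then 1 else 0,
    fun j => (if (j : ℤ) < c then 1 else 0) - (if (j : ℤ) < c - b then 1 else 0),
    fun j => if (j : ℤ) < c then 1 else 0, sum_initial a ha (by omega), ?_,
    sum_initial c (by omega) hc, fun j => ?_⟩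
  · rw [Finset.sum_sub_distrib, sum_initial c (by omega) hc, sum_initial _ (by omega) (by omega)]
    ring
  · dsimp only
    split_ifs <;> omega

/-- The multiplicities in an irreducible tuple are functions of its sum. -/
lemma multiplicities_of_irred {o a b c t x y z : ℕ} {n s₀ s₁ s₂ : ℤ}
    (h : (x = 0 ∨ a = 0) ∧ (y = 0 ∨ b = 0) ∧ (z = 0 ∨ c = 0) ∧ (x = 0 ∨ y = 0) ∧
      (x = 0 ∨ z = 0) ∧ (y = 0 ∨ z = 0) ∧ (x = 0 ∨ t = 0) ∧ (y = 0 ∨ t = 0) ∧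
      (z = 0 ∨ t = 0) ∧ (a = 0 ∨ b = 0 ∨ c = 0))
    (h' : n = o + a + b + c + t + x + y + z ∧ s₀ = b + c + t + x ∧ s₁ = a + c + t + y ∧
      s₂ = a + b + t + z) :
    (x : ℤ) = max 0 (s₀ - s₁ - s₂) ∧ (y : ℤ) = max 0 (s₁ - s₀ - s₂) ∧
      (z : ℤ) = max 0 (s₂ - s₀ - s₁) ∧
      (t : ℤ) = max 0 (min (s₀ + s₁ - s₂) (min (s₀ + s₂ - s₁) (s₁ + s₂ - s₀))) := by
  obtain ⟨h1, h2, h3, h4, h5, h6, h7, h8, h9, h10⟩ := h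
  rcases Nat.eq_zero_or_pos x with rfl | hx
  · rcases Nat.eq_zero_or_pos y with rfl | hy
    · rcases Nat.eq_zero_or_pos z with rfl | hz
      · clear h1 h2 h3 h4 h5 h6 h7 h8 h9
        rcases h10 with rfl | rfl | rfl <;> refine ⟨?_, ?_, ?_, ?_⟩ <;> omega
      · obtain rfl := h3.resolve_left hz.ne'
        obtain rfl := h9.resolve_left hz.ne'
        clear h1 h2 h3 h4 h5 h6 h7 h8 h9 h10
        refine ⟨?_, ?_, ?_, ?_⟩ <;> omega
    · obtain rfl := h2.resolve_left hy.ne'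
      obtain rfl := h6.resolve_left hy.ne'
      obtain rfl := h8.resolve_left hy.ne'
      clear h1 h2 h3 h4 h5 h6 h7 h8 h9 h10
      refine ⟨?_, ?_, ?_, ?_⟩ <;> omega
  · obtain rfl := h1.resolve_left hx.ne'
    obtain rfl := h4.resolve_left hx.ne'
    obtain rfl := h5.resolve_left hx.ne'
    obtain rfl := h7.resolve_left hx.ne'
    clear h1 h2 h3 h4 h5 h6 h7 h8 h9 h10
    refine ⟨?_, ?_, ?_, ?_⟩ <;> omega

/-- A set of vertices of the cube is good if it contains the core, as far as its elements can occur
in a tuple with sum `s`, and those of `(1,0,0)`, `(0,1,0)`, `(0,0,1)` that no tuple with sum `s` can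
avoid. By moves of two entries and the cubic relation of `Irred.triple`, any tuple becomes
irreducible, and the irreducible tuple is determined by `s` up to order. -/
theorem good_of_core {s : Fin 3 → ℤ} {A : Set (Fin 3 → ℤ)} (hA : A ⊆ cube)
    (hs : ∀ i, 0 ≤ s i ∧ s i ≤ m)
    (hcore : ∀ y ∈ core, (∀ i, y i = 1 → 0 < s i) → y ∈ A)
    (h0 : s 1 + s 2 < s 0 → ![1, 0, 0] ∈ A) (h1 : s 0 + s 2 < s 1 → ![0, 1, 0] ∈ A)
    (h2 : s 0 + s 1 < s 2 → ![0, 0, 1] ∈ A) : Good m s Set.univ A := by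
  constructor
  · have hor : (s 0 ≤ s 2 ∧ s 1 ≤ s 2) ∨ (s 0 ≤ s 1 ∧ s 2 ≤ s 1) ∨ (s 1 ≤ s 0 ∧ s 2 ≤ s 0) := by
      omega
    -- The ones of the two smaller coordinates fill those of the largest from both ends.
    rcases hor with h | h | h
    · obtain ⟨p, q, r, hp, hq, hr, hpqr⟩ := exists_intervals (hs 0).1 (hs 1).1 h.1 h.2 (hs 2).2
      refine ⟨fun j => ![p j, q j, r j], isTuple_of_mem_core hA hcore (fun j => ?_) fun i => ?_⟩
      · rcases hpqr j with ⟨e1, e2, e3⟩ | ⟨e1, e2, e3⟩ | ⟨e1, e2, e3⟩ | ⟨e1, e2, e3⟩ |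
          ⟨e1, e2, e3, e4⟩ <;> simp only [e1, e2, e3]
        · exact .inr (by decide)
        · exact .inr (by decide)
        · exact .inr (by decide)
        · exact .inr (by decide)
        · exact .inl (h2 e4)
      · fin_cases i <;> simpa
    · obtain ⟨p, q, r, hp, hq, hr, hpqr⟩ := exists_intervals (hs 0).1 (hs 2).1 h.1 h.2 (hs 1).2
      refine ⟨fun j => ![p j, r j, q j], isTuple_of_mem_core hA hcore (fun j => ?_) fun i => ?_⟩
      · rcases hpqr j with ⟨e1, e2, e3⟩ | ⟨e1, e2, e3⟩ | ⟨e1, e2, e3⟩ | ⟨e1, e2, e3⟩ |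
          ⟨e1, e2, e3, e4⟩ <;> simp only [e1, e2, e3]
        · exact .inr (by decide)
        · exact .inr (by decide)
        · exact .inr (by decide)
        · exact .inr (by decide)
        · exact .inl (h1 e4)
      · fin_cases i <;> simpa
    · obtain ⟨p, q, r, hp, hq, hr, hpqr⟩ := exists_intervals (hs 1).1 (hs 2).1 h.1 h.2 (hs 0).2
      refine ⟨fun j => ![r j, p j, q j], isTuple_of_mem_core hA hcore (fun j => ?_) fun i => ?_⟩
      · rcases hpqr j with ⟨e1, e2, e3⟩ | ⟨e1, e2, e3⟩ | ⟨e1, e2, e3⟩ | ⟨e1, e2, e3⟩ |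
          ⟨e1, e2, e3, e4⟩ <;> simp only [e1, e2, e3]
        · exact .inr (by decide)
        · exact .inr (by decide)
        · exact .inr (by decide)
        · exact .inr (by decide)
        · exact .inl (h0 e4)
      · fin_cases i <;> simpa
  · intro f g hf hg
    obtain ⟨f', hf', hff', hfi⟩ := exists_irred f hf
    obtain ⟨g', hg', hgg', hgi⟩ := exists_irred g hg
    refine (hff'.trans ?_).trans (hgg'.symm hg)
    -- The vertices that occur in an irreducible tuple are affinely independent.
    have key : ∀ k : Fin m → Fin 3 → ℤ, IsTuple s Set.univ A k → Irred s A k →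
        (count k ![1, 0, 0] = 0 ∨ count k ![0, 1, 1] = 0) ∧
        (count k ![0, 1, 0] = 0 ∨ count k ![1, 0, 1] = 0) ∧
        (count k ![0, 0, 1] = 0 ∨ count k ![1, 1, 0] = 0) ∧
        (count k ![1, 0, 0] = 0 ∨ count k ![0, 1, 0] = 0) ∧
        (count k ![1, 0, 0] = 0 ∨ count k ![0, 0, 1] = 0) ∧
        (count k ![0, 1, 0] = 0 ∨ count k ![0, 0, 1] = 0) ∧
        (count k ![1, 0, 0] = 0 ∨ count k ![1, 1, 1] = 0) ∧
        (count k ![0, 1, 0] = 0 ∨ count k ![1, 1, 1] = 0) ∧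
        (count k ![0, 0, 1] = 0 ∨ count k ![1, 1, 1] = 0) ∧
        (count k ![0, 1, 1] = 0 ∨ count k ![1, 0, 1] = 0 ∨ count k ![1, 1, 0] = 0) := by
      intro k hk hi
      refine ⟨hi.pair hk hA hcore ![0, 0, 0] ![1, 1, 1] ?_ ?_ ?_ ?_ ?_,
        hi.pair hk hA hcore ![0, 0, 0] ![1, 1, 1] ?_ ?_ ?_ ?_ ?_,
        hi.pair hk hA hcore ![0, 0, 0] ![1, 1, 1] ?_ ?_ ?_ ?_ ?_,
        hi.pair hk hA hcore ![0, 0, 0] ![1, 1, 0] ?_ ?_ ?_ ?_ ?_,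
        hi.pair hk hA hcore ![0, 0, 0] ![1, 0, 1] ?_ ?_ ?_ ?_ ?_,
        hi.pair hk hA hcore ![0, 0, 0] ![0, 1, 1] ?_ ?_ ?_ ?_ ?_,
        hi.pair hk hA hcore ![1, 1, 0] ![1, 0, 1] ?_ ?_ ?_ ?_ ?_,
        hi.pair hk hA hcore ![1, 1, 0] ![0, 1, 1] ?_ ?_ ?_ ?_ ?_,
        hi.pair hk hA hcore ![1, 0, 1] ![0, 1, 1] ?_ ?_ ?_ ?_ ?_, hi.triple hk hA hcore⟩ <;>
      decide
    have hf1 := key f' hf' hfi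
    have hg1 := key g' hg' hgi
    have hf2 := count_eqs (fun j => hA (hf'.1 j)) (fun i => hf'.2 i trivial)
    have hg2 := count_eqs (fun j => hA (hg'.1 j)) (fun i => hg'.2 i trivial)
    refine conn_of_count_eq hA hf' hg' ?_
    have hf3 := multiplicities_of_irred hf1 hf2
    have hg3 := multiplicities_of_irred hg1 hg2
    clear hf1 hg1
    unfold cube
    simp only [Finset.mem_insert, Finset.mem_singleton, forall_eq_or_imp, forall_eq]
    omega

/-- A set of vertices of the standard simplex is good if it contains those needed for the sum `s`:
as the vertices are affinely independent, the tuple is unique up to order. -/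
theorem good_of_simplex {s : Fin 3 → ℤ} {A : Set (Fin 3 → ℤ)}
    (hA : A ⊆ ({![0, 0, 0], ![1, 0, 0], ![0, 1, 0], ![0, 0, 1]} : Finset (Fin 3 → ℤ)))
    (hs : ∀ i, 0 ≤ s i) (hsm : s 0 + s 1 + s 2 ≤ m)
    (h : s 0 + s 1 + s 2 < m → ![0, 0, 0] ∈ A) (h0 : 0 < s 0 → ![1, 0, 0] ∈ A)
    (h1 : 0 < s 1 → ![0, 1, 0] ∈ A) (h2 : 0 < s 2 → ![0, 0, 1] ∈ A) :
    Good m s Set.univ A := by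
  have hA' : A ⊆ cube := fun y hy => by
    have := hA hy
    revert this
    simp only [Finset.coe_insert, Finset.coe_singleton, Set.mem_insert_iff, Set.mem_singleton_iff]
    rintro (rfl | rfl | rfl | rfl) <;> decide
  have hs0 := hs 0
  have hs1 := hs 1
  have hs2 := hs 2
  constructor
  · refine ⟨fun j => ![if (j : ℤ) < s 0 then 1 else 0,
      (if (j : ℤ) < s 0 + s 1 then 1 else 0) - (if (j : ℤ) < s 0 then 1 else 0),
      (if (j : ℤ) < s 0 + s 1 + s 2 then 1 else 0) - (if (j : ℤ) < s 0 + s 1 then 1 else 0)],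
      fun j => ?_, fun i _ => ?_⟩
    · have := j.2
      dsimp only
      split_ifs
      all_goals first | omega | skip
      · simpa using h0 (by omega)
      · simpa using h1 (by omega)
      · simpa using h2 (by omega)
      · simpa using h (by omega)
    · fin_cases i
      · simpa using sum_initial (s 0) hs0 (by omega)
      · simp [Finset.sum_sub_distrib, sum_initial (m := m) (s 0) hs0 (by omega),
          sum_initial (m := m) (s 0 + s 1) (by omega) (by omega)]
      · simp [Finset.sum_sub_distrib, sum_initial (m := m) (s 0 + s 1) (by omega) (by omega),
          sum_initial (m := m) (s 0 + s 1 + s 2) (by omega) (by omega)]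
  · intro f g hf hg
    have hzero : ∀ k : Fin m → Fin 3 → ℤ, IsTuple s Set.univ A k →
        count k ![0, 1, 1] = 0 ∧ count k ![1, 0, 1] = 0 ∧ count k ![1, 1, 0] = 0 ∧
          count k ![1, 1, 1] = 0 := by
      intro k hk
      refine ⟨?_, ?_, ?_, ?_⟩ <;>
      · by_contra hne
        obtain ⟨j, hj⟩ := count_ne_zero hne
        have := hA (hk.1 j)
        rw [hj] at this
        exact absurd (Finset.mem_coe.mp this) (by decide)
    have hf1 := hzero f hf
    have hg1 := hzero g hg
    have hf2 := count_eqs (fun j => hA' (hf.1 j)) (fun i => hf.2 i trivial)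
    have hg2 := count_eqs (fun j => hA' (hg.1 j)) (fun i => hg.2 i trivial)
    refine conn_of_count_eq hA' hf hg ?_
    unfold cube
    simp only [Finset.mem_insert, Finset.mem_singleton, forall_eq_or_imp, forall_eq]
    omega

end TupleMoves

/-! ### The local conditions at the vertices -/

namespace TupleMoves

variable {E : Type*} {m : ℕ}

/-- If all elements of `C` agree on `F`, there is only one tuple to consider. -/
lemma good_of_const {x : E → ℤ} {F : Set E} {C : Set (E → ℤ)} (a : E → ℤ) (ha : a ∈ C)
    (hC : ∀ y ∈ C, ∀ e ∈ F, y e = a e) (hx : ∀ e ∈ F, x e = m * a e) : Good m x F C :=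
  ⟨⟨fun _ => a, fun _ => ha, fun e he => by simp [hx e he]⟩, fun f g hf hg =>
    Conn.of_eqOn hg fun j e he => (hC _ (hf.1 j) e he).trans (hC _ (hg.1 j) e he).symm⟩

/-- Goodness may be checked in `0/1` coordinates: the edges in `F` are given distinct coordinates
`ι e`, with `y e = p e + δ e * z (ι e)`. Coordinates that belong to no edge are constantly zero. -/
theorem Good.of_bits {x : E → ℤ} {F : Set E} {C : Set (E → ℤ)} (hC : DependsOn F C)
    {ι : E → Fin 3} (hι : Set.InjOn ι F) {p δ : E → ℤ} (hδ : ∀ e ∈ F, δ e ≠ 0)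
    (hbox : ∀ y ∈ C, ∀ e ∈ F, y e = p e ∨ y e = p e + δ e) {s : Fin 3 → ℤ}
    (hx : ∀ e ∈ F, x e = m * p e + δ e * s (ι e)) (hs : ∀ i ∉ ι '' F, s i = 0)
    (hgood : Good m s Set.univ {z | z ∈ cube ∧ (fun e => p e + δ e * z (ι e)) ∈ C}) :
    Good m x F C := by
  classical
  set A : Set (Fin 3 → ℤ) := {z | z ∈ cube ∧ (fun e => p e + δ e * z (ι e)) ∈ C} with hA
  let val : (Fin 3 → ℤ) → E → ℤ := fun z e => p e + δ e * z (ι e)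
  let bits : (E → ℤ) → Fin 3 → ℤ := fun y i => if ∃ e ∈ F, ι e = i ∧ y e ≠ p e then 1 else 0
  have hbits : ∀ (y : E → ℤ) e, e ∈ F → bits y (ι e) = if y e ≠ p e then 1 else 0 := by
    intro y e he
    simp only [bits]
    refine if_congr ⟨?_, fun h => ⟨e, he, rfl, h⟩⟩ rfl rfl
    rintro ⟨e', he', h1, h2⟩
    rwa [← hι he' he h1]
  have hval : ∀ y ∈ C, ∀ e ∈ F, val (bits y) e = y e := by
    intro y hy e he
    simp only [val, hbits y e he]
    split_ifs with h
    · rcases hbox y hy e he with h' | h'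
      · exact absurd h' h
      · rw [h']; ring
    · rw [not_not.mp h]; ring
  have hbA : ∀ y ∈ C, bits y ∈ A := by
    refine fun y hy => ⟨?_, hC _ _ (fun e he => (hval y hy e he).symm) hy⟩
    have h01 : ∀ i, bits y i = 0 ∨ bits y i = 1 := fun i => by
      simp only [bits]; split_ifs <;> simp
    have : bits y = ![bits y 0, bits y 1, bits y 2] := by ext i; fin_cases i <;> rfl
    rw [this]
    exact mem_cube_of_bits (h01 0) (h01 1) (h01 2)
  have up : ∀ z : Fin m → Fin 3 → ℤ, IsTuple s Set.univ A z →
      IsTuple x F C (fun j => val (z j)) := by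
    refine fun z hz => ⟨fun j => (hz.1 j).2, fun e he => ?_⟩
    simp only [val, Finset.sum_add_distrib, ← Finset.mul_sum, hz.2 (ι e) trivial]
    simp [hx e he]
  have down : ∀ f : Fin m → E → ℤ, IsTuple x F C f →
      IsTuple s Set.univ A (fun j => bits (f j)) := by
    refine fun f hf => ⟨fun j => hbA _ (hf.1 j), fun i _ => ?_⟩
    by_cases hi : i ∈ ι '' F
    · obtain ⟨e, he, rfl⟩ := hi
      have h1 : ∑ j, val (bits (f j)) e = x e := by
        rw [← hf.2 e he]; exact Finset.sum_congr rfl fun j _ => hval _ (hf.1 j) e he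
      simp only [val, Finset.sum_add_distrib, ← Finset.mul_sum, hx e he] at h1
      simpa [hδ e he] using h1
    · rw [hs i hi]
      refine Finset.sum_eq_zero fun j _ => ?_
      simp only [bits]
      rw [if_neg]
      rintro ⟨e, he, rfl, -⟩
      exact hi ⟨e, he, rfl⟩
  constructor
  · obtain ⟨z, hz⟩ := hgood.1
    exact ⟨_, up z hz⟩
  · intro f g hf hg
    have key : ∀ z z' : Fin m → Fin 3 → ℤ, Conn s Set.univ A z z' →
        Conn x F C (fun j => val (z j)) (fun j => val (z' j)) := by
      intro z z' h
      induction h with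
      | refl => exact .refl
      | tail _ h ih =>
        obtain ⟨hz', J, hJ, hJ'⟩ := h
        refine ih.tail ⟨up _ hz', J, hJ, fun j hj e _ => ?_⟩
        simp only [val, hJ' j hj (ι e) trivial]
    refine (Conn.of_eqOn (up _ (down f hf)) fun j e he => (hval _ (hf.1 j) e he).symm).trans
      ((key _ _ (hgood.2 _ _ (down f hf) (down g hg))).trans
        (Conn.of_eqOn hg fun j e he => hval _ (hg.1 j) e he))

/-- `Good.of_bits` for a condition on two edges. -/
lemma good_pair {x : E → ℤ} {e₁ e₂ : E} (h12 : e₁ ≠ e₂) (R : ℤ → ℤ → Prop) {p₁ p₂ δ₁ δ₂ s₁ s₂ : ℤ}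
    (hδ₁ : δ₁ ≠ 0) (hδ₂ : δ₂ ≠ 0) (hR₁ : ∀ u v, R u v → u = p₁ ∨ u = p₁ + δ₁)
    (hR₂ : ∀ u v, R u v → v = p₂ ∨ v = p₂ + δ₂)
    (hx₁ : x e₁ = m * p₁ + δ₁ * s₁) (hx₂ : x e₂ = m * p₂ + δ₂ * s₂)
    (hgood : Good m ![s₁, s₂, 0] Set.univ
      {z | z ∈ cube ∧ R (p₁ + δ₁ * z 0) (p₂ + δ₂ * z 1)}) :
    Good m x {e₁, e₂} {y | R (y e₁) (y e₂)} := by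
  classical
  refine Good.of_bits (ι := fun e => if e = e₁ then 0 else 1)
    (p := fun e => if e = e₁ then p₁ else p₂) (δ := fun e => if e = e₁ then δ₁ else δ₂)
    (s := ![s₁, s₂, 0]) ?_ ?_ ?_ ?_ ?_ ?_ ?_
  · intro y z hyz hy
    simpa only [Set.mem_ofPred_eq, ← hyz e₁ (by simp), ← hyz e₂ (by simp)] using hy
  · rintro e (rfl | rfl) e' (rfl | rfl) h <;> simp_all [h12.symm]
  · rintro e (rfl | rfl) <;> simp [h12.symm, hδ₁, hδ₂]
  · rintro y hy e (rfl | rfl)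
    · simpa using hR₁ _ _ hy
    · simpa [h12.symm] using hR₂ _ _ hy
  · rintro e (rfl | rfl) <;> simp [h12.symm, hx₁, hx₂]
  · intro i hi
    fin_cases i
    · exact absurd ⟨e₁, by simp, by simp⟩ hi
    · exact absurd ⟨e₂, by simp, by simp [h12.symm]⟩ hi
    · rfl
  · simpa [h12.symm] using hgood

/-- `Good.of_bits` for a condition on three edges. -/
lemma good_triple {x : E → ℤ} {e₁ e₂ e₃ : E} (h12 : e₁ ≠ e₂) (h13 : e₁ ≠ e₃) (h23 : e₂ ≠ e₃)
    (R : ℤ → ℤ → ℤ → Prop) {p₁ p₂ p₃ δ₁ δ₂ δ₃ s₁ s₂ s₃ : ℤ}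
    (hδ₁ : δ₁ ≠ 0) (hδ₂ : δ₂ ≠ 0) (hδ₃ : δ₃ ≠ 0)
    (hR₁ : ∀ u v w, R u v w → u = p₁ ∨ u = p₁ + δ₁)
    (hR₂ : ∀ u v w, R u v w → v = p₂ ∨ v = p₂ + δ₂)
    (hR₃ : ∀ u v w, R u v w → w = p₃ ∨ w = p₃ + δ₃)
    (hx₁ : x e₁ = m * p₁ + δ₁ * s₁) (hx₂ : x e₂ = m * p₂ + δ₂ * s₂)
    (hx₃ : x e₃ = m * p₃ + δ₃ * s₃)
    (hgood : Good m ![s₁, s₂, s₃] Set.univ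
      {z | z ∈ cube ∧ R (p₁ + δ₁ * z 0) (p₂ + δ₂ * z 1) (p₃ + δ₃ * z 2)}) :
    Good m x {e₁, e₂, e₃} {y | R (y e₁) (y e₂) (y e₃)} := by
  classical
  refine Good.of_bits (ι := fun e => if e = e₁ then 0 else if e = e₂ then 1 else 2)
    (p := fun e => if e = e₁ then p₁ else if e = e₂ then p₂ else p₃)
    (δ := fun e => if e = e₁ then δ₁ else if e = e₂ then δ₂ else δ₃)
    (s := ![s₁, s₂, s₃]) ?_ ?_ ?_ ?_ ?_ ?_ ?_
  · intro y z hyz hy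
    simpa only [Set.mem_ofPred_eq, ← hyz e₁ (by simp), ← hyz e₂ (by simp),
      ← hyz e₃ (by simp)] using hy
  · rintro e (rfl | rfl | rfl) e' (rfl | rfl | rfl) h <;>
      simp_all [h12.symm, h13.symm, h23.symm]
  · rintro e (rfl | rfl | rfl) <;> simp [h12.symm, h13.symm, h23.symm, hδ₁, hδ₂, hδ₃]
  · rintro y hy e (rfl | rfl | rfl)
    · simpa using hR₁ _ _ _ hy
    · simpa [h12.symm] using hR₂ _ _ _ hy
    · simpa [h13.symm, h23.symm] using hR₃ _ _ _ hy
  · rintro e (rfl | rfl | rfl) <;> simp [h12.symm, h13.symm, h23.symm, hx₁, hx₂, hx₃]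
  · intro i hi
    fin_cases i
    · exact absurd ⟨e₁, by simp, by simp⟩ hi
    · exact absurd ⟨e₂, by simp, by simp [h12.symm]⟩ hi
    · exact absurd ⟨e₃, by simp, by simp [h13.symm, h23.symm]⟩ hi
  · simpa [h12.symm, h13.symm, h23.symm] using hgood

lemma inter_cube_subset (P : (Fin 3 → ℤ) → Prop) : {z | z ∈ cube ∧ P z} ⊆ (cube : Set _) :=
  fun _ h => h.1

/-- The local condition at a vertex with a loop, for the weights `u` of the tree edge and `v` of
the loop, when the former is restricted to `{a, a + 2}` and the latter to `{b, b + 1}`. -/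
def LoopCond (L a b u v : ℤ) : Prop :=
  (u = a ∨ u = a + 2) ∧ (v = b ∨ v = b + 1) ∧ u ≤ 2 * v ∧ u + 2 * v ≤ 4 * L

/-- The local condition at a trinode, for weights restricted to `{a, a + 2}`, `{b, b + 2}` and
`{c, c + 2}`. -/
def TriCond (L a b c u v w : ℤ) : Prop :=
  (u = a ∨ u = a + 2) ∧ (v = b ∨ v = b + 2) ∧ (w = c ∨ w = c + 2) ∧
    u ≤ v + w ∧ v ≤ u + w ∧ w ≤ u + v ∧ u + v + w ≤ 4 * L

/-- A quantity that is too small to be a multiple `m * c` with `c < n` gives the bound `n ≤ c`. -/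
lemma le_of_mul_lt {n c t : ℤ} (hm : 0 < m) (h : t ≤ m * c) (ht : m * (n - 1) < t) : n ≤ c := by
  by_contra hc
  have hm' : (0 : ℤ) < m := by exact_mod_cast hm
  nlinarith [mul_le_mul_of_nonneg_left (show c ≤ n - 1 by omega) hm'.le]

/-- A vertex with a loop. Unless `s = t = 0`, the inequality `u ≤ 2 * v` can cut only the corner
`u = a + 2`, `v = b`, and `u + 2 * v ≤ 4 * L` only the corner `u = a + 2`, `v = b + 1`; by parity
not both are cut. -/
theorem good_loop {x : E → ℤ} {e f : E} (hef : e ≠ f) (hm : 0 < m) {L a b s t : ℤ} (ha : Even a)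
    (hxe : x e = m * a + 2 * s) (hxf : x f = m * b + t) (hs : 0 ≤ s ∧ s < m) (ht : 0 ≤ t ∧ t < m)
    (h1 : x e ≤ 2 * x f) (h2 : x e + 2 * x f ≤ 4 * L * m) :
    Good m x {e, f} {y | LoopCond L a b (y e) (y f)} := by
  obtain ⟨k, rfl⟩ := ha
  obtain ⟨c, hc⟩ : ∃ c, c = b - k := ⟨_, rfl⟩
  obtain ⟨d, hd⟩ : ∃ d, d = 2 * L - b - k := ⟨_, rfl⟩
  have hc' : s - t ≤ m * c := by rw [hc, mul_sub]; rw [hxe, hxf] at h1; linarith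
  have hd' : s + t ≤ m * d := by
    rw [hd, mul_sub, mul_sub]; rw [hxe, hxf] at h2; linarith
  have hc0 : 0 ≤ c := le_of_mul_lt hm hc' (by linarith)
  have hd0 : 0 ≤ d := le_of_mul_lt hm hd' (by linarith)
  by_cases hd1 : d = 1
  · -- The constraint `u + 2 * v ≤ 4 * L` cuts a corner: reflect the coordinate of the loop.
    rw [hd1] at hd'
    refine good_pair hef (LoopCond L (k + k) b) (p₁ := k + k) (δ₁ := 2) (s₁ := s) (p₂ := b + 1)
      (δ₂ := -1) (s₂ := m - t) (by norm_num) (by norm_num) (fun u v h => h.1)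
      (fun u v h => by have := h.2.1; omega) hxe (by rw [hxf]; ring)
      (good_of_core (inter_cube_subset _) (fun i => ?_) ?_ ?_ ?_ ?_)
    · fin_cases i <;> simp <;> omega
    · simp only [core, Finset.mem_insert, Finset.mem_singleton, forall_eq_or_imp, forall_eq]
      refine ⟨fun _ => ⟨by decide, ?_⟩, fun h => absurd (h 2 rfl) (by simp),
        fun h => absurd (h 2 rfl) (by simp), fun _ => ⟨by decide, ?_⟩,
        fun h => absurd (h 2 rfl) (by simp)⟩ <;> simp [LoopCond] <;> omega
    · simp; omega
    · exact fun _ => ⟨by decide, by simp [LoopCond]; omega⟩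
    · simp; omega
  · have hst : d = 0 → s = 0 ∧ t = 0 := by rintro rfl; omega
    have hst' : t < s → 1 ≤ c := by
      intro h; by_contra hc1
      obtain rfl : c = 0 := by omega
      omega
    refine good_pair hef (LoopCond L (k + k) b) (p₁ := k + k) (δ₁ := 2) (s₁ := s) (p₂ := b)
      (δ₂ := 1) (s₂ := t) (by norm_num) (by norm_num) (fun u v h => h.1)
      (fun u v h => h.2.1) hxe (by rw [hxf]; ring)
      (good_of_core (inter_cube_subset _) (fun i => ?_) ?_ ?_ ?_ ?_)
    · fin_cases i <;> simp <;> omega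
    · simp only [core, Finset.mem_insert, Finset.mem_singleton, forall_eq_or_imp, forall_eq]
      refine ⟨fun _ => ⟨by decide, ?_⟩, fun h => absurd (h 2 rfl) (by simp),
        fun h => absurd (h 2 rfl) (by simp), fun h => ⟨by decide, ?_⟩,
        fun h => absurd (h 2 rfl) (by simp)⟩
      · simp [LoopCond]; omega
      · have := h 0 rfl
        simp at this
        simp [LoopCond]; omega
    · exact fun h => ⟨by decide, by simp at h; simp [LoopCond]; omega⟩
    · exact fun h => ⟨by decide, by simp at h; simp [LoopCond]; omega⟩
    · simp; omega

/-- A trinode two of whose edges have constant weight, for instance because they are leaf-edges of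
odd weight. -/
theorem good_tri_of_fixed {x : E → ℤ} {e₁ e₂ e₃ : E} (h12 : e₁ ≠ e₂) (h13 : e₁ ≠ e₃)
    (h23 : e₂ ≠ e₃) (hm : 0 < m) {L a₁ a₂ a₃ s : ℤ} (ha : Even (a₁ + a₂ + a₃))
    (hx₁ : x e₁ = m * a₁) (hx₂ : x e₂ = m * a₂) (hx₃ : x e₃ = m * a₃ + 2 * s)
    (hs : 0 ≤ s ∧ s < m) (h1 : x e₁ ≤ x e₂ + x e₃) (h2 : x e₂ ≤ x e₁ + x e₃)
    (h3 : x e₃ ≤ x e₁ + x e₂) (h4 : x e₁ + x e₂ + x e₃ ≤ 4 * L * m) :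
    Good m x {e₁, e₂, e₃} {y | TriCond L a₁ a₂ a₃ (y e₁) (y e₂) (y e₃)} := by
  obtain ⟨k, hk⟩ := ha
  obtain ⟨d, hd⟩ : ∃ d, d = 2 * L - k := ⟨_, rfl⟩
  rw [hx₁, hx₂, hx₃] at h1 h2 h3 h4
  have g1 : -s ≤ m * (k - a₁) := by
    have : (m : ℤ) * (a₁ + a₂ + a₃) = m * (k + k) := by rw [hk]
    linarith [mul_sub (m : ℤ) k a₁]
  have g2 : -s ≤ m * (k - a₂) := by
    have : (m : ℤ) * (a₁ + a₂ + a₃) = m * (k + k) := by rw [hk]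
    linarith [mul_sub (m : ℤ) k a₂]
  have g3 : s ≤ m * (k - a₃) := by
    have : (m : ℤ) * (a₁ + a₂ + a₃) = m * (k + k) := by rw [hk]
    linarith [mul_sub (m : ℤ) k a₃]
  have g4 : s ≤ m * d := by
    have : (m : ℤ) * (a₁ + a₂ + a₃) = m * (k + k) := by rw [hk]
    rw [hd]
    linarith [mul_sub (m : ℤ) (2 * L) k]
  have c1 : 0 ≤ k - a₁ := le_of_mul_lt hm g1 (by linarith)
  have c2 : 0 ≤ k - a₂ := le_of_mul_lt hm g2 (by linarith)
  have c3 : 0 ≤ k - a₃ := le_of_mul_lt hm g3 (by linarith)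
  have c4 : 0 ≤ d := le_of_mul_lt hm g4 (by linarith)
  have c3' : 0 < s → 1 ≤ k - a₃ := fun h => le_of_mul_lt hm g3 (by linarith)
  have c4' : 0 < s → 1 ≤ d := fun h => le_of_mul_lt hm g4 (by linarith)
  refine good_triple h12 h13 h23 (TriCond L a₁ a₂ a₃) (p₁ := a₁) (p₂ := a₂) (p₃ := a₃) (δ₁ := 2)
    (δ₂ := 2) (δ₃ := 2) (s₁ := 0) (s₂ := 0) (s₃ := s) (by norm_num) (by norm_num) (by norm_num)
    (fun u v w h => h.1) (fun u v w h => h.2.1) (fun u v w h => h.2.2.1) (by rw [hx₁]; ring)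
    (by rw [hx₂]; ring) hx₃ (good_of_core (inter_cube_subset _) (fun i => ?_) ?_ ?_ ?_ ?_)
  · fin_cases i <;> simp; omega
  · simp only [core, Finset.mem_insert, Finset.mem_singleton, forall_eq_or_imp, forall_eq]
    refine ⟨fun _ => ⟨by decide, ?_⟩, fun h => absurd (h 1 rfl) (by simp),
      fun h => absurd (h 0 rfl) (by simp), fun h => absurd (h 0 rfl) (by simp),
      fun h => absurd (h 0 rfl) (by simp)⟩
    simp [TriCond]; omega
  · simp; omega
  · simp; omega
  · exact fun h => ⟨by decide, by simp at h; simp [TriCond]; omega⟩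

/-- The hypotheses on the three edges at a trinode used below. The sum `x e` is
`m * (2 * k e) + 2 * s e`, where `s e` is the number of entries of weight `2 * k e + 2`. -/
structure TriData (m : ℕ) (L : ℤ) (x k s : E → ℤ) (e₁ e₂ e₃ : E) : Prop where
  ne₁₂ : e₁ ≠ e₂
  ne₁₃ : e₁ ≠ e₃
  ne₂₃ : e₂ ≠ e₃
  sum₁ : x e₁ = m * (2 * k e₁) + 2 * s e₁
  sum₂ : x e₂ = m * (2 * k e₂) + 2 * s e₂
  sum₃ : x e₃ = m * (2 * k e₃) + 2 * s e₃
  nonneg₁ : 0 ≤ s e₁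
  nonneg₂ : 0 ≤ s e₂
  nonneg₃ : 0 ≤ s e₃
  lt₁ : s e₁ < m
  lt₂ : s e₂ < m
  lt₃ : s e₃ < m
  k_nonneg₁ : 0 ≤ k e₁
  k_nonneg₂ : 0 ≤ k e₂
  k_nonneg₃ : 0 ≤ k e₃
  tri₁ : s e₁ - s e₂ - s e₃ ≤ m * (k e₂ + k e₃ - k e₁)
  tri₂ : s e₂ - s e₁ - s e₃ ≤ m * (k e₁ + k e₃ - k e₂)
  tri₃ : s e₃ - s e₁ - s e₂ ≤ m * (k e₁ + k e₂ - k e₃)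
  level : s e₁ + s e₂ + s e₃ ≤ m * (2 * L - k e₁ - k e₂ - k e₃)

/-- The weightings satisfying the local condition at a trinode. -/
def triSet (L : ℤ) (k : E → ℤ) (e₁ e₂ e₃ : E) : Set (E → ℤ) :=
  {y | TriCond L (2 * k e₁) (2 * k e₂) (2 * k e₃) (y e₁) (y e₂) (y e₃)}

variable {L : ℤ} {x k s : E → ℤ} {e₁ e₂ e₃ : E}

lemma TriData.rotate (h : TriData m L x k s e₁ e₂ e₃) : TriData m L x k s e₂ e₃ e₁ where
  ne₁₂ := h.ne₂₃
  ne₁₃ := h.ne₁₂.symm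
  ne₂₃ := h.ne₁₃.symm
  sum₁ := h.sum₂
  sum₂ := h.sum₃
  sum₃ := h.sum₁
  nonneg₁ := h.nonneg₂
  nonneg₂ := h.nonneg₃
  nonneg₃ := h.nonneg₁
  lt₁ := h.lt₂
  lt₂ := h.lt₃
  lt₃ := h.lt₁
  k_nonneg₁ := h.k_nonneg₂
  k_nonneg₂ := h.k_nonneg₃
  k_nonneg₃ := h.k_nonneg₁
  tri₁ := by
    rw [show k e₃ + k e₁ - k e₂ = k e₁ + k e₃ - k e₂ by ring]; linarith [h.tri₂]
  tri₂ := by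
    rw [show k e₂ + k e₁ - k e₃ = k e₁ + k e₂ - k e₃ by ring]; linarith [h.tri₃]
  tri₃ := h.tri₁.trans' (by linarith)
  level := by
    rw [show 2 * L - k e₂ - k e₃ - k e₁ = 2 * L - k e₁ - k e₂ - k e₃ by ring]
    linarith [h.level]

lemma good_tri_rotate (h : Good m x {e₂, e₃, e₁} (triSet L k e₂ e₃ e₁)) :
    Good m x {e₁, e₂, e₃} (triSet L k e₁ e₂ e₃) := by
  have h1 : ({e₁, e₂, e₃} : Set E) = {e₂, e₃, e₁} := by
    rw [Set.insert_comm, Set.pair_comm e₁ e₃]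
  have h2 : triSet L k e₁ e₂ e₃ = triSet L k e₂ e₃ e₁ := by
    ext y; simp only [triSet, TriCond, Set.mem_ofPred_eq]; omega
  rwa [h1, h2]

/-- The level constraint cuts the corner `(1,1,1)`, and one of the triangle inequalities cuts none.
Reflecting the coordinates of `e₂` and `e₃` exchanges the corners of these two constraints, and the
core is left intact. -/
lemma TriData.good_of_level_two (h : TriData m L x k s e₁ e₂ e₃) (hm : 0 < m)
    (h4 : 2 * L - k e₁ - k e₂ - k e₃ = 2) (h1 : 2 ≤ k e₂ + k e₃ - k e₁) :
    Good m x {e₁, e₂, e₃} (triSet L k e₁ e₂ e₃) := by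
  obtain ⟨n12, n13, n23, hx₁, hx₂, hx₃, p1, p2, p3, l1, l2, l3, k1, k2, k3, t1, t2, t3, t4⟩ := h
  have c2 : -1 ≤ k e₁ + k e₃ - k e₂ := le_of_mul_lt hm t2 (by linarith)
  have c3 : -1 ≤ k e₁ + k e₂ - k e₃ := le_of_mul_lt hm t3 (by linarith)
  rw [h4] at t4
  have hcut2 : s e₁ + s e₃ < s e₂ → 1 ≤ k e₁ + k e₃ - k e₂ := fun h =>
    le_of_mul_lt hm t2 (by linarith)
  have hcut3 : s e₁ + s e₂ < s e₃ → 1 ≤ k e₁ + k e₂ - k e₃ := fun h =>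
    le_of_mul_lt hm t3 (by linarith)
  refine good_triple n12 n13 n23 (TriCond L (2 * k e₁) (2 * k e₂) (2 * k e₃)) (p₁ := 2 * k e₁)
    (p₂ := 2 * k e₂ + 2) (p₃ := 2 * k e₃ + 2) (δ₁ := 2)
    (δ₂ := -2) (δ₃ := -2) (s₁ := s e₁) (s₂ := m - s e₂) (s₃ := m - s e₃)
    (by norm_num) (by norm_num) (by norm_num)
    (fun u v w h => h.1) (fun u v w h => by have := h.2.1; omega)
    (fun u v w h => by have := h.2.2.1; omega) hx₁
    (by rw [hx₂]; ring) (by rw [hx₃]; ring)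
    (good_of_core (inter_cube_subset _) (fun i => ?_) ?_ ?_ ?_ ?_)
  · fin_cases i <;> simp <;> omega
  · simp only [core, Finset.mem_insert, Finset.mem_singleton, forall_eq_or_imp, forall_eq]
    refine ⟨fun _ => ⟨by decide, ?_⟩, fun _ => ⟨by decide, ?_⟩, fun _ => ⟨by decide, ?_⟩,
      fun _ => ⟨by decide, ?_⟩, fun _ => ⟨by decide, ?_⟩⟩ <;> simp [TriCond] <;> omega
  · simp; omega
  · exact fun h => ⟨by decide, by simp at h; simp [TriCond]; omega⟩
  · exact fun h => ⟨by decide, by simp at h; simp [TriCond]; omega⟩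

/-- A triangle inequality cuts the cube down to a simplex with apex `(0,1,1)`. -/
lemma TriData.good_of_neg (h : TriData m L x k s e₁ e₂ e₃)
    (h4 : 3 ≤ 2 * L - k e₁ - k e₂ - k e₃) (h1 : k e₂ + k e₃ - k e₁ = -1) :
    Good m x {e₁, e₂, e₃} (triSet L k e₁ e₂ e₃) := by
  obtain ⟨n12, n13, n23, hx₁, hx₂, hx₃, p1, p2, p3, l1, l2, l3, k1, k2, k3, t1, t2, t3, t4⟩ := h
  rw [h1] at t1
  refine good_triple n12 n13 n23 (TriCond L (2 * k e₁) (2 * k e₂) (2 * k e₃)) (p₁ := 2 * k e₁)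
    (p₂ := 2 * k e₂ + 2) (p₃ := 2 * k e₃ + 2) (δ₁ := 2)
    (δ₂ := -2) (δ₃ := -2) (s₁ := s e₁) (s₂ := m - s e₂) (s₃ := m - s e₃)
    (by norm_num) (by norm_num) (by norm_num)
    (fun u v w h => h.1) (fun u v w h => by have := h.2.1; omega)
    (fun u v w h => by have := h.2.2.1; omega) hx₁
    (by rw [hx₂]; ring) (by rw [hx₃]; ring)
    (good_of_simplex ?_ (fun i => ?_) ?_ ?_ ?_ ?_ ?_)
  · rintro z ⟨hz, hz'⟩
    revert hz'
    revert z
    simp only [cube, Finset.mem_insert, Finset.mem_singleton, forall_eq_or_imp, forall_eq]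
    simp [TriCond]
    omega
  · fin_cases i <;> simp <;> omega
  · simp; omega
  · exact fun h => ⟨by decide, by simp [TriCond]; omega⟩
  · exact fun h => ⟨by decide, by simp [TriCond]; omega⟩
  · exact fun h => ⟨by decide, by simp [TriCond]; omega⟩
  · exact fun h => ⟨by decide, by simp [TriCond]; omega⟩

/-- The level constraint cuts the cube down to the standard simplex. -/
lemma TriData.good_of_level_one (h : TriData m L x k s e₁ e₂ e₃) (hm : 0 < m)
    (h4 : 2 * L - k e₁ - k e₂ - k e₃ = 1) :
    Good m x {e₁, e₂, e₃} (triSet L k e₁ e₂ e₃) := by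
  obtain ⟨n12, n13, n23, hx₁, hx₂, hx₃, p1, p2, p3, l1, l2, l3, k1, k2, k3, t1, t2, t3, t4⟩ := h
  have c1 : -1 ≤ k e₂ + k e₃ - k e₁ := le_of_mul_lt hm t1 (by linarith)
  have c2 : -1 ≤ k e₁ + k e₃ - k e₂ := le_of_mul_lt hm t2 (by linarith)
  have c3 : -1 ≤ k e₁ + k e₂ - k e₃ := le_of_mul_lt hm t3 (by linarith)
  rw [h4] at t4
  have z1 : s e₁ + s e₂ + s e₃ < m ∨ 0 < s e₁ → 1 ≤ k e₂ + k e₃ - k e₁ := fun h => by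
    have := le_of_mul_lt (n := 0) hm t1 (by rcases h with h | h <;> linarith)
    omega
  have z2 : s e₁ + s e₂ + s e₃ < m ∨ 0 < s e₂ → 1 ≤ k e₁ + k e₃ - k e₂ := fun h => by
    have := le_of_mul_lt (n := 0) hm t2 (by rcases h with h | h <;> linarith)
    omega
  have z3 : s e₁ + s e₂ + s e₃ < m ∨ 0 < s e₃ → 1 ≤ k e₁ + k e₂ - k e₃ := fun h => by
    have := le_of_mul_lt (n := 0) hm t3 (by rcases h with h | h <;> linarith)
    omega
  refine good_triple n12 n13 n23 (TriCond L (2 * k e₁) (2 * k e₂) (2 * k e₃)) (p₁ := 2 * k e₁)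
    (p₂ := 2 * k e₂) (p₃ := 2 * k e₃) (δ₁ := 2)
    (δ₂ := 2) (δ₃ := 2) (s₁ := s e₁) (s₂ := s e₂) (s₃ := s e₃)
    (by norm_num) (by norm_num) (by norm_num)
    (fun u v w h => h.1) (fun u v w h => h.2.1)
    (fun u v w h => h.2.2.1) hx₁ hx₂ hx₃
    (good_of_simplex ?_ (fun i => ?_) ?_ ?_ ?_ ?_ ?_)
  · rintro z ⟨hz, hz'⟩
    revert hz'
    revert z
    simp only [cube, Finset.mem_insert, Finset.mem_singleton, forall_eq_or_imp, forall_eq]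
    simp [TriCond]
    omega
  · fin_cases i <;> simp <;> omega
  · simp; omega
  · exact fun h => ⟨by decide, by simp at h; simp [TriCond]; omega⟩
  · exact fun h => ⟨by decide, by simp at h; simp [TriCond]; omega⟩
  · exact fun h => ⟨by decide, by simp at h; simp [TriCond]; omega⟩
  · exact fun h => ⟨by decide, by simp at h; simp [TriCond]; omega⟩

/-- The level constraint is inactive or forces all entries to be equal, and the triangle
inequalities cut at most the corners `(1,0,0)`, `(0,1,0)` and `(0,0,1)`. -/
lemma TriData.good_of_nonneg (h : TriData m L x k s e₁ e₂ e₃) (hm : 0 < m)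
    (h4 : 2 * L - k e₁ - k e₂ - k e₃ = 0 ∨ 3 ≤ 2 * L - k e₁ - k e₂ - k e₃)
    (c1 : 0 ≤ k e₂ + k e₃ - k e₁) (c2 : 0 ≤ k e₁ + k e₃ - k e₂)
    (c3 : 0 ≤ k e₁ + k e₂ - k e₃) : Good m x {e₁, e₂, e₃} (triSet L k e₁ e₂ e₃) := by
  obtain ⟨n12, n13, n23, hx₁, hx₂, hx₃, p1, p2, p3, l1, l2, l3, k1, k2, k3, t1, t2, t3, t4⟩ := h
  have h4' : 2 * L - k e₁ - k e₂ - k e₃ = 0 → s e₁ = 0 ∧ s e₂ = 0 ∧ s e₃ = 0 := by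
    intro h; rw [h] at t4; omega
  have hcut1 : s e₂ + s e₃ < s e₁ → 1 ≤ k e₂ + k e₃ - k e₁ := fun h =>
    le_of_mul_lt hm t1 (by linarith)
  have hcut2 : s e₁ + s e₃ < s e₂ → 1 ≤ k e₁ + k e₃ - k e₂ := fun h =>
    le_of_mul_lt hm t2 (by linarith)
  have hcut3 : s e₁ + s e₂ < s e₃ → 1 ≤ k e₁ + k e₂ - k e₃ := fun h =>
    le_of_mul_lt hm t3 (by linarith)
  refine good_triple n12 n13 n23 (TriCond L (2 * k e₁) (2 * k e₂) (2 * k e₃)) (p₁ := 2 * k e₁)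
    (p₂ := 2 * k e₂) (p₃ := 2 * k e₃) (δ₁ := 2)
    (δ₂ := 2) (δ₃ := 2) (s₁ := s e₁) (s₂ := s e₂) (s₃ := s e₃)
    (by norm_num) (by norm_num) (by norm_num)
    (fun u v w h => h.1) (fun u v w h => h.2.1)
    (fun u v w h => h.2.2.1) hx₁ hx₂ hx₃
    (good_of_core (inter_cube_subset _) (fun i => ?_) ?_ ?_ ?_ ?_)
  · fin_cases i <;> simp <;> omega
  · simp only [core, Finset.mem_insert, Finset.mem_singleton, forall_eq_or_imp, forall_eq]
    refine ⟨fun h => ⟨by decide, ?_⟩, fun h => ⟨by decide, ?_⟩, fun h => ⟨by decide, ?_⟩,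
      fun h => ⟨by decide, ?_⟩, fun h => ⟨by decide, ?_⟩⟩
    · simp [TriCond]; omega
    · have := h 1 rfl
      simp at this; simp [TriCond]; omega
    · have := h 0 rfl
      simp at this; simp [TriCond]; omega
    · have := h 0 rfl
      simp at this; simp [TriCond]; omega
    · have := h 0 rfl
      simp at this; simp [TriCond]; omega
  · exact fun h => ⟨by decide, by simp at h; simp [TriCond]; omega⟩
  · exact fun h => ⟨by decide, by simp at h; simp [TriCond]; omega⟩
  · exact fun h => ⟨by decide, by simp at h; simp [TriCond]; omega⟩

/-- A trinode with even weights. In `0/1` coordinates the right-hand sides of the four constraints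
are `k e₂ + k e₃ - k e₁` with its two rotations and `2 * L - k e₁ - k e₂ - k e₃`. They have equal
parity and sum `2 * L ≥ 4`; this rules out that all four corners of odd coordinate sum are cut from
the cube. -/
theorem TriData.good (h : TriData m L x k s e₁ e₂ e₃) (hm : 0 < m) (hL : 2 ≤ L) :
    Good m x {e₁, e₂, e₃} (triSet L k e₁ e₂ e₃) := by
  have c1 : -1 ≤ k e₂ + k e₃ - k e₁ :=
    le_of_mul_lt hm h.tri₁ (by linarith [h.nonneg₁, h.lt₂, h.lt₃])
  have c2 : -1 ≤ k e₁ + k e₃ - k e₂ :=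
    le_of_mul_lt hm h.tri₂ (by linarith [h.nonneg₂, h.lt₁, h.lt₃])
  have c3 : -1 ≤ k e₁ + k e₂ - k e₃ :=
    le_of_mul_lt hm h.tri₃ (by linarith [h.nonneg₃, h.lt₂, h.lt₁])
  have c4 : 0 ≤ 2 * L - k e₁ - k e₂ - k e₃ := le_of_mul_lt hm h.level (by
    have : (0 : ℤ) < m := by exact_mod_cast hm
    linarith [h.nonneg₁, h.nonneg₂, h.nonneg₃])
  by_cases h1 : 2 * L - k e₁ - k e₂ - k e₃ = 1
  · exact h.good_of_level_one hm h1
  by_cases h2 : 2 * L - k e₁ - k e₂ - k e₃ = 2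
  · have hor : 2 ≤ k e₂ + k e₃ - k e₁ ∨ 2 ≤ k e₃ + k e₁ - k e₂ ∨ 2 ≤ k e₁ + k e₂ - k e₃ := by
      omega
    rcases hor with h3 | h3 | h3
    · exact h.good_of_level_two hm h2 h3
    · exact good_tri_rotate (h.rotate.good_of_level_two hm (by omega) h3)
    · exact good_tri_rotate (good_tri_rotate
        (h.rotate.rotate.good_of_level_two hm (by omega) h3))
  by_cases h3 : 0 ≤ k e₂ + k e₃ - k e₁ ∧ 0 ≤ k e₁ + k e₃ - k e₂ ∧ 0 ≤ k e₁ + k e₂ - k e₃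
  · exact h.good_of_nonneg hm (by omega) h3.1 h3.2.1 h3.2.2
  · have hor : k e₂ + k e₃ - k e₁ = -1 ∨ k e₃ + k e₁ - k e₂ = -1 ∨ k e₁ + k e₂ - k e₃ = -1 := by
      omega
    rcases hor with h5 | h5 | h5
    · exact h.good_of_neg (by omega) h5
    · exact good_tri_rotate (h.rotate.good_of_neg (by omega) h5)
    · exact good_tri_rotate (good_tri_rotate
        (h.rotate.rotate.good_of_neg (by omega) h5))

end TupleMoves

/-! ### Balancing -/

namespace TupleMoves

/-- For positive `d` and `m`, the largest integer `a ≡ q` modulo `d` with `m * a ≤ x`. -/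
def base (q d : ℤ) (m : ℕ) (x : ℤ) : ℤ := q + d * ((x - m * q) / (d * m))

lemma base_spec {q d : ℤ} (hd : 0 < d) {m : ℕ} (hm : 0 < m) {x : ℤ} (hx : d ∣ x - m * q) :
    ∃ s, x = m * base q d m x + d * s ∧ 0 ≤ s ∧ s < m := by
  have hm' : (0 : ℤ) < m := by exact_mod_cast hm
  obtain ⟨t, ht⟩ := hx
  refine ⟨t % m, ?_, Int.emod_nonneg _ hm'.ne', Int.emod_lt_of_pos _ hm'⟩
  rw [base, ht, Int.mul_ediv_mul_of_pos _ _ hd]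
  have h1 := Int.mul_ediv_add_emod t m
  have h2 : x = m * q + d * t := by linarith
  calc x = m * q + d * t := h2
    _ = m * q + d * (m * (t / m) + t % m) := by rw [h1]
    _ = _ := by ring

/-- Replacing two numbers by the two closest numbers with the same sum in the same class modulo `d`
decreases the sum of squares, unless they were at distance at most `d` already. -/
lemma sq_add_sq_le {q d u v y z a : ℤ} (hd : 0 < d) (hu : d ∣ u - q) (hv : d ∣ v - q)
    (ha : d ∣ a - q) (hy : y = a ∨ y = a + d) (hz : z = a ∨ z = a + d) (hsum : y + z = u + v) :
    y ^ 2 + z ^ 2 ≤ u ^ 2 + v ^ 2 ∧ (d < |u - v| → y ^ 2 + z ^ 2 < u ^ 2 + v ^ 2) := by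
  obtain ⟨u', hu'⟩ := hu
  obtain ⟨v', hv'⟩ := hv
  obtain ⟨a', ha'⟩ := ha
  obtain rfl : u = q + d * u' := by linarith
  obtain rfl : v = q + d * v' := by linarith
  obtain rfl : a = q + d * a' := by linarith
  obtain ⟨y', rfl, hy'⟩ : ∃ y', y = q + d * y' ∧ (y' = a' ∨ y' = a' + 1) := by
    rcases hy with rfl | rfl
    exacts [⟨a', rfl, .inl rfl⟩, ⟨a' + 1, by ring, .inr rfl⟩]
  obtain ⟨z', rfl, hz'⟩ : ∃ z', z = q + d * z' ∧ (z' = a' ∨ z' = a' + 1) := by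
    rcases hz with rfl | rfl
    exacts [⟨a', rfl, .inl rfl⟩, ⟨a' + 1, by ring, .inr rfl⟩]
  have hs : y' + z' = u' + v' := by
    have : d * (y' + z') = d * (u' + v') := by linarith
    exact mul_left_cancel₀ hd.ne' this
  have hid : (q + d * u') ^ 2 + (q + d * v') ^ 2 - ((q + d * y') ^ 2 + (q + d * z') ^ 2) =
      d ^ 2 * (2 * ((u' - y') * (u' - z'))) := by
    obtain rfl : v' = y' + z' - u' := by linarith
    ring
  have hd2 : 0 < d ^ 2 := by positivity
  have h0 : 0 ≤ (u' - y') * (u' - z') := by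
    rcases le_or_gt u' a' with h | h
    · exact mul_nonneg_of_nonpos_of_nonpos (by omega) (by omega)
    · exact mul_nonneg (by omega) (by omega)
  constructor
  · nlinarith [mul_nonneg hd2.le h0]
  · intro hlt
    have h1 : 1 < |u' - v'| := by
      rw [show q + d * u' - (q + d * v') = d * (u' - v') by ring, abs_mul, abs_of_pos hd] at hlt
      by_contra hcon
      nlinarith
    have h2 : 0 < (u' - y') * (u' - z') := by
      rcases lt_abs.mp h1 with h | h
      · exact mul_pos (by omega) (by omega)
      · exact mul_pos_of_neg_of_neg (by omega) (by omega)
    nlinarith [mul_pos hd2 h2]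

/-- Numbers in one class modulo `d`, pairwise at distance at most `d`, take at most two values,
which are determined by their sum. -/
lemma eq_base_of_pairwise {q d : ℤ} (hd : 0 < d) {m : ℕ} {v : Fin m → ℤ}
    (hv : ∀ j, d ∣ v j - q) (hp : ∀ i j, |v i - v j| ≤ d) {x : ℤ} (hx : ∑ j, v j = x) (j : Fin m) :
    v j = base q d m x ∨ v j = base q d m x + d := by
  have hm : 0 < m := j.pos
  have hm' : (0 : ℤ) < m := by exact_mod_cast hm
  choose u hu using hv
  have hvu : ∀ j, v j = q + d * u j := fun j => by linarith [hu j]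
  have hxu : x - m * q = d * ∑ j, u j := by
    rw [← hx, Finset.mul_sum, ← Finset.sum_congr rfl fun j _ => hu j]
    simp
  have hp' : ∀ i j, u i ≤ u j + 1 := by
    intro i j
    have := (abs_le.mp (hp i j)).2
    rw [hvu i, hvu j] at this
    by_contra hcon
    nlinarith
  obtain ⟨k, hk⟩ : ∃ k, k = (∑ j, u j) / (m : ℤ) := ⟨_, rfl⟩
  have hbase : base q d m x = q + d * k := by
    rw [base, hxu, Int.mul_ediv_mul_of_pos _ _ hd, hk]
  have h1 : m * k ≤ ∑ j, u j := by rw [hk]; exact Int.mul_ediv_self_le hm'.ne'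
  have h2 : ∑ j, u j < m * k + m := by rw [hk]; exact Int.lt_mul_ediv_self_add hm'
  have h3 : k ≤ u j := by
    by_contra hcon
    have : ∑ i, u i < ∑ _i : Fin m, k := Finset.sum_lt_sum (fun i _ => by
      have := hp' i j; omega) ⟨j, Finset.mem_univ _, by omega⟩
    simp at this
    omega
  have h4 : u j ≤ k + 1 := by
    by_contra hcon
    have : ∑ _i : Fin m, (k + 1) < ∑ i, u i := Finset.sum_lt_sum (fun i _ => by
      have := hp' j i; omega) ⟨j, Finset.mem_univ _, by omega⟩
    simp at this
    linarith
  rw [hbase, hvu j]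
  rcases (show u j = k ∨ u j = k + 1 by omega) with h | h <;> rw [h]
  · exact .inl rfl
  · exact .inr (by ring)

/-- A graded set of weightings, closed under addition, in which every weighting can be split into
weightings of degree one that are as equal as possible, and any two such splittings are connected
by moves. The weights of degree `m` are congruent to `m * q` modulo `d`. -/
structure BalancedSystem {E : Type*} (Feas : ℕ → (E → ℤ) → Prop) (q d : E → ℤ) : Prop where
  zero : Feas 0 0
  add : ∀ {m n x y}, Feas m x → Feas n y → Feas (m + n) (x + y)
  pos : ∀ e, 0 < d e
  dvd : ∀ {m x}, Feas m x → ∀ e, d e ∣ x e - m * q e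
  good : ∀ {m x}, 0 < m → Feas m x → Good m x Set.univ
    {y | Feas 1 y ∧ ∀ e, y e = base (q e) (d e) m (x e) ∨ y e = base (q e) (d e) m (x e) + d e}

variable {E : Type*} {Feas : ℕ → (E → ℤ) → Prop} {q d : E → ℤ}

lemma BalancedSystem.sum (h : BalancedSystem Feas q d) {m : ℕ} {f : Fin m → E → ℤ}
    (hf : ∀ j, Feas 1 (f j)) : Feas m (∑ j, f j) := by
  induction m with
  | zero => simpa using h.zero
  | succ n ih =>
    rw [Fin.sum_univ_castSucc]
    exact h.add (ih fun j => hf _) (hf _)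

lemma BalancedSystem.exists_tuple (h : BalancedSystem Feas q d) {m : ℕ} (hm : 0 < m) {x : E → ℤ}
    (hx : Feas m x) : ∃ f : Fin m → E → ℤ, IsTuple x Set.univ {y | Feas 1 y} f := by
  obtain ⟨f, hf⟩ := (h.good hm hx).1
  exact ⟨f, fun j => (hf.1 j).1, hf.2⟩

/-- Any tuple is connected to one in which no two entries differ by more than `d`: balancing two
entries is a move and decreases the sum of squares. -/
lemma BalancedSystem.exists_balanced [Finite E] (h : BalancedSystem Feas q d) {m : ℕ} {x : E → ℤ}
    {f : Fin m → E → ℤ} (hf : IsTuple x Set.univ {y | Feas 1 y} f) :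
    ∃ g, IsTuple x Set.univ {y | Feas 1 y} g ∧ Conn x Set.univ {y | Feas 1 y} f g ∧
      ∀ i j e, |g i e - g j e| ≤ d e := by
  classical
  have := Fintype.ofFinite E
  induction' hn : (∑ j, ∑ e, f j e ^ 2).toNat using Nat.strong_induction_on with n ih
    generalizing f
  by_cases hbal : ∀ i j e, |f i e - f j e| ≤ d e
  · exact ⟨f, hf, .refl, hbal⟩
  push Not at hbal
  obtain ⟨i, j, e, hlt⟩ := hbal
  have hij : j ≠ i := by
    rintro rfl
    simp only [sub_self, abs_zero] at hlt
    exact absurd hlt (not_lt.mpr (h.pos e).le)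
  obtain ⟨y, hy, hysum⟩ := (h.good (m := 2) two_pos (h.add (hf.1 i) (hf.1 j))).1
  have hysum' : ∀ e, y 0 e + y 1 e = f i e + f j e := fun e => by
    simpa [Fin.sum_univ_two] using hysum e trivial
  set g := Function.update (Function.update f i (y 0)) j (y 1) with hg
  have hsums : ∀ φ : (E → ℤ) → ℤ,
      ∑ l, φ (g l) = ∑ l, φ (f l) - φ (f i) + φ (y 0) - φ (f j) + φ (y 1) := by
    intro φ
    rw [hg, sum_update, sum_update, Function.update_of_ne hij]
  have hgt : IsTuple x Set.univ {y | Feas 1 y} g := by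
    refine ⟨fun l => ?_, fun e _ => ?_⟩
    · by_cases h1 : l = j
      · subst h1; simpa [hg] using (hy 1).1
      · by_cases h2 : l = i
        · subst h2; simpa [hg, h1] using (hy 0).1
        · simpa [hg, h1, h2] using hf.1 l
    · rw [hsums fun y => y e, hf.2 e trivial]
      linarith [hysum' e]
  have hmove : Move x Set.univ {y | Feas 1 y} f g := by
    refine ⟨hgt, {i, j}, Finset.card_le_two.trans (by norm_num), fun l hl e _ => ?_⟩
    simp only [Finset.mem_insert, Finset.mem_singleton, not_or] at hl
    simp [hg, hl]
  have hdvd : ∀ l e, d e ∣ f l e - q e := fun l e => by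
    simpa using h.dvd (hf.1 l) e
  have hsq : ∀ e, _ := fun e => sq_add_sq_le (h.pos e) (hdvd i e) (hdvd j e)
    (a := base (q e) (d e) 2 ((f i + f j) e)) (by simp [base]) ((hy 0).2 e) ((hy 1).2 e) (hysum' e)
  have hdec : ∑ l, ∑ e, g l e ^ 2 < ∑ l, ∑ e, f l e ^ 2 := by
    rw [hsums fun y => ∑ e, y e ^ 2]
    have : ∑ e, (y 0 e ^ 2 + y 1 e ^ 2) < ∑ e, (f i e ^ 2 + f j e ^ 2) :=
      Finset.sum_lt_sum (fun e _ => (hsq e).1) ⟨e, Finset.mem_univ _, (hsq e).2 hlt⟩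
    rw [Finset.sum_add_distrib, Finset.sum_add_distrib] at this
    linarith
  have h0 : 0 ≤ ∑ l, ∑ e, g l e ^ 2 :=
    Finset.sum_nonneg fun l _ => Finset.sum_nonneg fun e _ => sq_nonneg _
  obtain ⟨g', h1, h2, h3⟩ := ih _ (by omega) hgt rfl
  exact ⟨g', h1, .head hmove h2, h3⟩

/-- Any two splittings of a weighting into weightings of degree one are connected by moves. -/
theorem BalancedSystem.conn [Finite E] (h : BalancedSystem Feas q d) {m : ℕ} {x : E → ℤ}
    {f g : Fin m → E → ℤ} (hf : IsTuple x Set.univ {y | Feas 1 y} f)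
    (hg : IsTuple x Set.univ {y | Feas 1 y} g) : Conn x Set.univ {y | Feas 1 y} f g := by
  rcases Nat.eq_zero_or_pos m with rfl | hm
  · exact Conn.of_eqOn hg fun j => j.elim0
  obtain ⟨f', hf', hff', hfb⟩ := h.exists_balanced hf
  obtain ⟨g', hg', hgg', hgb⟩ := h.exists_balanced hg
  have hx : Feas m x := by
    have := h.sum hf.1
    rwa [show ∑ j, f j = x from funext fun e => by
      rw [Finset.sum_apply]; exact hf.2 e trivial] at this
  have hbox : ∀ k : Fin m → E → ℤ, IsTuple x Set.univ {y | Feas 1 y} k →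
      (∀ i j e, |k i e - k j e| ≤ d e) → IsTuple x Set.univ {y | Feas 1 y ∧ ∀ e,
        y e = base (q e) (d e) m (x e) ∨ y e = base (q e) (d e) m (x e) + d e} k :=
    fun k hk hkb => ⟨fun j => ⟨hk.1 j, fun e => eq_base_of_pairwise (h.pos e)
      (v := fun j => k j e) (fun j => by simpa using h.dvd (hk.1 j) e)
      (fun i j => hkb i j e) (hk.2 e trivial) j⟩, hk.2⟩
  refine (hff'.trans ?_).trans (hgg'.symm hg)
  have key := (h.good hm hx).2 f' g' (hbox f' hf' hfb) (hbox g' hg' hgb)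
  refine Relation.ReflTransGen.mono ?_ _ _ key
  rintro k k' ⟨hk', J, hJ⟩
  exact ⟨⟨fun j => (hk'.1 j).1, hk'.2⟩, J, hJ⟩

end TupleMoves

/-! ### Semigroup algebras and toric ideals -/

namespace LatticePolytope

open MvPolynomial

variable {ι : Type*} {P : Set (ι → ℝ)} {Λ : AddSubgroup (ι → ℤ)}

lemma coe_sum_toSemigroup {κ : Type*} (J : Finset κ) (f : κ → LatticePoint P Λ) :
    ((∑ j ∈ J, (f j).toSemigroup : semigroup P Λ) : ℕ × (ι → ℤ)) =
      (J.card, ∑ j ∈ J, (f j).1) := by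
  rw [AddSubmonoid.coe_finsetSum]
  ext1
  · simp [Prod.fst_sum, LatticePoint.toSemigroup]
  · simp [Prod.snd_sum, LatticePoint.toSemigroup]

/-- The map `ℂ[X_P] → ℂ[P]`. -/
noncomputable def toricMap (P : Set (ι → ℝ)) (Λ : AddSubgroup (ι → ℤ)) :
    MvPolynomial (LatticePoint P Λ) ℂ →ₐ[ℂ] SemigroupAlgebra P Λ :=
  MvPolynomial.aeval (R := ℂ)
    (fun x : LatticePoint P Λ => (AddMonoidAlgebra.single x.toSemigroup 1 : SemigroupAlgebra P Λ))

lemma mem_toricIdeal {p : MvPolynomial (LatticePoint P Λ) ℂ} :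
    p ∈ toricIdeal P Λ ↔ toricMap P Λ p = 0 := Iff.rfl

lemma prod_single {κ : Type*} (J : Finset κ) (f : κ → LatticePoint P Λ) :
    ∏ j ∈ J, (AddMonoidAlgebra.single (f j).toSemigroup 1 : SemigroupAlgebra P Λ) =
      AddMonoidAlgebra.single (∑ j ∈ J, (f j).toSemigroup) 1 := by
  classical
  induction J using Finset.induction_on with
  | empty => simp [AddMonoidAlgebra.one_def]
  | insert a J ha ih =>
    rw [Finset.prod_insert ha, Finset.sum_insert ha, ih, AddMonoidAlgebra.single_mul_single,
      one_mul]

lemma toricMap_prod_X {κ : Type*} (J : Finset κ) (f : κ → LatticePoint P Λ) :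
    toricMap P Λ (∏ j ∈ J, X (f j)) = AddMonoidAlgebra.single (∑ j ∈ J, (f j).toSemigroup) 1 := by
  rw [map_prod, ← prod_single]
  exact Finset.prod_congr rfl fun j _ => by simp [toricMap]

lemma isNormal_of_forall_exists_sum
    (h : ∀ x : semigroup P Λ, ∃ f : Fin x.1.1 → LatticePoint P Λ, ∑ j, (f j).1 = x.1.2) :
    IsNormal P Λ := by
  rw [IsNormal, eq_top_iff]
  rintro a -
  have hsingle : ∀ x : semigroup P Λ, (AddMonoidAlgebra.single x 1 : SemigroupAlgebra P Λ) ∈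
      Algebra.adjoin ℂ (component P Λ 1 : Set (SemigroupAlgebra P Λ)) := by
    intro x
    obtain ⟨f, hf⟩ := h x
    have hx : x = ∑ j, (f j).toSemigroup := by
      apply Subtype.ext
      rw [coe_sum_toSemigroup, hf]
      simp
    rw [hx, ← prod_single]
    exact Subalgebra.prod_mem _ fun j _ =>
      Algebra.subset_adjoin (AddMonoidAlgebra.single_mem_gradeBy (R := ℂ)
        (fun x : semigroup P Λ => (x : ℕ × (ι → ℤ)).1) (f j).toSemigroup 1)
  induction a using AddMonoidAlgebra.induction_linear with
  | zero => exact Subalgebra.zero_mem _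
  | add p q hp hq => exact Subalgebra.add_mem _ hp hq
  | single x c =>
    have := Subalgebra.smul_mem _ (hsingle x) c
    rwa [AddMonoidAlgebra.smul_single, smul_eq_mul, mul_one] at this

/-- The ideal generated by the elements of degree at most three of the toric ideal. -/
noncomputable def cubicPart (P : Set (ι → ℝ)) (Λ : AddSubgroup (ι → ℤ)) :
    Ideal (MvPolynomial (LatticePoint P Λ) ℂ) :=
  Ideal.span {p | p ∈ toricIdeal P Λ ∧ p.totalDegree ≤ 3}

lemma totalDegree_prod_X_le {κ : Type*} (J : Finset κ) (f : κ → LatticePoint P Λ) :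
    (∏ j ∈ J, (X (f j) : MvPolynomial (LatticePoint P Λ) ℂ)).totalDegree ≤ J.card := by
  refine (totalDegree_finsetProd _ _).trans ?_
  simp [totalDegree_X]

/-- Monomials that differ by a move are congruent modulo the part of degree at most three. -/
lemma prod_X_sub_prod_X_mem {m : ℕ} (f g : Fin m → LatticePoint P Λ)
    (hsum : ∑ j, (f j).1 = ∑ j, (g j).1) (J : Finset (Fin m)) (hJ : J.card ≤ 3)
    (hfg : ∀ j ∉ J, f j = g j) :
    (∏ j, X (f j) - ∏ j, X (g j) : MvPolynomial (LatticePoint P Λ) ℂ) ∈ cubicPart P Λ := by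
  classical
  have hc : ∏ j ∈ Jᶜ, (X (f j) : MvPolynomial (LatticePoint P Λ) ℂ) = ∏ j ∈ Jᶜ, X (g j) :=
    Finset.prod_congr rfl fun j hj => by rw [hfg j (Finset.mem_compl.mp hj)]
  rw [← Finset.prod_mul_prod_compl J fun j => X (f j),
    ← Finset.prod_mul_prod_compl J fun j => X (g j), hc, ← sub_mul]
  refine Ideal.mul_mem_right _ _ (Ideal.subset_span ⟨?_, ?_⟩)
  · rw [mem_toricIdeal, map_sub, toricMap_prod_X, toricMap_prod_X, sub_eq_zero]
    congr 1
    apply Subtype.ext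
    rw [coe_sum_toSemigroup, coe_sum_toSemigroup]
    rw [← Finset.sum_add_sum_compl J, ← Finset.sum_add_sum_compl J (fun j => (g j).1),
      Finset.sum_congr (s₁ := Jᶜ) rfl fun j hj => by rw [hfg j (Finset.mem_compl.mp hj)]] at hsum
    rw [add_right_cancel hsum]
  · exact (totalDegree_sub _ _).trans (max_le ((totalDegree_prod_X_le J f).trans hJ)
      ((totalDegree_prod_X_le J g).trans hJ))

/-- Every monomial is a product of variables indexed by some `Fin m`. -/
lemma exists_monomial_eq_prod {σ : Type*} (u : σ →₀ ℕ) :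
    ∃ (m : ℕ) (f : Fin m → σ), (monomial u 1 : MvPolynomial σ ℂ) = ∏ j, X (f j) := by
  induction u using Finsupp.induction_linear with
  | zero => exact ⟨0, Fin.elim0, by simp⟩
  | add u v hu hv =>
    obtain ⟨m, f, hf⟩ := hu
    obtain ⟨n, g, hg⟩ := hv
    refine ⟨m + n, Fin.append f g, ?_⟩
    rw [Fin.prod_univ_add, ← one_mul (1 : ℂ), ← monomial_mul, hf, hg]
    simp
  | single a n => exact ⟨n, fun _ => a, by simp [X_pow_eq_monomial]⟩

/-- If products of variables with the same image are congruent modulo the part of degree at most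
three, the toric ideal is generated in degrees at most three. -/
lemma isGeneratedInDegreeLE_of_forall
    (h : ∀ (m : ℕ) (f g : Fin m → LatticePoint P Λ), ∑ j, (f j).1 = ∑ j, (g j).1 →
      (∏ j, X (f j) - ∏ j, X (g j) : MvPolynomial (LatticePoint P Λ) ℂ) ∈ cubicPart P Λ) :
    MvPolynomial.IsGeneratedInDegreeLE (toricIdeal P Λ) 3 := by
  classical
  refine ⟨{p | p ∈ toricIdeal P Λ ∧ p.totalDegree ≤ 3}, fun p hp => hp.2,
    le_antisymm (Ideal.span_le.mpr fun p hp => hp.1) fun p hp => ?_⟩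
  change p ∈ cubicPart P Λ
  -- A linear section, modulo `cubicPart`, of the toric map on its image.
  let rep : semigroup P Λ → MvPolynomial (LatticePoint P Λ) ℂ := fun x =>
    if hx : ∃ (m : ℕ) (f : Fin m → LatticePoint P Λ), ∑ j, (f j).toSemigroup = x then
      ∏ j, X (hx.choose_spec.choose j) else 0
  let Ψ : SemigroupAlgebra P Λ →ₗ[ℂ] MvPolynomial (LatticePoint P Λ) ℂ :=
    Finsupp.linearCombination ℂ rep ∘ₗ (AddMonoidAlgebra.coeffLinearEquiv ℂ).toLinearMap
  have hΨ : ∀ x, Ψ (AddMonoidAlgebra.single x 1) = rep x := fun x => by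
    simp [Ψ]
  have key : ∀ q, q - Ψ (toricMap P Λ q) ∈ cubicPart P Λ := by
    intro q
    induction q using MvPolynomial.induction_on' with
    | monomial u a =>
      obtain ⟨m, f, hf⟩ := exists_monomial_eq_prod u
      have hrep : ∃ (m : ℕ) (g : Fin m → LatticePoint P Λ),
          ∑ j, (g j).toSemigroup = ∑ j, (f j).toSemigroup := ⟨m, f, rfl⟩
      have hmem : ∏ j, X (f j) - rep (∑ j, (f j).toSemigroup) ∈ cubicPart P Λ := by
        simp only [rep, dif_pos hrep]
        have hspec := hrep.choose_spec.choose_spec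
        generalize hrep.choose_spec.choose = g at hspec
        generalize hrep.choose = k at g hspec
        have hcoe := congrArg (fun z : semigroup P Λ => (z : ℕ × (ι → ℤ))) hspec
        simp only [coe_sum_toSemigroup, Prod.mk.injEq, Finset.card_univ, Fintype.card_fin] at hcoe
        obtain ⟨rfl, hs⟩ := hcoe
        exact h _ f g hs.symm
      rw [← mul_one a, ← smul_eq_mul, ← smul_monomial, map_smul, map_smul, ← smul_sub, hf,
        toricMap_prod_X, hΨ, smul_eq_C_mul]
      exact Ideal.mul_mem_left _ _ hmem
    | add q₁ q₂ h₁ h₂ =>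
      rw [map_add, map_add, add_sub_add_comm]
      exact Ideal.add_mem _ h₁ h₂
  have := key p
  rwa [mem_toricIdeal.mp hp, map_zero, sub_zero] at this

open TupleMoves in
/-- If the lattice points of the multiples of `P` form a balanced system, `P` is normal and its
toric ideal is generated in degrees at most three. -/
theorem isNormal_and_isGeneratedInDegreeLE [Finite ι] {Feas : ℕ → (ι → ℤ) → Prop} {q d : ι → ℤ}
    (hsys : BalancedSystem Feas q d)
    (hone : ∀ y, Feas 1 y ↔ y ∈ Λ ∧ (fun i => (y i : ℝ)) ∈ P)
    (hmul : ∀ (m : ℕ) (y : ι → ℤ), y ∈ Λ → (fun i => (y i : ℝ)) ∈ minkowskiMultiple P m →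
      Feas m y) :
    IsNormal P Λ ∧ MvPolynomial.IsGeneratedInDegreeLE (toricIdeal P Λ) 3 := by
  constructor
  · refine isNormal_of_forall_exists_sum ?_
    rintro ⟨⟨m, w⟩, hw, hw'⟩
    rcases Nat.eq_zero_or_pos m with rfl | hm
    · obtain ⟨p, -, hp⟩ := hw'
      refine ⟨Fin.elim0, funext fun i => ?_⟩
      have := congrFun hp i
      simp only [Finset.univ_eq_empty, Finset.sum_empty, Pi.zero_apply] at this ⊢
      exact_mod_cast this
    · obtain ⟨f, hf⟩ := hsys.exists_tuple hm (hmul m w hw hw')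
      refine ⟨fun j => ⟨f j, (hone _).mp (hf.1 j)⟩, funext fun i => ?_⟩
      rw [Finset.sum_apply]
      exact hf.2 i trivial
  · refine isGeneratedInDegreeLE_of_forall fun m f g hfg => ?_
    have htuple : ∀ k : Fin m → LatticePoint P Λ, ∑ j, (k j).1 = ∑ j, (f j).1 →
        IsTuple (∑ j, (f j).1) Set.univ {y | Feas 1 y} (fun j => (k j).1) := fun k hk =>
      ⟨fun j => (hone _).mpr (k j).2, fun e _ => by rw [← hk, Finset.sum_apply]⟩
    have hconn := hsys.conn (htuple f rfl) (htuple g hfg.symm)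
    have key : ∀ k : Fin m → ι → ℤ,
        Conn (∑ j, (f j).1) Set.univ {y | Feas 1 y} (fun j => (f j).1) k →
        ∀ k' : Fin m → LatticePoint P Λ, (∀ j, (k' j).1 = k j) →
        (∏ j, X (f j) - ∏ j, X (k' j) : MvPolynomial (LatticePoint P Λ) ℂ) ∈ cubicPart P Λ := by
      intro k hk
      induction hk with
      | refl =>
        intro k' hk'
        rw [show k' = f from funext fun j => Subtype.ext (hk' j), sub_self]
        exact Ideal.zero_mem _
      | @tail k₁ k₂ hk₁ hmove ih =>
        intro k' hk'
        have ht := Conn.isTuple hk₁ (htuple f rfl)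
        obtain ⟨ht', J, hJ, hJ'⟩ := hmove
        let k₁' : Fin m → LatticePoint P Λ := fun j => ⟨k₁ j, (hone _).mp (ht.1 j)⟩
        have h2 := prod_X_sub_prod_X_mem k₁' k' (by
            funext e
            simp only [Finset.sum_apply, hk']
            exact (ht.2 e trivial).trans (ht'.2 e trivial).symm) J hJ
          (fun j hj => Subtype.ext ((funext fun e => hJ' j hj e trivial).trans (hk' j).symm))
        have := Ideal.add_mem _ (ih k₁' fun _ => rfl) h2
        rwa [sub_add_sub_cancel] at this
    exact key _ hconn g fun _ => rfl

end LatticePolytope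

/-! ### Tree-like graphs -/

namespace Graph

variable {α β : Type*} {Γ : Graph α β}

lemma inc_halfEdge {v : α} (h : Γ.HalfEdgeAt v) : Γ.Inc (HalfEdgeAt.edge h) v := by
  rcases h with ⟨e, he⟩ | ⟨e, he⟩
  · exact he
  · exact IsLoopAt.inc he

/-- The edges at a vertex with three half-edges. -/
lemma inc_iff_of_equiv {v : α} (h : Fin 3 ≃ Γ.HalfEdgeAt v) (e : E(Γ)) :
    Γ.Inc e v ↔ ∃ i, e = HalfEdgeAt.edge (h i) := by
  constructor
  · intro he
    exact ⟨h.symm (Sum.inl ⟨e, he⟩), by rw [Equiv.apply_symm_apply]; rfl⟩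
  · rintro ⟨i, rfl⟩
    exact inc_halfEdge _

lemma valence_of_equiv {v : α} (h : Fin 3 ≃ Γ.HalfEdgeAt v) : Γ.valence v = 3 := by
  rw [valence, ← Nat.card_congr h, Nat.card_eq_fintype_card, Fintype.card_fin]

lemma exists_vertex_inc (e : E(Γ)) : ∃ v : V(Γ), Γ.Inc e v := by
  obtain ⟨x, y, h⟩ := exists_isLink_of_mem_edgeSet e.2
  exact ⟨⟨x, h.left_mem⟩, h.inc_left⟩

/-- A presentation of `Γ` as a trivalent tree `T` with loops added at the leaves in `S`. -/
structure TreeModel (Γ : Graph α β) where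
  /-- the underlying tree -/
  T : SimpleGraph V(Γ)
  /-- the leaves that carry a loop -/
  S : Set V(Γ)
  trivalent : T.IsTrivalentTree
  ncard_of_mem : ∀ v ∈ S, (T.neighborSet v).ncard = 1
  /-- the edges of `Γ` are those of the tree and the loops -/
  φ : T.edgeSet ⊕ S ≃ E(Γ)
  isLink_inl : ∀ (e : T.edgeSet) (x y : V(Γ)),
    Γ.IsLink (φ (Sum.inl e)) x y ↔ (e : Sym2 V(Γ)) = s(x, y)
  isLink_inr : ∀ (s : S) (x y : V(Γ)),
    Γ.IsLink (φ (Sum.inr s)) x y ↔ x = (s : V(Γ)) ∧ y = (s : V(Γ))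

lemma IsTreeLike.nonempty_treeModel (h : Γ.IsTreeLike) : Nonempty Γ.TreeModel := by
  obtain ⟨T, S, h1, h2, φ, h3, h4⟩ := h
  exact ⟨⟨T, S, h1, h2, φ, h3, h4⟩⟩

namespace TreeModel

variable (M : Γ.TreeModel)

/-- The edges of the tree, as opposed to the loops. -/
def IsTreeEdge (e : E(Γ)) : Prop := ∃ t, e = M.φ (Sum.inl t)

/-- The edge of `Γ` joining two adjacent vertices of the tree. -/
def edge {u v : V(Γ)} (h : M.T.Adj u v) : E(Γ) := M.φ (Sum.inl ⟨s(u, v), h⟩)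

lemma isTreeEdge_edge {u v : V(Γ)} (h : M.T.Adj u v) : M.IsTreeEdge (M.edge h) := ⟨_, rfl⟩

lemma edge_injective {u v v' : V(Γ)} {h : M.T.Adj u v} {h' : M.T.Adj u v'}
    (heq : M.edge h = M.edge h') : v = v' :=
  Sym2.congr_right.mp (congrArg Subtype.val (Sum.inl_injective (M.φ.injective heq)))

lemma inc_inl (t : M.T.edgeSet) (v : V(Γ)) :
    Γ.Inc (M.φ (Sum.inl t)) v ↔ v ∈ (t : Sym2 V(Γ)) := by
  constructor
  · rintro ⟨y, hy⟩
    rw [(M.isLink_inl t v ⟨y, hy.right_mem⟩).mp hy]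
    exact Sym2.mem_mk_left _ _
  · intro h
    obtain ⟨y, hy⟩ := Sym2.mem_iff_exists.mp h
    exact ⟨y, (M.isLink_inl t v y).mpr hy⟩

lemma inc_edge {u v : V(Γ)} (h : M.T.Adj u v) (w : V(Γ)) :
    Γ.Inc (M.edge h) w ↔ w = u ∨ w = v := by
  rw [edge, inc_inl]; simp

lemma inc_inr (s : M.S) (v : V(Γ)) : Γ.Inc (M.φ (Sum.inr s)) v ↔ v = s := by
  constructor
  · rintro ⟨y, hy⟩
    exact ((M.isLink_inr s v ⟨y, hy.right_mem⟩).mp hy).1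
  · intro h
    exact ⟨v, (M.isLink_inr s v v).mpr ⟨h, h⟩⟩

lemma not_isLoopAt_inl (t : M.T.edgeSet) (v : V(Γ)) : ¬ Γ.IsLoopAt (M.φ (Sum.inl t)) v := by
  intro h
  have := (M.isLink_inl t v v).mp h
  have ht := t.2
  rw [this] at ht
  exact M.T.irrefl ht

lemma isLoopAt_inr (s : M.S) : Γ.IsLoopAt (M.φ (Sum.inr s)) (s : V(Γ)) :=
  (M.isLink_inr s s s).mpr ⟨rfl, rfl⟩

lemma not_isTreeEdge_inr (s : M.S) : ¬ M.IsTreeEdge (M.φ (Sum.inr s)) := by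
  rintro ⟨t, ht⟩
  simpa using M.φ.injective ht

lemma IsTreeEdge.not_isLoopAt {M : Γ.TreeModel} {e : E(Γ)} (he : M.IsTreeEdge e) (v : V(Γ)) :
    ¬ Γ.IsLoopAt e v := by
  obtain ⟨t, rfl⟩ := he
  exact M.not_isLoopAt_inl t v

/-- A tree edge at `v` leads to a neighbour of `v`. -/
lemma IsTreeEdge.exists_edge_eq {M : Γ.TreeModel} {e : E(Γ)} (he : M.IsTreeEdge e) {v : V(Γ)}
    (hv : Γ.Inc e v) : ∃ (u : V(Γ)) (h : M.T.Adj v u), e = M.edge h := by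
  obtain ⟨t, rfl⟩ := he
  obtain ⟨u, hu⟩ := Sym2.mem_iff_exists.mp ((M.inc_inl t v).mp hv)
  have h : M.T.Adj v u := by rw [← SimpleGraph.mem_edgeSet, ← hu]; exact t.2
  exact ⟨u, h, congrArg (fun z => M.φ (Sum.inl z)) (Subtype.ext hu)⟩

/-- An edge that is not a tree edge is a loop at some vertex. -/
lemma exists_of_not_isTreeEdge {e : E(Γ)} (he : ¬ M.IsTreeEdge e) :
    ∃ s : M.S, e = M.φ (Sum.inr s) := by
  obtain ⟨t | s, ht⟩ := M.φ.surjective e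
  · exact absurd ⟨t, ht.symm⟩ he
  · exact ⟨s, ht.symm⟩

/-- The edges at a vertex are those leading to its neighbours, and the loop if there is one. -/
lemma inc_cases {e : E(Γ)} {v : V(Γ)} (h : Γ.Inc e v) :
    (∃ (u : V(Γ)) (hu : M.T.Adj v u), e = M.edge hu) ∨
      ∃ hv : v ∈ M.S, e = M.φ (Sum.inr ⟨v, hv⟩) := by
  by_cases he : M.IsTreeEdge e
  · exact .inl (he.exists_edge_eq h)
  · obtain ⟨s, rfl⟩ := M.exists_of_not_isTreeEdge he
    obtain rfl := (M.inc_inr s v).mp h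
    exact .inr ⟨s.2, rfl⟩

lemma adj_of_inc {e : E(Γ)} {u v : V(Γ)} (huv : u ≠ v) (hu : Γ.Inc e u) (hv : Γ.Inc e v) :
    ∃ h : M.T.Adj u v, e = M.edge h := by
  rcases M.inc_cases hu with ⟨w, hw, rfl⟩ | ⟨hs, rfl⟩
  · rcases (M.inc_edge hw v).mp hv with rfl | rfl
    · exact absurd rfl huv
    · exact ⟨hw, rfl⟩
  · exact absurd ((M.inc_inr _ v).mp hv).symm huv

/-- The three kinds of vertices: leaves, leaves of the tree carrying a loop, and trinodes. -/
lemma vertex_cases (v : V(Γ)) :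
    (Γ.valence v = 1 ∧ ∃ e, M.IsTreeEdge e ∧ ∀ e' : E(Γ), Γ.Inc e' v ↔ e' = e) ∨
    (∃ (e f : E(Γ)) (h : Fin 3 ≃ Γ.HalfEdgeAt (v : α)), M.IsTreeEdge e ∧ ¬ M.IsTreeEdge f ∧
      HalfEdgeAt.edge (h 0) = e ∧ HalfEdgeAt.edge (h 1) = f ∧ HalfEdgeAt.edge (h 2) = f) ∨
    ∃ h : Fin 3 ≃ Γ.HalfEdgeAt (v : α), (∀ i, M.IsTreeEdge (HalfEdgeAt.edge (h i))) ∧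
      Function.Injective fun i => HalfEdgeAt.edge (h i) := by
  rcases M.trivalent.2.2 v with h1 | h3
  · obtain ⟨u, hu⟩ := Set.ncard_eq_one.mp h1
    have hadj : M.T.Adj v u := by
      rw [← SimpleGraph.mem_neighborSet, hu]; rfl
    have hadj' : ∀ w (hw : M.T.Adj v w), M.edge hw = M.edge hadj := by
      intro w hw
      have : w ∈ M.T.neighborSet v := hw
      rw [hu] at this
      obtain rfl : w = u := this
      rfl
    have hinc : Γ.Inc (M.edge hadj) v := (M.inc_edge hadj v).mpr (.inl rfl)
    by_cases hv : v ∈ M.S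
    · right; left
      have hloop : Γ.IsLoopAt (M.φ (Sum.inr ⟨v, hv⟩)) v := M.isLoopAt_inr ⟨v, hv⟩
      have hne : M.edge hadj ≠ M.φ (Sum.inr ⟨v, hv⟩) := fun h =>
        M.not_isTreeEdge_inr ⟨v, hv⟩ (h ▸ M.isTreeEdge_edge hadj)
      let g : Fin 3 → Γ.HalfEdgeAt (v : α) := ![Sum.inl ⟨M.edge hadj, hinc⟩,
        Sum.inl ⟨M.φ (Sum.inr ⟨v, hv⟩), hloop.inc⟩, Sum.inr ⟨M.φ (Sum.inr ⟨v, hv⟩), hloop⟩]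
      have hg : Function.Bijective g := by
        constructor
        · intro i j hij
          fin_cases i <;> fin_cases j <;> first | rfl | (simp [g, hne, hne.symm] at hij)
        · rintro (⟨e, he⟩ | ⟨e, he⟩)
          · rcases M.inc_cases he with ⟨w, hw, rfl⟩ | ⟨-, rfl⟩
            · exact ⟨0, by simp [g, hadj' w hw]⟩
            · exact ⟨1, by simp [g]⟩
          · rcases M.inc_cases (IsLoopAt.inc he) with ⟨w, hw, rfl⟩ | ⟨-, rfl⟩
            · exact absurd he ((M.isTreeEdge_edge hw).not_isLoopAt v)
            · exact ⟨2, by simp [g]⟩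
      exact ⟨_, _, Equiv.ofBijective g hg, M.isTreeEdge_edge hadj, M.not_isTreeEdge_inr ⟨v, hv⟩,
        rfl, rfl, rfl⟩
    · left
      have key : ∀ e' : E(Γ), Γ.Inc e' v ↔ e' = M.edge hadj := by
        intro e'
        constructor
        · intro h
          rcases M.inc_cases h with ⟨w, hw, rfl⟩ | ⟨hs, -⟩
          · exact hadj' w hw
          · exact absurd hs hv
        · rintro rfl; exact hinc
      refine ⟨?_, _, M.isTreeEdge_edge hadj, key⟩
      rw [valence, Nat.card_eq_one_iff_unique]
      refine ⟨⟨?_⟩, ⟨Sum.inl ⟨_, hinc⟩⟩⟩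
      have hno : ∀ e : E(Γ), ¬ Γ.IsLoopAt e v := fun e he => by
        rw [(key e).mp (IsLoopAt.inc he)] at he
        exact (M.isTreeEdge_edge hadj).not_isLoopAt v he
      rintro (⟨e, he⟩ | ⟨e, he⟩) (⟨e', he'⟩ | ⟨e', he'⟩)
      · have h1 := (key e).mp he
        have h2 := (key e').mp he'
        subst h1; subst h2; rfl
      · exact absurd he' (hno e')
      · exact absurd he (hno e)
      · exact absurd he (hno e)
  · right; right
    obtain ⟨u₁, u₂, u₃, h12, h13, h23, hu⟩ := Set.ncard_eq_three.mp h3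
    have hv : v ∉ M.S := fun hv => by
      have := M.ncard_of_mem v hv
      omega
    have a₁ : M.T.Adj v u₁ := by rw [← SimpleGraph.mem_neighborSet, hu]; simp
    have a₂ : M.T.Adj v u₂ := by rw [← SimpleGraph.mem_neighborSet, hu]; simp
    have a₃ : M.T.Adj v u₃ := by rw [← SimpleGraph.mem_neighborSet, hu]; simp
    have hinc : ∀ w (hw : M.T.Adj v w), Γ.Inc (M.edge hw) v := fun w hw =>
      (M.inc_edge hw v).mpr (.inl rfl)
    have n12 : M.edge a₁ ≠ M.edge a₂ := fun h => h12 (M.edge_injective h)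
    have n13 : M.edge a₁ ≠ M.edge a₃ := fun h => h13 (M.edge_injective h)
    have n23 : M.edge a₂ ≠ M.edge a₃ := fun h => h23 (M.edge_injective h)
    let g : Fin 3 → Γ.HalfEdgeAt (v : α) := ![Sum.inl ⟨M.edge a₁, hinc _ a₁⟩,
        Sum.inl ⟨M.edge a₂, hinc _ a₂⟩, Sum.inl ⟨M.edge a₃, hinc _ a₃⟩]
    have hg : Function.Bijective g := by
      constructor
      · intro i j hij
        fin_cases i <;> fin_cases j <;>
          first | rfl | (simp [g, n12, n12.symm, n13, n13.symm, n23, n23.symm] at hij)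
      · rintro (⟨e, he⟩ | ⟨e, he⟩)
        · rcases M.inc_cases he with ⟨w, hw, rfl⟩ | ⟨hs, -⟩
          · have hw' : w ∈ M.T.neighborSet v := hw
            rw [hu] at hw'
            rcases hw' with rfl | rfl | rfl
            exacts [⟨0, rfl⟩, ⟨1, rfl⟩, ⟨2, rfl⟩]
          · exact absurd hs hv
        · rcases M.inc_cases (IsLoopAt.inc he) with ⟨w, hw, rfl⟩ | ⟨hs, -⟩
          · exact absurd he ((M.isTreeEdge_edge hw).not_isLoopAt v)
          · exact absurd hs hv
    refine ⟨Equiv.ofBijective g hg, fun i => ?_, fun i j hij => ?_⟩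
    · fin_cases i
      exacts [M.isTreeEdge_edge a₁, M.isTreeEdge_edge a₂, M.isTreeEdge_edge a₃]
    · fin_cases i <;> fin_cases j <;> first | rfl |
        (simp [g, HalfEdgeAt.edge, n12, n12.symm, n13, n13.symm, n23, n23.symm] at hij)

lemma finite_edgeSet (M : Γ.TreeModel) : Finite E(Γ) := by
  have := M.trivalent.1
  exact Finite.of_equiv _ M.φ

end TreeModel

end Graph

/-! ### Parity of the weights -/

namespace Graph

variable {α β : Type*} {Γ : Graph α β} {n : ℕ} {leaf : Fin n ≃ Γ.Leaf} {r : Fin n → ℕ}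

/-- The triangle inequalities, and the bound `B` on the perimeter. -/
def TriIneq (B a b c : ℤ) : Prop := a ≤ b + c ∧ b ≤ a + c ∧ c ≤ a + b ∧ a + b + c ≤ B

/-- The conditions imposed at the vertex `v` on an integer weighting in the semigroup of the
polytope of level `2 * L`, in degree `m`. -/
def Loc (leaf : Fin n ≃ Γ.Leaf) (r : Fin n → ℕ) (L m : ℕ) (v : α) (y : E(Γ) → ℤ) : Prop :=
  (∀ h : Fin 3 ≃ Γ.HalfEdgeAt v,
    Even (y (h 0).edge + y (h 1).edge + y (h 2).edge) ∧
      TriIneq (4 * L * m) (y (h 0).edge) (y (h 1).edge) (y (h 2).edge)) ∧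
  (∀ i, (leaf i : α) = v → ∀ e : E(Γ), Γ.Inc e v → y e = m * r i) ∧
  ∀ e : E(Γ), Γ.Inc e v → 0 ≤ y e

/-- The integer weightings satisfying all local conditions in degree `m`. -/
def Feas (leaf : Fin n ≃ Γ.Leaf) (r : Fin n → ℕ) (L m : ℕ) (y : E(Γ) → ℤ) : Prop :=
  ∀ v : V(Γ), Loc leaf r L m v y

/-- The condition on three half-edges does not depend on their order. -/
lemma triIneq_perm (B : ℤ) (z : Fin 3 → ℤ) (σ : Equiv.Perm (Fin 3)) :
    TriIneq B (z (σ 0)) (z (σ 1)) (z (σ 2)) ↔ TriIneq B (z 0) (z 1) (z 2) := by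
  have hsum : ∀ σ : Equiv.Perm (Fin 3), z (σ 0) + z (σ 1) + z (σ 2) = z 0 + z 1 + z 2 := by
    intro σ
    have := Equiv.sum_comp σ z
    rwa [Fin.sum_univ_three, Fin.sum_univ_three] at this
  have hiff : ∀ σ : Equiv.Perm (Fin 3), TriIneq B (z (σ 0)) (z (σ 1)) (z (σ 2)) ↔
      (∀ i, 2 * z (σ i) ≤ z 0 + z 1 + z 2) ∧ z 0 + z 1 + z 2 ≤ B := by
    intro σ
    rw [← hsum σ, Fin.forall_fin_succ, Fin.forall_fin_two, TriIneq]
    simp only [Fin.isValue, Fin.succ_zero_eq_one, Fin.succ_one_eq_two]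
    omega
  rw [hiff σ, show TriIneq B (z 0) (z 1) (z 2) ↔ _ from hiff 1,
    σ.forall_congr_right (q := fun i => 2 * z i ≤ z 0 + z 1 + z 2)]
  rfl

/-- At a vertex with three half-edges, listed by `h`, it is enough to look at this list. -/
lemma loc_iff_of_equiv {L m : ℕ} {v : α} (h : Fin 3 ≃ Γ.HalfEdgeAt v) (y : E(Γ) → ℤ) :
    Loc leaf r L m v y ↔ Even (y (h 0).edge + y (h 1).edge + y (h 2).edge) ∧
      TriIneq (4 * L * m) (y (h 0).edge) (y (h 1).edge) (y (h 2).edge) := by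
  refine ⟨fun hl => hl.1 h, fun hl => ⟨fun h' => ?_, fun i hi => ?_, fun e he => ?_⟩⟩
  · set σ : Equiv.Perm (Fin 3) := h'.trans h.symm with hσ
    let z : Fin 3 → ℤ := fun i => y (h i).edge
    have hz : ∀ i, y (h' i).edge = z (σ i) := fun i => by simp [z, hσ]
    rw [hz, hz, hz]
    refine ⟨?_, (triIneq_perm _ z σ).mpr hl.2⟩
    have := Equiv.sum_comp σ z
    rw [Fin.sum_univ_three, Fin.sum_univ_three] at this
    rw [this]
    exact hl.1
  · have h1 := (leaf i).2
    have h3 := valence_of_equiv h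
    rw [hi] at h1
    omega
  · obtain ⟨i, rfl⟩ := (inc_iff_of_equiv h e).mp he
    obtain ⟨h1, h2, h3, -⟩ := hl.2
    fin_cases i <;> simp <;> omega

lemma loc_iff_of_leaf {L m : ℕ} {v : α} {i : Fin n} (hi : (leaf i : α) = v) {e : E(Γ)}
    (he : ∀ e' : E(Γ), Γ.Inc e' v ↔ e' = e) (y : E(Γ) → ℤ) :
    Loc leaf r L m v y ↔ y e = m * r i := by
  constructor
  · intro hl
    exact hl.2.1 i hi e ((he e).mpr rfl)
  · intro hy
    refine ⟨fun h => ?_, fun j hj e' he' => ?_, fun e' he' => ?_⟩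
    · have h1 := (leaf i).2
      have h3 := valence_of_equiv h
      rw [hi] at h1
      omega
    · obtain rfl : j = i := leaf.injective (Subtype.ext (hj.trans hi.symm))
      rw [(he e').mp he', hy]
    · rw [(he e').mp he', hy]
      positivity

/-- The leaf-edges of odd weight. -/
def IsOddLeafEdge (leaf : Fin n ≃ Γ.Leaf) (r : Fin n → ℕ) (e : E(Γ)) : Prop :=
  ∃ i, Γ.Inc e (leaf i) ∧ Odd (r i)

open Classical in
/-- The residue modulo `2` of the weight of a tree edge `e` in degree one: by
`TreeModel.even_weight`, only odd leaf-edges have odd weight. -/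
noncomputable def parity (leaf : Fin n ≃ Γ.Leaf) (r : Fin n → ℕ) (e : E(Γ)) : ℤ :=
  if IsOddLeafEdge leaf r e then 1 else 0

lemma parity_of_odd {e : E(Γ)} (h : IsOddLeafEdge leaf r e) : parity leaf r e = 1 := if_pos h

lemma parity_of_not_odd {e : E(Γ)} (h : ¬ IsOddLeafEdge leaf r e) : parity leaf r e = 0 := if_neg h

namespace TreeModel

variable (M : Γ.TreeModel)

/-- There is only one edge at a leaf. -/
lemma leaf_inc (i : Fin n) : ∃ e, M.IsTreeEdge e ∧ ∀ e' : E(Γ), Γ.Inc e' (leaf i) ↔ e' = e := by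
  have h1 := (leaf i).2
  have hmem : (leaf i : α) ∈ V(Γ) := by
    rw [valence, Nat.card_eq_one_iff_unique] at h1
    obtain ⟨-, ⟨h⟩⟩ := h1
    exact (inc_halfEdge h).vertex_mem
  rcases M.vertex_cases ⟨_, hmem⟩ with h | ⟨e, f, h, -⟩ | ⟨h, -⟩
  · exact h.2
  · have := valence_of_equiv h
    simp only at this
    omega
  · have := valence_of_equiv h
    simp only at this
    omega

lemma leaf_mem (M : Γ.TreeModel) (i : Fin n) : (leaf i : α) ∈ V(Γ) := by
  obtain ⟨e, -, he⟩ := M.leaf_inc (leaf := leaf) i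
  exact ((he e).mpr rfl).vertex_mem

/-- Compatibility: at a vertex other than a leaf, odd leaf-edges do not occur alone. -/
lemma exists_odd_leafEdge_ne (M : Γ.TreeModel) (hr : Γ.IsCompatible leaf r) {v : V(Γ)}
    (hv : Γ.valence (v : α) ≠ 1) {e : E(Γ)} (he : Γ.Inc e v) (hodd : IsOddLeafEdge leaf r e) :
    ∃ f : E(Γ), f ≠ e ∧ Γ.Inc f v ∧ IsOddLeafEdge leaf r f := by
  obtain ⟨i, hei, hi⟩ := hodd
  obtain ⟨j, hji, hj, e', f, x, he'i, hfj, he'x, hfx⟩ := hr i hi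
  have hleaf : ∀ k, (leaf k : α) ≠ v := fun k hk => hv (hk ▸ (leaf k).2)
  obtain ⟨e₀, -, he₀⟩ := M.leaf_inc (leaf := leaf) i
  obtain rfl := (he₀ e).mp hei
  obtain rfl : e' = e := congrArg Subtype.val ((he₀ ⟨e', he'i.edge_mem⟩).mp he'i)
  have hlij : (leaf j : α) ≠ leaf i := fun h => hji (leaf.injective (Subtype.ext h))
  have hej : ¬ Γ.Inc e (leaf j) := fun h => by
    rcases Inc.eq_or_eq_or_eq h hei he with h | h | h
    · exact hlij h
    · exact hleaf j h
    · exact hleaf i h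
  have hfe : f ≠ e := fun h => hej (h ▸ hfj)
  refine ⟨⟨f, hfj.edge_mem⟩, fun h => hfe (congrArg Subtype.val h), ?_, j, hfj, hj⟩
  rcases Inc.eq_or_eq_or_eq he'x hei he with h | h | h
  · subst h
    exact absurd (congrArg Subtype.val ((he₀ ⟨f, hfj.edge_mem⟩).mp hfx)) hfe
  · exact h ▸ hfx
  · exact absurd h (hleaf i)

/-- A loop is not a leaf-edge. -/
lemma not_odd_of_not_isTreeEdge {e : E(Γ)} (he : ¬ M.IsTreeEdge e) :
    ¬ IsOddLeafEdge leaf r e := by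
  rintro ⟨i, hi, -⟩
  obtain ⟨e', he', h⟩ := M.leaf_inc (leaf := leaf) i
  exact he ((h e).mp hi ▸ he')

lemma not_odd_at_loop (hr : Γ.IsCompatible leaf r) {v : V(Γ)} {e f : E(Γ)}
    (h : Fin 3 ≃ Γ.HalfEdgeAt (v : α)) (hf : ¬ M.IsTreeEdge f)
    (h0 : (h 0).edge = e) (h1 : (h 1).edge = f) (h2 : (h 2).edge = f) :
    ¬ IsOddLeafEdge leaf r e := by
  intro hodd
  have hv : Γ.valence (v : α) ≠ 1 := by rw [valence_of_equiv h]; norm_num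
  obtain ⟨g, hge, hgv, hg⟩ := M.exists_odd_leafEdge_ne hr hv
    ((inc_iff_of_equiv h e).mpr ⟨0, h0.symm⟩) hodd
  obtain ⟨i, rfl⟩ := (inc_iff_of_equiv h g).mp hgv
  fin_cases i
  · exact hge h0
  · exact M.not_odd_of_not_isTreeEdge hf (h1 ▸ hg)
  · exact M.not_odd_of_not_isTreeEdge hf (h2 ▸ hg)

/-- If all three edges at a trinode are odd leaf-edges, they make up all of `Γ`, and the sum of
`r` is odd. -/
lemma not_all_odd (hsum : Even (∑ i, r i)) {v : V(Γ)} (h : Fin 3 ≃ Γ.HalfEdgeAt (v : α))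
    (ht : ∀ i, M.IsTreeEdge (h i).edge) (hinj : Function.Injective fun i => (h i).edge) :
    ¬ ∀ k, IsOddLeafEdge leaf r (h k).edge := by
  intro hall
  choose i hi hodd using hall
  have hleaf : ∀ k, (leaf k : α) ≠ v := fun k hk => by
    have h1 := (leaf k).2
    have h3 := valence_of_equiv h
    rw [hk] at h1
    omega
  let l : Fin 3 → V(Γ) := fun k => ⟨leaf (i k), M.leaf_mem _⟩
  have hends : ∀ k (w : V(Γ)), Γ.Inc (h k).edge w → w = v ∨ w = l k := by
    intro k w hw
    rcases Inc.eq_or_eq_or_eq hw (inc_halfEdge (h k)) (hi k) with h | h | h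
    · exact .inl (Subtype.ext h)
    · exact .inr (Subtype.ext h)
    · exact absurd h.symm (hleaf _)
  -- The vertex `v` and the three leaves are closed under adjacency.
  have hclosed : ∀ w w' : V(Γ), M.T.Adj w w' → (w = v ∨ ∃ k, w = l k) →
      (w' = v ∨ ∃ k, w' = l k) := by
    intro w w' hadj hw
    have hinc : Γ.Inc (M.edge hadj) w := (M.inc_edge hadj w).mpr (.inl rfl)
    have hinc' : Γ.Inc (M.edge hadj) w' := (M.inc_edge hadj w').mpr (.inr rfl)
    obtain ⟨k, hk⟩ : ∃ k, M.edge hadj = (h k).edge := by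
      rcases hw with rfl | ⟨k, rfl⟩
      · exact (inc_iff_of_equiv h _).mp hinc
      · obtain ⟨e₀, -, he₀⟩ := M.leaf_inc (leaf := leaf) (i k)
        exact ⟨k, ((he₀ _).mp hinc).trans ((he₀ _).mp (hi k)).symm⟩
    rcases hends k w' (hk ▸ hinc') with h | h
    · exact .inl h
    · exact .inr ⟨k, h⟩
  have hreach : ∀ w : V(Γ), w = v ∨ ∃ k, w = l k := by
    intro w
    obtain ⟨p⟩ := M.trivalent.2.1.connected v w
    have : ∀ {a b : V(Γ)}, M.T.Walk a b → (a = v ∨ ∃ k, a = l k) → (b = v ∨ ∃ k, b = l k) := by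
      intro a b p
      induction p with
      | nil => exact id
      | cons hadj _ ih => exact fun ha => ih (hclosed _ _ hadj ha)
    exact this p (.inl rfl)
  have hibij : Function.Bijective i := by
    constructor
    · intro k k' hkk'
      apply hinj
      obtain ⟨e₀, -, he₀⟩ := M.leaf_inc (leaf := leaf) (i k)
      exact ((he₀ _).mp (hi k)).trans ((he₀ _).mp (hkk' ▸ hi k')).symm
    · intro j
      rcases hreach ⟨leaf j, M.leaf_mem j⟩ with h | ⟨k, h⟩
      · exact absurd (congrArg Subtype.val h) (hleaf j)
      · exact ⟨k, leaf.injective (Subtype.ext (congrArg Subtype.val h).symm)⟩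
  rw [← Equiv.sum_comp (Equiv.ofBijective i hibij), Fin.sum_univ_three] at hsum
  simp only [Equiv.ofBijective_apply] at hsum
  exact Nat.not_even_iff_odd.mpr (((hodd 0).add_odd (hodd 1)).add_odd (hodd 2)) hsum

/-- At a trinode either no edge is an odd leaf-edge or exactly two are, which may be listed
first. -/
lemma trinode_cases (hr : Γ.IsCompatible leaf r) (hsum : Even (∑ i, r i)) {v : V(Γ)}
    (h : Fin 3 ≃ Γ.HalfEdgeAt (v : α)) (ht : ∀ i, M.IsTreeEdge (h i).edge)
    (hinj : Function.Injective fun i => (h i).edge) :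
    (∀ k, ¬ IsOddLeafEdge leaf r (h k).edge) ∨
      ∃ σ : Equiv.Perm (Fin 3), IsOddLeafEdge leaf r (h (σ 0)).edge ∧
        IsOddLeafEdge leaf r (h (σ 1)).edge ∧ ¬ IsOddLeafEdge leaf r (h (σ 2)).edge := by
  by_cases hnone : ∀ k, ¬ IsOddLeafEdge leaf r (h k).edge
  · exact .inl hnone
  push Not at hnone
  obtain ⟨k, hk⟩ := hnone
  have hv : Γ.valence (v : α) ≠ 1 := by rw [valence_of_equiv h]; norm_num
  obtain ⟨g, hge, hgv, hg⟩ := M.exists_odd_leafEdge_ne hr hv (inc_halfEdge (h k)) hk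
  obtain ⟨k', rfl⟩ := (inc_iff_of_equiv h g).mp hgv
  have hkk' : k' ≠ k := fun h => hge (by rw [h])
  have hnall := M.not_all_odd (leaf := leaf) hsum h ht hinj
  push Not at hnall
  obtain ⟨l, hl⟩ := hnall
  have hlk : l ≠ k := by rintro rfl; exact hl hk
  have hlk' : l ≠ k' := by rintro rfl; exact hl hg
  right
  have hperm : ∀ a b c : Fin 3, b ≠ a → c ≠ a → c ≠ b →
      ∃ σ : Equiv.Perm (Fin 3), σ 0 = a ∧ σ 1 = b ∧ σ 2 = c := by decide
  obtain ⟨σ, h0, h1, h2⟩ := hperm k k' l hkk' hlk hlk'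
  exact ⟨σ, h0 ▸ hk, h1 ▸ hg, h2 ▸ hl⟩

end TreeModel

lemma Feas.eq_at_leaf {L m : ℕ} {y : E(Γ) → ℤ} (M : Γ.TreeModel) (hy : Feas leaf r L m y)
    {i : Fin n} {e : E(Γ)} (he : Γ.Inc e (leaf i)) : y e = m * r i :=
  (hy ⟨leaf i, M.leaf_mem i⟩).2.1 i rfl e he

namespace TreeModel

variable (M : Γ.TreeModel)

/-- A tree edge of odd weight that is not an odd leaf-edge is accompanied by another such edge at
each of its ends. -/
lemma exists_odd_weight_ne (hr : Γ.IsCompatible leaf r) (hsum : Even (∑ i, r i)) {L m : ℕ}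
    {y : E(Γ) → ℤ} (hy : Feas leaf r L m y) {v : V(Γ)} {e : E(Γ)} (hev : Γ.Inc e v)
    (he : M.IsTreeEdge e) (hodd : Odd (y e)) (hleaf : ¬ IsOddLeafEdge leaf r e) :
    ∃ f : E(Γ), f ≠ e ∧ Γ.Inc f v ∧ M.IsTreeEdge f ∧ Odd (y f) ∧ ¬ IsOddLeafEdge leaf r f := by
  rcases M.vertex_cases v with ⟨hv, -⟩ | ⟨e₀, f, h, -, hf, h0, h1, h2⟩ | ⟨h, ht, hinj⟩
  · obtain ⟨i, hi⟩ := leaf.surjective ⟨v, hv⟩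
    have hi' : (leaf i : α) = v := congrArg Subtype.val hi
    rw [← hi'] at hev
    rw [hy.eq_at_leaf M hev] at hodd
    exact absurd ⟨i, hev, by exact_mod_cast (Int.odd_mul.mp hodd).2⟩ hleaf
  · have hl := ((hy v).1 h).1
    rw [h0, h1, h2, add_assoc] at hl
    obtain ⟨k, rfl⟩ := (inc_iff_of_equiv h e).mp hev
    have hne : (h k).edge ≠ f := fun hk => hf (hk ▸ he)
    have hk : (h k).edge = e₀ := by
      fin_cases k
      exacts [h0, absurd h1 hne, absurd h2 hne]
    rw [hk, Int.odd_iff] at hodd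
    rw [Int.even_iff] at hl
    omega
  · obtain ⟨k, rfl⟩ := (inc_iff_of_equiv h e).mp hev
    rcases M.trinode_cases hr hsum h ht hinj with hnone | ⟨σ, hσ0, hσ1, -⟩
    · have hl := ((hy v).1 h).1
      have hex : ∃ k', k' ≠ k ∧ Odd (y (h k').edge) := by
        by_contra! hcon
        simp only [Int.odd_iff, Int.even_iff] at hcon hl hodd
        fin_cases k
        · have := hcon 1 (by decide)
          have := hcon 2 (by decide)
          simp only [Fin.zero_eta] at hodd
          omega
        · have := hcon 0 (by decide)
          have := hcon 2 (by decide)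
          simp only [Fin.mk_one] at hodd
          omega
        · have := hcon 1 (by decide)
          have := hcon 0 (by decide)
          simp only [Fin.reduceFinMk] at hodd
          omega
      obtain ⟨k', hk', hk''⟩ := hex
      exact ⟨_, fun h => hk' (hinj h), inc_halfEdge _, ht k', hk'', hnone k'⟩
    · have hl := ((hy v).1 (σ.trans h)).1
      simp only [Equiv.trans_apply] at hl
      obtain ⟨i, hi, hi'⟩ := id hσ0
      obtain ⟨j, hj, hj'⟩ := id hσ1
      rw [hy.eq_at_leaf M hi, hy.eq_at_leaf M hj, ← mul_add] at hl
      have hij : Even ((m : ℤ) * (r i + r j)) :=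
        Even.mul_left (by exact_mod_cast hi'.add_odd hj') _
      have hl2 := (Int.even_add.mp hl).mp hij
      obtain ⟨l, rfl⟩ := σ.surjective k
      fin_cases l
      · exact absurd hσ0 hleaf
      · exact absurd hσ1 hleaf
      · exact absurd hl2 (Int.not_even_iff_odd.mpr hodd)

/-- Tree edges other than odd leaf-edges have even weight: those of odd weight would form a
subforest without vertices of degree one. -/
lemma even_weight (hr : Γ.IsCompatible leaf r) (hsum : Even (∑ i, r i)) {L m : ℕ}
    {y : E(Γ) → ℤ} (hy : Feas leaf r L m y) {e : E(Γ)} (he : M.IsTreeEdge e)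
    (hleaf : ¬ IsOddLeafEdge leaf r e) : Even (y e) := by
  classical
  by_contra hodd
  rw [Int.not_even_iff_odd] at hodd
  have := M.trivalent.1
  have := Fintype.ofFinite V(Γ)
  -- The subforest of the edges in question; an end of it contradicts `exists_odd_weight_ne`.
  let H : SimpleGraph V(Γ) :=
    { Adj := fun u v => ∃ h : M.T.Adj u v, Odd (y (M.edge h)) ∧
        ¬ IsOddLeafEdge leaf r (M.edge h)
      symm := ⟨by
        rintro u v ⟨h, h1⟩
        have : M.edge h.symm = M.edge h :=
          congrArg (fun z => M.φ (Sum.inl z)) (Subtype.ext Sym2.eq_swap)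
        exact ⟨h.symm, by rwa [this]⟩⟩
      loopless := ⟨fun v ⟨h, _⟩ => M.T.irrefl h⟩ }
  have hH : H.IsAcyclic := SimpleGraph.IsAcyclic.anti (fun u v h => h.1)
    M.trivalent.2.1.isAcyclic
  let S : Finset V(Γ) := Finset.univ.filter fun v => ∃ u, H.Adj v u
  obtain ⟨v₀, hv₀⟩ := exists_vertex_inc e
  obtain ⟨u₀, hu₀, rfl⟩ := he.exists_edge_eq hv₀
  obtain ⟨v, hvS, hv⟩ := hH.exists_subsingleton_neighbors S
    ⟨v₀, Finset.mem_filter.mpr ⟨Finset.mem_univ _, u₀, hu₀, hodd, hleaf⟩⟩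
  obtain ⟨u, hu⟩ := (Finset.mem_filter.mp hvS).2
  obtain ⟨hadj, hodd', hleaf'⟩ := id hu
  obtain ⟨f, hfe, hfv, hft, hfodd, hfleaf⟩ := M.exists_odd_weight_ne hr hsum hy
    ((M.inc_edge hadj v).mpr (.inl rfl)) (M.isTreeEdge_edge hadj) hodd' hleaf'
  obtain ⟨w, hw, rfl⟩ := hft.exists_edge_eq hfv
  have hHw : H.Adj v w := ⟨hw, hfodd, hfleaf⟩
  have hmem : ∀ {a}, H.Adj v a → a ∈ S := fun h =>
    Finset.mem_filter.mpr ⟨Finset.mem_univ _, v, h.symm⟩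
  obtain rfl := hv ⟨hmem hHw, hHw⟩ ⟨hmem hu, hu⟩
  exact hfe rfl

/-- The step between the values allowed for the weight of an edge: `2` for tree edges and `1` for
loops. -/
noncomputable def step (e : E(Γ)) : ℤ := by classical exact if M.IsTreeEdge e then 2 else 1

lemma step_of_isTreeEdge {M : Γ.TreeModel} {e : E(Γ)} (he : M.IsTreeEdge e) : M.step e = 2 := by
  simp [step, he]

lemma step_of_not_isTreeEdge {M : Γ.TreeModel} {e : E(Γ)} (he : ¬ M.IsTreeEdge e) :
    M.step e = 1 := by
  simp [step, he]

lemma step_pos (e : E(Γ)) : 0 < M.step e := by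
  by_cases he : M.IsTreeEdge e
  · rw [step_of_isTreeEdge he]; norm_num
  · rw [step_of_not_isTreeEdge he]; norm_num

/-- In degree `m` the weights of an edge lie in one class modulo its step. -/
lemma step_dvd (hr : Γ.IsCompatible leaf r) (hsum : Even (∑ i, r i)) {L m : ℕ}
    {y : E(Γ) → ℤ} (hy : Feas leaf r L m y) (e : E(Γ)) :
    M.step e ∣ y e - m * parity leaf r e := by
  by_cases he : M.IsTreeEdge e
  · rw [step_of_isTreeEdge he]
    by_cases hodd : IsOddLeafEdge leaf r e
    · obtain ⟨i, hi, k, hk⟩ := id hodd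
      rw [parity_of_odd hodd, hy.eq_at_leaf M hi, hk]
      exact ⟨m * k, by push_cast; ring⟩
    · rw [parity_of_not_odd hodd, mul_zero, sub_zero]
      exact (M.even_weight hr hsum hy he hodd).two_dvd
  · rw [step_of_not_isTreeEdge he]
    exact one_dvd _

end TreeModel

end Graph

/-! ### The balanced system of a tree-like graph -/

namespace Graph

open TupleMoves

variable {α β : Type*} {Γ : Graph α β} {n : ℕ} {leaf : Fin n ≃ Γ.Leaf} {r : Fin n → ℕ}

lemma TriIneq.add {B B' a b c a' b' c' : ℤ} (h : TriIneq B a b c) (h' : TriIneq B' a' b' c') :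
    TriIneq (B + B') (a + a') (b + b') (c + c') := by
  obtain ⟨h1, h2, h3, h4⟩ := h
  obtain ⟨h1', h2', h3', h4'⟩ := h'
  exact ⟨by omega, by omega, by omega, by omega⟩

lemma feas_zero {L : ℕ} : Feas leaf r L 0 0 :=
  fun v => ⟨fun h => by simp [TriIneq], fun i _ e _ => by simp, fun e _ => le_rfl⟩

lemma Feas.add {L m m' : ℕ} {x y : E(Γ) → ℤ} (hx : Feas leaf r L m x) (hy : Feas leaf r L m' y) :
    Feas leaf r L (m + m') (x + y) := by
  intro v
  obtain ⟨h1, h2, h3⟩ := hx v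
  obtain ⟨h1', h2', h3'⟩ := hy v
  refine ⟨fun h => ⟨?_, ?_⟩, fun i hi e he => ?_, fun e he => add_nonneg (h3 e he) (h3' e he)⟩
  · have hE := (h1 h).1
    have hE' := (h1' h).1
    rw [Int.even_iff] at hE hE' ⊢
    simp only [Pi.add_apply]
    omega
  · rw [Nat.cast_add, mul_add]
    exact (h1 h).2.add (h1' h).2
  · rw [Pi.add_apply, h2 i hi e he, h2' i hi e he]
    push_cast; ring

lemma Loc.congr {L m : ℕ} {v : α} {y z : E(Γ) → ℤ} (hyz : ∀ e : E(Γ), Γ.Inc e v → y e = z e)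
    (hy : Loc leaf r L m v y) : Loc leaf r L m v z := by
  refine ⟨fun h => ?_, fun i hi e he => ?_, fun e he => ?_⟩
  · rw [← hyz _ (inc_halfEdge _), ← hyz _ (inc_halfEdge _), ← hyz _ (inc_halfEdge _)]
    exact hy.1 h
  · rw [← hyz e he]; exact hy.2.1 i hi e he
  · rw [← hyz e he]; exact hy.2.2 e he

lemma base_sub_dvd (q d : ℤ) (m : ℕ) (x : ℤ) : d ∣ base q d m x - q := by simp [base]

namespace TreeModel

variable (M : Γ.TreeModel)

/-- The smaller of the two weights allowed for `e` in a balanced splitting of `x`. -/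
noncomputable def low (leaf : Fin n ≃ Γ.Leaf) (r : Fin n → ℕ) (m : ℕ) (x : E(Γ) → ℤ)
    (e : E(Γ)) : ℤ :=
  base (parity leaf r e) (M.step e) m (x e)

/-- The local conditions at `v` on the entries of a balanced splitting of `x`. -/
def locSet (leaf : Fin n ≃ Γ.Leaf) (r : Fin n → ℕ) (L m : ℕ) (x : E(Γ) → ℤ) (v : V(Γ)) :
    Set (E(Γ) → ℤ) :=
  {y | Loc leaf r L 1 v y ∧
    ∀ e : E(Γ), Γ.Inc e v → y e = M.low leaf r m x e ∨ y e = M.low leaf r m x e + M.step e}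

section

variable {L m : ℕ} {x : E(Γ) → ℤ}

/-- At a leaf the splitting is forced: all weights are `r i`. -/
lemma good_at_leaf (hr : Γ.IsCompatible leaf r) (hsum : Even (∑ i, r i)) (hm : 0 < m)
    (hx : Feas leaf r L m x) {v : V(Γ)} {i : Fin n} (hi : (leaf i : α) = v)
    {e : E(Γ)} (he : M.IsTreeEdge e) (hinc : ∀ e' : E(Γ), Γ.Inc e' v ↔ e' = e) :
    Good m x {e | Γ.Inc e v} (M.locSet leaf r L m x v) := by
  have hei : Γ.Inc e (leaf i) := hi ▸ (hinc e).mpr rfl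
  have hxe := hx.eq_at_leaf M hei
  have hm' : (0 : ℤ) < m := by exact_mod_cast hm
  obtain ⟨s, hs, hs0, hsm⟩ := base_spec (M.step_pos e) hm (M.step_dvd hr hsum hx e)
  have hdvd := base_sub_dvd (parity leaf r e) (M.step e) m (x e)
  rw [step_of_isTreeEdge he] at hs hdvd
  -- The weight `r i` has the right parity, also if `e` joins two leaves.
  have hpar : (2 : ℤ) ∣ r i - parity leaf r e := by
    by_cases hodd : IsOddLeafEdge leaf r e
    · obtain ⟨j, hj, k, hk⟩ := id hodd
      have hij : (m : ℤ) * r i = m * r j := by rw [← hxe, hx.eq_at_leaf M hj]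
      rw [mul_left_cancel₀ hm'.ne' hij, parity_of_odd hodd, hk]
      exact ⟨k, by push_cast; ring⟩
    · rw [parity_of_not_odd hodd, sub_zero]
      have : Even (r i) := Nat.not_odd_iff_even.mp fun h => hodd ⟨i, hei, h⟩
      exact_mod_cast this.two_dvd
  have hlow : M.low leaf r m x e = r i := by
    rw [low, step_of_isTreeEdge he]
    set a := base (parity leaf r e) 2 m (x e)
    rw [hxe] at hs
    have h1 : (r i : ℤ) < a + 2 := by
      by_contra hcon
      nlinarith
    have h2 : a ≤ r i := by
      by_contra hcon
      nlinarith
    omega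
  refine good_of_const (fun _ => (r i : ℤ)) ⟨?_, fun e' he' => ?_⟩ (fun y hy e' he' => ?_)
    fun e' he' => ?_
  · rw [loc_iff_of_leaf hi hinc]; simp
  · obtain rfl := (hinc e').mp he'
    exact .inl hlow.symm
  · have := (loc_iff_of_leaf hi hinc y).mp hy.1
    rw [(hinc e').mp he', this]; simp
  · rw [(hinc e').mp he', hxe]

lemma good_at_loop (hr : Γ.IsCompatible leaf r) (hsum : Even (∑ i, r i)) (hm : 0 < m)
    (hx : Feas leaf r L m x) {v : V(Γ)} {e f : E(Γ)} (h : Fin 3 ≃ Γ.HalfEdgeAt (v : α))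
    (he : M.IsTreeEdge e) (hf : ¬ M.IsTreeEdge f)
    (h0 : (h 0).edge = e) (h1 : (h 1).edge = f) (h2 : (h 2).edge = f) :
    Good m x {e | Γ.Inc e v} (M.locSet leaf r L m x v) := by
  have hef : e ≠ f := fun h => hf (h ▸ he)
  have hinc : ∀ e' : E(Γ), Γ.Inc e' v ↔ e' = e ∨ e' = f := by
    intro e'
    rw [inc_iff_of_equiv h, Fin.exists_fin_succ, Fin.exists_fin_two]
    simp [h0, h1, h2]
  have hpe : parity leaf r e = 0 := parity_of_not_odd (M.not_odd_at_loop hr h hf h0 h1 h2)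
  obtain ⟨s, hs, hs'⟩ := base_spec (M.step_pos e) hm (M.step_dvd hr hsum hx e)
  obtain ⟨t, ht, ht'⟩ := base_spec (M.step_pos f) hm (M.step_dvd hr hsum hx f)
  have hlow : Even (M.low leaf r m x e) := by
    rw [low, base, hpe, step_of_isTreeEdge he, zero_add]
    exact even_two_mul _
  have hxl := (loc_iff_of_equiv h x).mp (hx v)
  rw [h0, h1, h2] at hxl
  obtain ⟨-, hx1, hx2, hx3, hx4⟩ := hxl
  have hxe : x e = m * M.low leaf r m x e + 2 * s := by
    rw [hs, low, step_of_isTreeEdge he]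
  have hxf : x f = m * M.low leaf r m x f + t := by
    rw [low]
    simpa only [step_of_not_isTreeEdge hf, one_mul] using ht
  have key := good_loop (m := m) (x := x) (L := L) hef hm hlow hxe hxf hs' ht' (by linarith)
    (by linarith)
  convert key using 1
  · ext e'; exact hinc e'
  · ext y
    simp only [locSet, Set.mem_ofPred_eq, LoopCond]
    rw [loc_iff_of_equiv h, h0, h1, h2]
    simp only [hinc, forall_eq_or_imp, forall_eq, step_of_isTreeEdge he,
      step_of_not_isTreeEdge hf, TriIneq, Nat.cast_one, mul_one]
    obtain ⟨k, hk⟩ := hlow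
    have hk0 : 0 ≤ k := by
      by_contra hcon
      rw [hk] at hxe
      nlinarith
    rw [hk, Int.even_iff]
    omega

lemma good_at_trinode (hr : Γ.IsCompatible leaf r) (hsum : Even (∑ i, r i)) (hm : 0 < m)
    (hL : 1 < L) (hx : Feas leaf r L m x) {v : V(Γ)} (h : Fin 3 ≃ Γ.HalfEdgeAt (v : α))
    (ht : ∀ i, M.IsTreeEdge (h i).edge) (hinj : Function.Injective fun i => (h i).edge) :
    Good m x {e | Γ.Inc e v} (M.locSet leaf r L m x v) := by
  have hm' : (0 : ℤ) < m := by exact_mod_cast hm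
  -- It does not matter how the three edges are listed.
  obtain ⟨h, ht, hinj, hcases⟩ : ∃ h : Fin 3 ≃ Γ.HalfEdgeAt (v : α),
      (∀ i, M.IsTreeEdge (h i).edge) ∧ (Function.Injective fun i => (h i).edge) ∧
      ((∀ k, ¬ IsOddLeafEdge leaf r (h k).edge) ∨ (IsOddLeafEdge leaf r (h 0).edge ∧
        IsOddLeafEdge leaf r (h 1).edge ∧ ¬ IsOddLeafEdge leaf r (h 2).edge)) := by
    rcases M.trinode_cases hr hsum h ht hinj with h1 | ⟨σ, h1⟩
    · exact ⟨h, ht, hinj, .inl h1⟩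
    · exact ⟨σ.trans h, fun i => ht _, fun i j hij => σ.injective (hinj hij), .inr h1⟩
  obtain ⟨e₁, he₁⟩ : ∃ e, e = (h 0).edge := ⟨_, rfl⟩
  obtain ⟨e₂, he₂⟩ : ∃ e, e = (h 1).edge := ⟨_, rfl⟩
  obtain ⟨e₃, he₃⟩ : ∃ e, e = (h 2).edge := ⟨_, rfl⟩
  have n12 : e₁ ≠ e₂ := by rw [he₁, he₂]; exact hinj.ne (by decide)
  have n13 : e₁ ≠ e₃ := by rw [he₁, he₃]; exact hinj.ne (by decide)
  have n23 : e₂ ≠ e₃ := by rw [he₂, he₃]; exact hinj.ne (by decide)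
  have t1 : M.IsTreeEdge e₁ := he₁ ▸ ht 0
  have t2 : M.IsTreeEdge e₂ := he₂ ▸ ht 1
  have t3 : M.IsTreeEdge e₃ := he₃ ▸ ht 2
  have hinc : ∀ e' : E(Γ), Γ.Inc e' v ↔ e' = e₁ ∨ e' = e₂ ∨ e' = e₃ := by
    intro e'
    rw [inc_iff_of_equiv h, Fin.exists_fin_succ, Fin.exists_fin_two]
    simp [he₁, he₂, he₃]
  have hspec : ∀ e, M.IsTreeEdge e →
      ∃ s, x e = m * M.low leaf r m x e + 2 * s ∧ 0 ≤ s ∧ s < m := by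
    intro e he
    have := base_spec (M.step_pos e) hm (M.step_dvd hr hsum hx e)
    rw [step_of_isTreeEdge he] at this
    rwa [low, step_of_isTreeEdge he]
  have hxl := (loc_iff_of_equiv h x).mp (hx v)
  rw [← he₁, ← he₂, ← he₃] at hxl hcases
  obtain ⟨hxe, hx1, hx2, hx3, hx4⟩ := hxl
  have hset : {e : E(Γ) | Γ.Inc e v} = {e₁, e₂, e₃} := by ext e'; exact hinc e'
  have hloc : Even (M.low leaf r m x e₁ + M.low leaf r m x e₂ + M.low leaf r m x e₃) →
      M.locSet leaf r L m x v = {y | TriCond L (M.low leaf r m x e₁) (M.low leaf r m x e₂)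
        (M.low leaf r m x e₃) (y e₁) (y e₂) (y e₃)} := by
    intro heven
    ext y
    simp only [locSet, Set.mem_ofPred_eq, TriCond]
    rw [loc_iff_of_equiv h, ← he₁, ← he₂, ← he₃]
    simp only [hinc, forall_eq_or_imp, forall_eq, step_of_isTreeEdge t1, step_of_isTreeEdge t2,
      step_of_isTreeEdge t3, TriIneq, Nat.cast_one, mul_one]
    rw [Int.even_iff] at heven ⊢
    omega
  have hdvd : ∀ e, M.IsTreeEdge e → (2 : ℤ) ∣ M.low leaf r m x e - parity leaf r e := by
    intro e he
    have := base_sub_dvd (parity leaf r e) (M.step e) m (x e)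
    rw [step_of_isTreeEdge he] at this
    rwa [low, step_of_isTreeEdge he]
  rw [hset]
  rcases hcases with hnone | ⟨o1, o2, o3⟩
  · choose! s hs using hspec
    let k : E(Γ) → ℤ := fun e => M.low leaf r m x e / 2
    have hk : ∀ i, M.low leaf r m x (h i).edge = 2 * k (h i).edge := by
      intro i
      have hno : ¬ IsOddLeafEdge leaf r (h i).edge := by
        fin_cases i
        · exact he₁ ▸ hnone 0
        · exact he₂ ▸ hnone 1
        · exact he₃ ▸ hnone 2
      have := hdvd _ (ht i)
      rw [parity_of_not_odd hno, sub_zero] at this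
      exact (Int.mul_ediv_cancel' this).symm
    have k1 : M.low leaf r m x e₁ = 2 * k e₁ := he₁ ▸ hk 0
    have k2 : M.low leaf r m x e₂ = 2 * k e₂ := he₂ ▸ hk 1
    have k3 : M.low leaf r m x e₃ = 2 * k e₃ := he₃ ▸ hk 2
    have hknn : ∀ e, M.IsTreeEdge e → Γ.Inc e v → M.low leaf r m x e = 2 * k e → 0 ≤ k e := by
      intro e he hev hke
      have h0 := (hx v).2.2 e hev
      obtain ⟨h1, h2, h3⟩ := hs e he
      by_contra hcon
      rw [hke] at h1
      nlinarith
    obtain ⟨s1, s1', s1''⟩ := hs e₁ t1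
    obtain ⟨s2, s2', s2''⟩ := hs e₂ t2
    obtain ⟨s3, s3', s3''⟩ := hs e₃ t3
    rw [k1] at s1
    rw [k2] at s2
    rw [k3] at s3
    have hdata : TriData m L x k s e₁ e₂ e₃ :=
      { ne₁₂ := n12, ne₁₃ := n13, ne₂₃ := n23, sum₁ := s1, sum₂ := s2, sum₃ := s3
        nonneg₁ := s1', nonneg₂ := s2', nonneg₃ := s3'
        lt₁ := s1'', lt₂ := s2'', lt₃ := s3''
        k_nonneg₁ := hknn e₁ t1 ((hinc _).mpr (.inl rfl)) k1
        k_nonneg₂ := hknn e₂ t2 ((hinc _).mpr (.inr (.inl rfl))) k2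
        k_nonneg₃ := hknn e₃ t3 ((hinc _).mpr (.inr (.inr rfl))) k3
        tri₁ := by rw [s1, s2, s3] at hx1; linarith
        tri₂ := by rw [s1, s2, s3] at hx2; linarith
        tri₃ := by rw [s1, s2, s3] at hx3; linarith
        level := by rw [s1, s2, s3] at hx4; linarith }
    have := hdata.good hm (by exact_mod_cast hL)
    rwa [triSet, ← k1, ← k2, ← k3, ← hloc] at this
    rw [k1, k2, k3, ← mul_add, ← mul_add]
    exact even_two_mul _
  · -- The weights of the two odd leaf-edges are forced.
    have hfix : ∀ e, M.IsTreeEdge e → IsOddLeafEdge leaf r e →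
        x e = m * M.low leaf r m x e := by
      intro e he ho
      obtain ⟨i, hi, hi'⟩ := id ho
      obtain ⟨s, h1, h2, h3⟩ := hspec e he
      have h4 := hdvd e he
      rw [parity_of_odd ho] at h4
      have h5 := hx.eq_at_leaf M hi
      obtain ⟨c, hc⟩ := hi'
      obtain ⟨b, hb⟩ := h4
      have h6 : M.low leaf r m x e = 2 * b + 1 := by linarith
      rw [h5, h6, hc] at h1
      push_cast at h1
      have h7 : s = m * (c - b) := by linarith
      have h8 : (c : ℤ) - b = 0 := by
        by_contra hcon
        rcases lt_or_gt_of_ne hcon with hlt | hlt <;> nlinarith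
      rw [h5, h6, hc, show b = c by linarith]
      push_cast; ring
    obtain ⟨s, hs, hs'⟩ := hspec e₃ t3
    have d1 := hdvd e₁ t1
    have d2 := hdvd e₂ t2
    have d3 := hdvd e₃ t3
    rw [parity_of_odd o1] at d1
    rw [parity_of_odd o2] at d2
    rw [parity_of_not_odd o3] at d3
    have heven : Even (M.low leaf r m x e₁ + M.low leaf r m x e₂ + M.low leaf r m x e₃) := by
      rw [Int.even_iff]; omega
    rw [hloc heven]
    exact good_tri_of_fixed n12 n13 n23 hm heven (hfix e₁ t1 o1) (hfix e₂ t2 o2) hs hs'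
      hx1 hx2 hx3 hx4

lemma good_locSet (hr : Γ.IsCompatible leaf r) (hsum : Even (∑ i, r i)) (hm : 0 < m)
    (hL : 1 < L) (hx : Feas leaf r L m x) (v : V(Γ)) :
    Good m x {e | Γ.Inc e v} (M.locSet leaf r L m x v) := by
  rcases M.vertex_cases v with ⟨hv, e, he, hinc⟩ | ⟨e, f, h, he, hf, h0, h1, h2⟩ | ⟨h, ht, hinj⟩
  · obtain ⟨i, hi⟩ := leaf.surjective ⟨v, hv⟩
    exact M.good_at_leaf hr hsum hm hx (congrArg Subtype.val hi) he hinc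
  · exact M.good_at_loop hr hsum hm hx h he hf h0 h1 h2
  · exact M.good_at_trinode hr hsum hm hL hx h ht hinj

/-- Gluing the local conditions over the tree. -/
lemma good_feas (hr : Γ.IsCompatible leaf r) (hsum : Even (∑ i, r i)) (hm : 0 < m)
    (hL : 1 < L) (hx : Feas leaf r L m x) :
    Good m x Set.univ {y | Feas leaf r L 1 y ∧
      ∀ e, y e = M.low leaf r m x e ∨ y e = M.low leaf r m x e + M.step e} := by
  have := M.trivalent.1
  have := Fintype.ofFinite V(Γ)
  have key := Good.forest (m := m) (x := x) M.trivalent.2.1.isAcyclic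
    (F := fun v : V(Γ) => {e : E(Γ) | Γ.Inc e v}) (C := M.locSet leaf r L m x)
    (p := M.low leaf r m x) (q := fun e => M.low leaf r m x e + M.step e)
    (fun u v huv ⟨e, he, he'⟩ => (M.adj_of_inc huv he he').1)
    (fun u v huv e he f hf => by
      obtain ⟨h, rfl⟩ := M.adj_of_inc huv he.1 he.2
      obtain ⟨_, rfl⟩ := M.adj_of_inc huv hf.1 hf.2
      rfl)
    (fun v y z hyz hy => ⟨hy.1.congr hyz, fun e he => by
      rw [← hyz e he]; exact hy.2 e he⟩)
    (fun v y hy e he => hy.2 e he)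
    (fun v => M.good_locSet hr hsum hm hL hx v) Finset.univ
  convert key using 1
  · ext e
    obtain ⟨v, hv⟩ := exists_vertex_inc e
    simp only [Set.mem_univ, Finset.mem_univ, Set.iUnion_true, Set.mem_iUnion, true_iff]
    exact ⟨v, hv⟩
  · ext y
    simp only [Finset.mem_univ, Set.iInter_true, Set.mem_iInter, locSet, Set.mem_ofPred_eq]
    refine ⟨fun h v => ⟨h.1 v, fun e _ => h.2 e⟩, fun h => ⟨fun v => (h v).1, fun e => ?_⟩⟩
    obtain ⟨v, hv⟩ := exists_vertex_inc e
    exact (h v).2 e hv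

end

lemma balancedSystem (hr : Γ.IsCompatible leaf r) (hsum : Even (∑ i, r i)) {L : ℕ} (hL : 1 < L) :
    BalancedSystem (Feas leaf r L) (parity leaf r) M.step where
  zero := feas_zero
  add := Feas.add
  pos := M.step_pos
  dvd hx := M.step_dvd hr hsum hx
  good hm hx := M.good_feas hr hsum hm hL hx

end TreeModel

/-- The integer weightings in the `m`-fold Minkowski sum satisfy the local conditions of
degree `m`. -/
lemma feas_of_mem_minkowskiMultiple {L m : ℕ} {y : E(Γ) → ℤ} (hΛ : y ∈ Γ.weightLattice)
    (hy : (fun e => (y e : ℝ)) ∈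
      LatticePolytope.minkowskiMultiple (Γ.weightPolytope leaf r (2 * L)) m) :
    Feas leaf r L m y := by
  obtain ⟨p, hp, hpy⟩ := hy
  have hval : ∀ e, (y e : ℝ) = ∑ k, p k e := fun e => by
    rw [← congrFun hpy e, Finset.sum_apply]
  intro v
  refine ⟨fun h => ⟨hΛ v h, ?_⟩, fun i hi e he => ?_, fun e _ => ?_⟩
  · have h1 : ∀ k, p k (h 0).edge ≤ p k (h 1).edge + p k (h 2).edge := fun k => by
      linarith [abs_le.mp ((hp k).2.1 v h).1]
    have h2 : ∀ k, p k (h 1).edge ≤ p k (h 0).edge + p k (h 2).edge := fun k => by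
      linarith [abs_le.mp ((hp k).2.1 v h).1]
    have h3 : ∀ k, p k (h 2).edge ≤ p k (h 0).edge + p k (h 1).edge := fun k =>
      ((hp k).2.1 v h).2.1
    have h4 : ∀ k, p k (h 0).edge + p k (h 1).edge + p k (h 2).edge ≤ 4 * L := fun k => by
      have := ((hp k).2.1 v h).2.2
      push_cast at this
      linarith
    have g1 := Finset.sum_le_sum fun k (_ : k ∈ Finset.univ) => h1 k
    have g2 := Finset.sum_le_sum fun k (_ : k ∈ Finset.univ) => h2 k
    have g3 := Finset.sum_le_sum fun k (_ : k ∈ Finset.univ) => h3 k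
    have g4 := Finset.sum_le_sum fun k (_ : k ∈ Finset.univ) => h4 k
    simp only [Finset.sum_add_distrib, ← hval, Finset.sum_const, Finset.card_univ,
      Fintype.card_fin, nsmul_eq_mul] at g1 g2 g3 g4
    refine ⟨by exact_mod_cast g1, by exact_mod_cast g2, by exact_mod_cast g3, ?_⟩
    rw [mul_comm (4 * (L : ℤ))]
    exact_mod_cast g4
  · have h1 : ∀ k, p k e = r i := fun k => (hp k).2.2 i e (hi ▸ he)
    have := hval e
    simp only [h1, Finset.sum_const, Finset.card_univ, Fintype.card_fin, nsmul_eq_mul] at this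
    exact_mod_cast this
  · have : (0 : ℝ) ≤ y e := by
      rw [hval]
      exact Finset.sum_nonneg fun k _ => (hp k).1 e
    exact_mod_cast this

/-- The lattice points of the polytope are the integer weightings satisfying the local conditions
of degree one. -/
lemma feas_one_iff (M : Γ.TreeModel) {L : ℕ} {y : E(Γ) → ℤ} :
    Feas leaf r L 1 y ↔
      y ∈ Γ.weightLattice ∧ (fun e => (y e : ℝ)) ∈ Γ.weightPolytope leaf r (2 * L) := by
  constructor
  · intro hy
    have hmem : ∀ (v : α), Fin 3 ≃ Γ.HalfEdgeAt v → v ∈ V(Γ) := fun v h =>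
      (inc_halfEdge (h 0)).vertex_mem
    refine ⟨fun v h => ((hy ⟨v, hmem v h⟩).1 h).1, fun e => ?_, fun v h => ?_, fun i e he => ?_⟩
    · obtain ⟨v, hv⟩ := exists_vertex_inc e
      show (0 : ℝ) ≤ y e
      exact_mod_cast (hy v).2.2 e hv
    · obtain ⟨h1, h2, h3, h4⟩ := ((hy ⟨v, hmem v h⟩).1 h).2
      have h1' : (y (h 0).edge : ℝ) ≤ y (h 1).edge + y (h 2).edge := by exact_mod_cast h1
      have h2' : (y (h 1).edge : ℝ) ≤ y (h 0).edge + y (h 2).edge := by exact_mod_cast h2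
      have h3' : (y (h 2).edge : ℝ) ≤ y (h 0).edge + y (h 1).edge := by exact_mod_cast h3
      have h4' : (y (h 0).edge : ℝ) + y (h 1).edge + y (h 2).edge ≤ 4 * L * (1 : ℕ) := by
        exact_mod_cast h4
      refine ⟨abs_le.mpr ⟨by linarith, by linarith⟩, h3', ?_⟩
      push_cast at h4' ⊢
      linarith
    · show (y e : ℝ) = r i
      rw [hy.eq_at_leaf M he]
      simp
  · rintro ⟨hΛ, hy⟩
    exact feas_of_mem_minkowskiMultiple hΛ ⟨fun _ => fun e => (y e : ℝ), fun _ => hy, by simp⟩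

end Graph

theorem mainTheorem2 {α β : Type*} (Γ : Graph α β) (hΓ : Γ.IsTreeLike)
    (n : ℕ) (leaf : Fin n ≃ Γ.Leaf) (r : Fin n → ℕ) (hr : Γ.IsCompatible leaf r)
    (hsum : Even (∑ i, r i)) (L : ℕ) (hL : 1 < L) :
    LatticePolytope.IsNormal (Γ.weightPolytope leaf r (2 * L)) Γ.weightLattice ∧
    MvPolynomial.IsGeneratedInDegreeLE
      (LatticePolytope.toricIdeal (Γ.weightPolytope leaf r (2 * L)) Γ.weightLattice) 3 := by
  obtain ⟨M⟩ := hΓ.nonempty_treeModel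
  have := M.finite_edgeSet
  exact LatticePolytope.isNormal_and_isGeneratedInDegreeLE (M.balancedSystem hr hsum hL)
    (fun _ => Graph.feas_one_iff M) fun _ _ => Graph.feas_of_mem_minkowskiMultiple
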